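/- Let $G=\langle a_1,\dots,a_m\mid R\rangle$ be a finitely presented group ($R$ a finite set of words in the $a_i^{\pm1}$), and let $\lambda$ be the maximal length of a relator in $R$. For a van Kampen diagram $D$ over the presentation (a finite connected, simply connected planar diagram, possibly a single vertex, whose oriented edges are labelled by letters $a_i^{\pm1}$, opposite orientations carrying inverse letters, and each of whose faces reads along its boundary a relator or the inverse of a relator up to cyclic permutation), let $|\partial D|$ be the length of its boundary word and let the area of $D$ be \[ \mathcal{A}(D)=\sum_{f\text{ face of }D}|\partial f| . \] Call $D$ minimal if it has the least area among all van Kampen diagrams with the same boundary word. Suppose that for some constant $C>0$ every minimal van Kampen diagram $D$ satisfies \[ |\partial D|\ \ge\ C\,\mathcal{A}(D). \] Then $G$ is hyperbolic, and its Rips constant $\delta$ with respect to this presentation satisfies \[ \delta\ \le\ \frac{12\,\lambda}{C^{2}} ; \] that is, in every geodesic triangle of the Cayley graph of $G$ with respect to $a_1,\dots,a_m$ (a metric graph with all edges of length $1$), every side is contained in the closed $12\lambda/C^2$-neighbourhood of the union of the two other sides. -/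

import Mathlib

noncomputable section

/-- A word in the letters `a` and `a⁻¹`, `a ∈ α`; the letter `(a, true)` is `a` and `(a, false)` is
`a⁻¹` (the convention of `FreeGroup`). -/
abbrev GenWord (α : Type*) := List (α × Bool)

/-- The group `⟨α | R⟩`, where the relators are given as words. -/
abbrev GroupOf {α : Type*} (R : Finset (GenWord α)) : Type _ :=
  PresentedGroup (FreeGroup.mk '' (R : Set (GenWord α)))

/-- The element of `⟨α | R⟩` represented by a word. -/
def wordValue {α : Type*} (R : Finset (GenWord α)) (w : GenWord α) : GroupOf R :=
  PresentedGroup.mk _ (FreeGroup.mk w)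

/-- The maximal length of a relator (`0` if there are no relators). -/
def maxRelatorLength {α : Type*} (R : Finset (GenWord α)) : ℕ := R.sup List.length

/-! ### Van Kampen diagrams -/

/-- A finite connected planar graph with at least one edge, embedded in the sphere and with a
distinguished (outer) face, given as a combinatorial map, whose oriented edges carry letters and
whose inner faces carry relators.

* `Dart` is the set of oriented edges, `rev` reverses an oriented edge, and `next d` is the oriented
  edge that follows `d` on the boundary of the face on a fixed side of `d`.
* The edges, faces and vertices are the orbits of `rev`, of `next` and of `next * rev`
  (the latter permutes the darts with a given origin).
* The map is connected, and `V - E + F = 2` says that the surface is the sphere.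
* `root` is a dart on the boundary of the outer face, at which the boundary word starts. -/
structure PlanarLabelledMap {α : Type*} (R : Finset (GenWord α)) where
  Dart : Type
  fintypeDart : Fintype Dart
  rev : Equiv.Perm Dart
  next : Equiv.Perm Dart
  rev_rev : ∀ d, rev (rev d) = d
  rev_ne : ∀ d, rev d ≠ d
  connected : ∀ d e : Dart, ∃ g ∈ Subgroup.closure {rev, next}, g d = e
  euler :
    Nat.card (Quotient (Equiv.Perm.SameCycle.setoid (next * rev))) +
        Nat.card (Quotient (Equiv.Perm.SameCycle.setoid next)) =
      Nat.card (Quotient (Equiv.Perm.SameCycle.setoid rev)) + 2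
  letter : Dart → α × Bool
  letter_rev : ∀ d, letter (rev d) = ((letter d).1, !(letter d).2)
  root : Dart
  /-- Every inner face reads, from a suitable starting point, a relator or its inverse. -/
  inner_face : ∀ d, ¬ next.SameCycle root d → ∃ r ∈ R,
    ((List.range (Function.minimalPeriod next d)).map fun i => letter (next^[i] d)).IsRotated r ∨
    ((List.range (Function.minimalPeriod next d)).map fun i => letter (next^[i] d)).IsRotated
      (FreeGroup.invRev r)

namespace PlanarLabelledMap

variable {α : Type*} {R : Finset (GenWord α)} (M : PlanarLabelledMap R)

instance : Fintype M.Dart := M.fintypeDart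

/-- The faces, including the outer one. -/
def Face : Type := Quotient (Equiv.Perm.SameCycle.setoid M.next)

/-- The face on whose boundary a dart lies. -/
def face (d : M.Dart) : M.Face := Quotient.mk (Equiv.Perm.SameCycle.setoid M.next) d

instance : Finite M.Face := inferInstanceAs (Finite (Quotient _))

instance : Fintype M.Face := Fintype.ofFinite _

/-- The length of the boundary of a face (an edge with this face on both sides counts twice). -/
def faceLength (f : M.Face) : ℕ := Nat.card {d : M.Dart // M.face d = f}

/-- The word read along the boundary of the face of `d`, starting with `d`. -/
def faceWord (d : M.Dart) : GenWord α :=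
  (List.range (Function.minimalPeriod M.next d)).map fun i => M.letter (M.next^[i] d)

open Classical in
/-- The sum of the boundary lengths of the inner faces. -/
def area : ℕ := ∑ f ∈ Finset.univ.erase (M.face M.root), M.faceLength f

end PlanarLabelledMap

/-- A van Kampen diagram over the presentation `⟨α | R⟩`: either a single vertex, or a labelled
planar diagram with at least one edge. -/
inductive VanKampenDiagram {α : Type*} (R : Finset (GenWord α)) where
  | point : VanKampenDiagram R
  | ofMap : PlanarLabelledMap R → VanKampenDiagram R

namespace VanKampenDiagram

variable {α : Type*} {R : Finset (GenWord α)}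

/-- The word read along the boundary `∂D`; its length is the boundary length. -/
def boundaryWord : VanKampenDiagram R → GenWord α
  | point => []
  | ofMap M => M.faceWord M.root

/-- The boundary length `|∂D|`. -/
def boundaryLength (D : VanKampenDiagram R) : ℕ := D.boundaryWord.length

/-- The area `𝒜(D)`: the sum of the boundary lengths of the faces of `D`. -/
def area : VanKampenDiagram R → ℕ
  | point => 0
  | ofMap M => M.area

/-- `D` has minimal area among the diagrams with the same boundary word. -/
def IsMinimal (D : VanKampenDiagram R) : Prop :=
  ∀ D' : VanKampenDiagram R, D'.boundaryWord = D.boundaryWord → D.area ≤ D'.area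

end VanKampenDiagram

/-! ### The Cayley graph as a metric space -/

section Cayley

variable {α : Type*} {R : Finset (GenWord α)}

/-- `‖g‖`: the minimal length of a word representing `g`. -/
def groupNorm (g : GroupOf R) : ℕ := sInf {n | ∃ w : GenWord α, wordValue R w = g ∧ w.length = n}

theorem exists_word (g : GroupOf R) :
    ∃ w : GenWord α, wordValue R w = g ∧ w.length = groupNorm g := by
  have h : {n | ∃ w : GenWord α, wordValue R w = g ∧ w.length = n}.Nonempty := by
    obtain ⟨x, rfl⟩ := PresentedGroup.mk_surjective _ g
    obtain ⟨w, rfl⟩ := Quot.exists_rep x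
    exact ⟨_, w, rfl, rfl⟩
  exact Nat.sInf_mem h

theorem groupNorm_le (w : GenWord α) : groupNorm (wordValue R w) ≤ w.length :=
  Nat.sInf_le ⟨w, rfl, rfl⟩

theorem groupNorm_one : groupNorm (1 : GroupOf R) = 0 := by
  have h := groupNorm_le (R := R) []
  have : wordValue R [] = 1 := by
    rw [wordValue, ← FreeGroup.one_eq_mk, map_one]
  rw [this] at h
  simpa using h

theorem groupNorm_mul (g h : GroupOf R) : groupNorm (g * h) ≤ groupNorm g + groupNorm h := by
  obtain ⟨v, rfl, hv⟩ := exists_word g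
  obtain ⟨w, rfl, hw⟩ := exists_word h
  have : wordValue R v * wordValue R w = wordValue R (v ++ w) := by
    rw [wordValue, wordValue, wordValue, ← FreeGroup.mul_mk, map_mul]
  rw [← hv, ← hw, this, ← List.length_append]
  exact groupNorm_le _

theorem groupNorm_inv_le (g : GroupOf R) : groupNorm g⁻¹ ≤ groupNorm g := by
  obtain ⟨v, rfl, hv⟩ := exists_word g
  have : (wordValue R v)⁻¹ = wordValue R (FreeGroup.invRev v) := by
    rw [wordValue, wordValue, ← FreeGroup.inv_mk, map_inv]
  rw [← hv, this, ← FreeGroup.invRev_length (L₁ := v)]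
  exact groupNorm_le _

/-- The distance between two vertices of the Cayley graph. -/
def vertexDist (g h : GroupOf R) : ℕ := groupNorm (g⁻¹ * h)

theorem vertexDist_self (g : GroupOf R) : vertexDist g g = 0 := by
  rw [vertexDist, inv_mul_cancel, groupNorm_one]

theorem vertexDist_comm (g h : GroupOf R) : vertexDist g h = vertexDist h g := by
  have key : ∀ a b : GroupOf R, vertexDist a b ≤ vertexDist b a := fun a b => by
    have := groupNorm_inv_le (b⁻¹ * a)
    rwa [mul_inv_rev, inv_inv] at this
  exact le_antisymm (key _ _) (key _ _)

theorem vertexDist_triangle (g h k : GroupOf R) :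
    vertexDist g k ≤ vertexDist g h + vertexDist h k := by
  have := groupNorm_mul (g⁻¹ * h) (h⁻¹ * k)
  rwa [show g⁻¹ * h * (h⁻¹ * k) = g⁻¹ * k by group] at this

/-- A point of the geometric realization of the Cayley graph (all edges have length `1`): the point
at distance `t` from `g` on the edge that joins `g` to `g * a`. -/
structure CayleyGraph {α : Type*} (R : Finset (GenWord α)) where
  base : GroupOf R
  gen : α
  t : ℝ
  t_nonneg : 0 ≤ t
  t_le_one : t ≤ 1

namespace CayleyGraph

/-- The two ends of the edge on which the point lies. -/
def endpoint (p : CayleyGraph R) : Bool → GroupOf R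
  | false => p.base
  | true => p.base * PresentedGroup.of p.gen

/-- The distance along the edge from the point to the two ends. -/
def offset (p : CayleyGraph R) : Bool → ℝ
  | false => p.t
  | true => 1 - p.t

/-- The length of a shortest path from `p` to `q` through vertices: go to an end of the edge of `p`,
then in the graph to an end of the edge of `q`, then to `q`. -/
def throughDist (p q : CayleyGraph R) : ℝ :=
  (Finset.univ : Finset (Bool × Bool)).inf' Finset.univ_nonempty fun e =>
    p.offset e.1 + vertexDist (p.endpoint e.1) (q.endpoint e.2) + q.offset e.2

open Classical in
/-- The path length distance on the Cayley graph: two points of one edge can also be joined within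
this edge. -/
def graphDist (p q : CayleyGraph R) : ℝ :=
  if p.base = q.base ∧ p.gen = q.gen then min |p.t - q.t| (throughDist p q) else throughDist p q

theorem offset_nonneg (p : CayleyGraph R) (i : Bool) : 0 ≤ p.offset i := by
  have := p.t_nonneg
  have := p.t_le_one
  cases i <;> simp [offset] <;> linarith

theorem vertexDist_endpoint (p : CayleyGraph R) (i j : Bool) :
    (vertexDist (p.endpoint i) (p.endpoint j) : ℝ) ≤ p.offset i + p.offset j := by
  have h1 : vertexDist p.base (p.base * PresentedGroup.of p.gen) ≤ 1 := by
    rw [vertexDist, inv_mul_cancel_left]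
    exact groupNorm_le [(p.gen, true)]
  have h2 : vertexDist (p.base * PresentedGroup.of p.gen) p.base ≤ 1 := by
    rwa [vertexDist_comm]
  have h3 : (vertexDist p.base (p.base * PresentedGroup.of p.gen) : ℝ) ≤ 1 := by exact_mod_cast h1
  have h4 : (vertexDist (p.base * PresentedGroup.of p.gen) p.base : ℝ) ≤ 1 := by exact_mod_cast h2
  have := p.t_nonneg
  have := p.t_le_one
  cases i <;> cases j <;> simp only [endpoint, offset, vertexDist_self, Nat.cast_zero] <;> linarith

theorem throughDist_le (p q : CayleyGraph R) (i j : Bool) :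
    throughDist p q ≤ p.offset i + vertexDist (p.endpoint i) (q.endpoint j) + q.offset j :=
  Finset.inf'_le _ (Finset.mem_univ (i, j))

theorem exists_throughDist (p q : CayleyGraph R) : ∃ i j,
    throughDist p q = p.offset i + vertexDist (p.endpoint i) (q.endpoint j) + q.offset j := by
  obtain ⟨e, -, he⟩ := Finset.exists_mem_eq_inf' (s := (Finset.univ : Finset (Bool × Bool)))
    Finset.univ_nonempty fun e =>
      p.offset e.1 + vertexDist (p.endpoint e.1) (q.endpoint e.2) + q.offset e.2
  exact ⟨e.1, e.2, he⟩

theorem throughDist_nonneg (p q : CayleyGraph R) : 0 ≤ throughDist p q := by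
  obtain ⟨i, j, h⟩ := exists_throughDist p q
  rw [h]
  have := p.offset_nonneg i
  have := q.offset_nonneg j
  positivity

theorem throughDist_symm_le (p q : CayleyGraph R) : throughDist p q ≤ throughDist q p := by
  obtain ⟨i, j, h⟩ := exists_throughDist q p
  have := throughDist_le p q j i
  rw [vertexDist_comm] at this
  linarith

theorem throughDist_triangle (p q r : CayleyGraph R) :
    throughDist p r ≤ throughDist p q + throughDist q r := by
  obtain ⟨i, j, h⟩ := exists_throughDist p q
  obtain ⟨k, l, h'⟩ := exists_throughDist q r
  have h1 := throughDist_le p r i l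
  have h2 := vertexDist_endpoint q j k
  have h3 : (vertexDist (p.endpoint i) (r.endpoint l) : ℝ) ≤
      vertexDist (p.endpoint i) (q.endpoint j) + vertexDist (q.endpoint j) (q.endpoint k) +
        vertexDist (q.endpoint k) (r.endpoint l) := by
    have a := vertexDist_triangle (p.endpoint i) (q.endpoint j) (r.endpoint l)
    have b := vertexDist_triangle (q.endpoint j) (q.endpoint k) (r.endpoint l)
    exact_mod_cast (by omega)
  linarith

theorem throughDist_triangle_left (p q r : CayleyGraph R) (hb : p.base = q.base)
    (hg : p.gen = q.gen) : throughDist p r ≤ |p.t - q.t| + throughDist q r := by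
  obtain ⟨k, l, h'⟩ := exists_throughDist q r
  have h1 := throughDist_le p r k l
  have he : p.endpoint k = q.endpoint k := by cases k <;> simp [endpoint, hb, hg]
  have ho : p.offset k ≤ |p.t - q.t| + q.offset k := by
    have := abs_le.1 (le_refl |p.t - q.t|)
    cases k <;> simp only [offset] <;> linarith
  rw [he] at h1
  linarith

theorem graphDist_le_throughDist (p q : CayleyGraph R) : graphDist p q ≤ throughDist p q := by
  unfold graphDist
  split_ifs
  · exact min_le_right _ _
  · exact le_rfl

theorem graphDist_le_abs (p q : CayleyGraph R) (hb : p.base = q.base) (hg : p.gen = q.gen) :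
    graphDist p q ≤ |p.t - q.t| := by
  rw [graphDist, if_pos ⟨hb, hg⟩]
  exact min_le_left _ _

theorem graphDist_cases (p q : CayleyGraph R) : graphDist p q = throughDist p q ∨
    (p.base = q.base ∧ p.gen = q.gen ∧ graphDist p q = |p.t - q.t|) := by
  by_cases h : p.base = q.base ∧ p.gen = q.gen
  · rw [graphDist, if_pos h]
    rcases min_choice |p.t - q.t| (throughDist p q) with h' | h'
    · exact Or.inr ⟨h.1, h.2, h'⟩
    · exact Or.inl h'
  · left
    rw [graphDist, if_neg h]

theorem graphDist_symm_le (p q : CayleyGraph R) : graphDist p q ≤ graphDist q p := by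
  rcases graphDist_cases q p with h | ⟨hb, hg, h⟩
  · rw [h]
    exact (graphDist_le_throughDist p q).trans (throughDist_symm_le p q)
  · rw [h, abs_sub_comm]
    exact graphDist_le_abs p q hb.symm hg.symm

theorem throughDist_comm (p q : CayleyGraph R) : throughDist p q = throughDist q p :=
  le_antisymm (throughDist_symm_le p q) (throughDist_symm_le q p)

theorem graphDist_triangle (p q r : CayleyGraph R) :
    graphDist p r ≤ graphDist p q + graphDist q r := by
  rcases graphDist_cases p q with h | ⟨hb, hg, h⟩ <;>
    rcases graphDist_cases q r with h' | ⟨hb', hg', h'⟩ <;> rw [h, h']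
  · exact (graphDist_le_throughDist p r).trans (throughDist_triangle p q r)
  · refine (graphDist_le_throughDist p r).trans ?_
    have := throughDist_triangle_left r q p hb'.symm hg'.symm
    rw [throughDist_comm r p, throughDist_comm q p, abs_sub_comm] at this
    linarith
  · exact (graphDist_le_throughDist p r).trans (throughDist_triangle_left p q r hb hg)
  · exact (graphDist_le_abs p r (hb.trans hb') (hg.trans hg')).trans (abs_sub_le _ _ _)

theorem graphDist_self (p : CayleyGraph R) : graphDist p p = 0 := by
  rw [graphDist, if_pos ⟨rfl, rfl⟩, sub_self, abs_zero]
  exact min_eq_left (throughDist_nonneg p p)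

/-- The Cayley graph with its path metric. A vertex lies on several edges; the descriptions of one
and the same point are at distance `0` from each other, hence a pseudometric. -/
instance : PseudoMetricSpace (CayleyGraph R) where
  dist := graphDist
  dist_self := graphDist_self
  dist_comm p q := le_antisymm (graphDist_symm_le p q) (graphDist_symm_le q p)
  dist_triangle := graphDist_triangle

end CayleyGraph

end Cayley

/-! ### Hyperbolicity -/

/-- `γ`, restricted to `[0, L]`, is a geodesic from `x` to `y` of length `L`. -/
structure IsGeodesic {X : Type*} [PseudoMetricSpace X] (γ : ℝ → X) (L : ℝ) (x y : X) : Prop where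
  nonneg : 0 ≤ L
  source : γ 0 = x
  target : γ L = y
  isometry : ∀ s ∈ Set.Icc 0 L, ∀ t ∈ Set.Icc 0 L, dist (γ s) (γ t) = |s - t|

/-- The Rips condition: in every geodesic triangle, each side lies in the closed `δ`-neighbourhood
of the union of the two other sides. -/
def RipsHyperbolic (X : Type*) [PseudoMetricSpace X] (δ : ℝ) : Prop :=
  ∀ (x y z : X) (γ₁ γ₂ γ₃ : ℝ → X) (L₁ L₂ L₃ : ℝ),
    IsGeodesic γ₁ L₁ x y → IsGeodesic γ₂ L₂ y z → IsGeodesic γ₃ L₃ z x →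
    ∀ s ∈ Set.Icc 0 L₁,
      (∃ t ∈ Set.Icc 0 L₂, dist (γ₁ s) (γ₂ t) ≤ δ) ∨ (∃ t ∈ Set.Icc 0 L₃, dist (γ₁ s) (γ₃ t) ≤ δ)

end

/-! Write λ for the maximal relator length and a = λ/C. The argument is an integration of one-forms
over diagrams. For 1-Lipschitz functions F, T on the vertices, the discrete form F dT has integral
at most n²/8 in absolute value around a closed path of length n (`abs_sum_area_le`), hence at most
(λ/8)·|∂f| around a face f. Van Kampen's lemma (`exists_diagram`) fills every closed path by a
diagram, hence by a minimal one. The boundary integral is, up to sign, the sum of the integrals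
around the inner faces (`PlanarLabelledMap.lineIntegral_boundary`), so the isoperimetric hypothesis
bounds the integral of F dT along any closed word w by (a/8)·|w|.

For a geodesic side of length G, let T be the distance from its initial vertex and F a bump of
height h around its middle part, where 2h is cut off at both ends. If the rest of a closed path
avoids the h-neighbourhood of this middle part, only the side contributes, and it contributes at
least h(G - 4h) (`LinearIsoperimetric.strip`). In a geodesic triangle take h to be a rounded up, and
consider a maximal stretch of one side whose interior vertices are farther than 2h from the other
two sides. It bounds a quadrilateral or a hexagon with sides separated in this way. The strip
inequality for the longest separated side gives G ≤ 24a - 4h - 4, so every vertex is within 12a - 2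
of the other sides (`LinearIsoperimetric.thin_triangle`). Passing from vertices to points of real
geodesics costs another 2. This needs a ≥ 1, and 12a ≤ 12λ/C² when C ≤ 1.

If C > 1 or λ = 0, all closed line integrals vanish, by induction on the length
(`LinearIsoperimetric.lineIntegral_eq_zero`). Each edge then has a height function that jumps only
across that edge, so the graph is a tree and δ = 0 works
(`LinearIsoperimetric.ripsHyperbolic_zero`).

Van Kampen's lemma has an algebraic half, which turns a word representing 1 into a recipe of spurs
and chords (`fillable_of_wordValue_eq_one`), and a topological half, which carries out the recipe on
combinatorial maps. A pair of disjoint primal and dual spanning trees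
(`CombinatorialMap.exists_tree_pair`) replaces planar topology: it shows that the genus is
nonnegative, and that a planar diagram maps to the Cayley graph
(`CombinatorialMap.exists_potential`). -/

noncomputable section

/-! ### Relator insertions into words -/

/-- The inverse letter. -/
abbrev invLetter {α : Type*} (x : α × Bool) : α × Bool := (x.1, !x.2)

/-- A word is a relator or an inverse relator up to cyclic permutation. -/
def IsRelatorWord {α : Type*} (R : Finset (GenWord α)) (u : GenWord α) : Prop :=
  ∃ r ∈ R, u.IsRotated r ∨ u.IsRotated (FreeGroup.invRev r)

/-- `Expand R n w W`: the word `W` arises from `w` by `n` successive insertions of relator words. -/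
inductive Expand {α : Type*} (R : Finset (GenWord α)) : ℕ → GenWord α → GenWord α → Prop
  | refl (w : GenWord α) : Expand R 0 w w
  | insert {n : ℕ} {w b W : GenWord α} (p r q : GenWord α) (h : Expand R n w b) (hb : b = p ++ q)
      (hr : IsRelatorWord R r) (hW : W = p ++ r ++ q) : Expand R (n + 1) w W

/-- Boundary words of diagrams that are built by adding one edge at a time in the outer face:
either a spur, or a chord that cuts off a new face. -/
inductive Fillable {α : Type*} (R : Finset (GenWord α)) : GenWord α → Prop
  | nil : Fillable R []
  | spur (p q : GenWord α) (x : α × Bool) (h : Fillable R (p ++ q)) :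
      Fillable R (p ++ x :: invLetter x :: q)
  | chord (p u q : GenWord α) (x : α × Bool) (h : Fillable R (p ++ u ++ q))
      (hr : IsRelatorWord R (invLetter x :: u)) : Fillable R (p ++ x :: q)

variable {α : Type*} {R : Finset (GenWord α)}

theorem invLetter_invLetter (x : α × Bool) : invLetter (invLetter x) = x := by
  simp [invLetter]

theorem IsRelatorWord.congr_rotated {u v : GenWord α} (h : IsRelatorWord R u) (huv : v.IsRotated u) :
    IsRelatorWord R v := by
  obtain ⟨r, hr, h | h⟩ := h
  · exact ⟨r, hr, Or.inl (huv.trans h)⟩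
  · exact ⟨r, hr, Or.inr (huv.trans h)⟩

theorem isRotated_append_swap (a b : GenWord α) : (b ++ a).IsRotated (a ++ b) := by
  refine ⟨b.length, ?_⟩
  simp

theorem IsRelatorWord.swap {a b : GenWord α} (h : IsRelatorWord R (a ++ b)) :
    IsRelatorWord R (b ++ a) :=
  h.congr_rotated (isRotated_append_swap a b)

theorem invRev_isRotated {u v : GenWord α} (h : u.IsRotated v) :
    (FreeGroup.invRev u).IsRotated (FreeGroup.invRev v) := by
  unfold FreeGroup.invRev
  exact (h.map _).reverse

theorem IsRelatorWord.invRev {u : GenWord α} (h : IsRelatorWord R u) :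
    IsRelatorWord R (FreeGroup.invRev u) := by
  obtain ⟨r, hr, h | h⟩ := h
  · exact ⟨r, hr, Or.inr (invRev_isRotated h)⟩
  · refine ⟨r, hr, Or.inl ?_⟩
    simpa using invRev_isRotated h

namespace Expand

theorem append_left {n : ℕ} {a A : GenWord α} (h : Expand R n a A) (b : GenWord α) :
    Expand R n (b ++ a) (b ++ A) := by
  induction h with
  | refl w => exact .refl _
  | insert p r q _ hb hr hW ih =>
    subst hb hW
    exact .insert (b ++ p) r q ih (by simp) hr (by simp)

theorem append_right {n : ℕ} {a A : GenWord α} (h : Expand R n a A) (b : GenWord α) :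
    Expand R n (a ++ b) (A ++ b) := by
  induction h with
  | refl w => exact .refl _
  | insert p r q _ hb hr hW ih =>
    subst hb hW
    exact .insert p r (q ++ b) ih (by simp) hr (by simp)

theorem trans {n m : ℕ} {a b c : GenWord α} (h : Expand R n a b) (h' : Expand R m b c) :
    Expand R (n + m) a c := by
  induction h' with
  | refl w => exact h
  | insert p r q _ hb hr hW ih => exact .insert p r q (ih h) hb hr hW

theorem append {n m : ℕ} {a A b B : GenWord α} (h : Expand R n a A) (h' : Expand R m b B) :
    Expand R (n + m) (a ++ b) (A ++ B) :=
  (h.append_right b).trans (h'.append_left A)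

theorem insert_nested {n m : ℕ} {w a b T : GenWord α} (h : Expand R n w (a ++ b))
    (hT : Expand R m [] T) : Expand R (n + m) w (a ++ T ++ b) := by
  refine h.trans ?_
  have := (hT.append_left a).append_right b
  simpa using this

theorem split {n : ℕ} {w W : GenWord α} (h : Expand R n w W) :
    ∀ a b, w = a ++ b → ∃ A B i j, W = A ++ B ∧ Expand R i a A ∧ Expand R j b B ∧ i + j = n := by
  induction h with
  | refl w => exact fun a b h => ⟨a, b, 0, 0, h, .refl _, .refl _, rfl⟩
  | insert p r q _ hb hr hW ih =>
    intro a b hab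
    obtain ⟨A, B, i, j, h1, h2, h3, rfl⟩ := ih a b hab
    subst hW
    rw [hb] at h1
    rcases List.append_eq_append_iff.1 h1 with ⟨c, rfl, rfl⟩ | ⟨c, rfl, rfl⟩
    · exact ⟨p ++ r ++ c, B, i + 1, j, by simp, .insert p r c h2 rfl hr rfl, h3, by omega⟩
    · exact ⟨A, c ++ r ++ q, i, j + 1, by simp, h2, .insert c r q h3 rfl hr rfl, by omega⟩

theorem split_singleton {n : ℕ} {w W : GenWord α} (h : Expand R n w W) :
    ∀ x, w = [x] → ∃ A B i j, W = A ++ x :: B ∧ Expand R i [] A ∧ Expand R j [] B ∧ i + j = n := by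
  induction h with
  | refl w => exact fun x h => ⟨[], [], 0, 0, h, .refl _, .refl _, rfl⟩
  | insert p r q _ hb hr hW ih =>
    intro x hx
    obtain ⟨A, B, i, j, h1, h2, h3, rfl⟩ := ih x hx
    subst hW
    rw [hb] at h1
    rcases List.append_eq_append_iff.1 h1 with ⟨c, rfl, rfl⟩ | ⟨c, rfl, h4⟩
    · exact ⟨p ++ r ++ c, B, i + 1, j, by simp, .insert p r c h2 rfl hr rfl, h3, by omega⟩
    · rcases c with _ | ⟨y, c⟩
      · simp only [List.nil_append] at h4
        subst h4
        exact ⟨A ++ r, B, i + 1, j, by simp, .insert A r [] h2 (by simp) hr (by simp), h3, by omega⟩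
      · simp only [List.cons_append, List.cons.injEq] at h4
        obtain ⟨rfl, rfl⟩ := h4
        exact ⟨A, c ++ r ++ q, i, j + 1, by simp, h2, .insert c r q h3 rfl hr rfl, by omega⟩

theorem split_cons {n : ℕ} {x : α × Bool} {w W : GenWord α} (h : Expand R n (x :: w) W) :
    ∃ A B i j, W = A ++ x :: B ∧ Expand R i [] A ∧ Expand R j w B ∧ i + j = n := by
  obtain ⟨A, B, i, j, rfl, h1, h2, rfl⟩ := h.split [x] w rfl
  obtain ⟨A', B', k, l, rfl, h3, h4, rfl⟩ := h1.split_singleton x rfl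
  exact ⟨A', B' ++ B, k, l + j, by simp, h3, by simpa using h4.append h2, by omega⟩

/-- Relator words are closed under rotation. If the cut falls inside the last inserted relator, the
rotated relator is inserted first and the rotated remainder is nested inside it. -/
theorem rotate_nested {n : ℕ} {w W : GenWord α} (h : Expand R n w W) :
    ∀ a b, w = [] → W = a ++ b → ∃ m, Expand R m [] (b ++ a) := by
  induction h with
  | refl w =>
    intro a b hw hab
    subst hw
    obtain ⟨rfl, rfl⟩ := List.append_eq_nil_iff.1 hab.symm
    exact ⟨0, .refl _⟩
  | insert p r q _ hb hr hW ih =>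
    intro a b hw hab
    subst hW hb
    rw [List.append_assoc] at hab
    rcases List.append_eq_append_iff.1 hab with ⟨c, rfl, h1⟩ | ⟨c, rfl, rfl⟩
    · rcases List.append_eq_append_iff.1 h1 with ⟨d, rfl, rfl⟩ | ⟨d, rfl, rfl⟩
      · obtain ⟨m, hm⟩ := ih (p ++ d) b hw (by simp)
        exact ⟨m + 1, .insert (b ++ p) r d hm (by simp) hr (by simp)⟩
      · obtain ⟨m, hm⟩ := ih p q hw rfl
        have h2 : Expand R 1 [] (d ++ c) :=
          .insert [] (d ++ c) [] (.refl _) rfl hr.swap (by simp)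
        exact ⟨1 + m, by simpa using h2.insert_nested hm⟩
    · obtain ⟨m, hm⟩ := ih a (c ++ q) hw (by simp)
      exact ⟨m + 1, .insert c r (q ++ a) hm (by simp) hr (by simp)⟩

/-- The decomposition `B₁ ++ y :: B₂` of an expansion of `w` (by `n` insertions) has its letter `y`
either from `w` or from one of the inserted relators. -/
def LetterOrigin (R : Finset (GenWord α)) (n : ℕ) (w : GenWord α) (y : α × Bool)
    (B₁ B₂ : GenWord α) : Prop :=
  (∃ w₁ w₂ i j, w = w₁ ++ y :: w₂ ∧ Expand R i w₁ B₁ ∧ Expand R j w₂ B₂ ∧ i + j = n) ∨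
  (∃ A S₁ S₂ D r₁ r₂ i j k, B₁ = A ++ S₁ ∧ B₂ = S₂ ++ D ∧ IsRelatorWord R (r₁ ++ y :: r₂) ∧
    Expand R i w (A ++ D) ∧ Expand R j r₁ S₁ ∧ Expand R k r₂ S₂ ∧ i + j + k + 1 = n)

theorem LetterOrigin.insert_left {n : ℕ} {w : GenWord α} {y : α × Bool} {p r q B₂ : GenWord α}
    (hr : IsRelatorWord R r) (h : LetterOrigin R n w y (p ++ q) B₂) :
    LetterOrigin R (n + 1) w y (p ++ r ++ q) B₂ := by
  rcases h with ⟨w₁, w₂, i, j, h3, h4, h5, rfl⟩ |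
    ⟨A, S₁, S₂, D, r₁, r₂, i, j, k, h3, h4, h5, h6, h7, h8, rfl⟩
  · exact Or.inl ⟨w₁, w₂, i + 1, j, h3, .insert p r q h4 rfl hr rfl, h5, by omega⟩
  · refine Or.inr ?_
    rcases List.append_eq_append_iff.1 h3 with ⟨c, rfl, rfl⟩ | ⟨c, rfl, rfl⟩
    · exact ⟨p ++ r ++ c, S₁, S₂, D, r₁, r₂, i + 1, j, k, by simp, h4, h5,
        .insert p r (c ++ D) h6 (by simp) hr (by simp), h7, h8, by omega⟩
    · exact ⟨A, c ++ r ++ q, S₂, D, r₁, r₂, i, j + 1, k, by simp, h4, h5, h6,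
        .insert c r q h7 rfl hr rfl, h8, by omega⟩

theorem LetterOrigin.insert_right {n : ℕ} {w : GenWord α} {y : α × Bool} {p r q B₁ : GenWord α}
    (hr : IsRelatorWord R r) (h : LetterOrigin R n w y B₁ (p ++ q)) :
    LetterOrigin R (n + 1) w y B₁ (p ++ r ++ q) := by
  rcases h with ⟨w₁, w₂, i, j, h3, h4, h5, rfl⟩ |
    ⟨A, S₁, S₂, D, r₁, r₂, i, j, k, h3, h4, h5, h6, h7, h8, rfl⟩
  · exact Or.inl ⟨w₁, w₂, i, j + 1, h3, h4, .insert p r q h5 rfl hr rfl, by omega⟩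
  · refine Or.inr ?_
    rcases List.append_eq_append_iff.1 h4 with ⟨c, rfl, rfl⟩ | ⟨c, rfl, rfl⟩
    · exact ⟨A, S₁, p ++ r ++ c, D, r₁, r₂, i, j, k + 1, h3, by simp, h5, h6, h7,
        .insert p r c h8 rfl hr rfl, by omega⟩
    · exact ⟨A, S₁, S₂, c ++ r ++ q, r₁, r₂, i + 1, j, k, h3, by simp, h5,
        .insert (A ++ c) r q h6 (by simp) hr (by simp), h7, h8, by omega⟩

/-- The last inserted relator either contains the chosen letter, or lies on one side of it and is
charged to the piece in which it falls. -/
theorem letter_origin {n : ℕ} {w W : GenWord α} (h : Expand R n w W) (y : α × Bool) :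
    ∀ B₁ B₂, W = B₁ ++ y :: B₂ → LetterOrigin R n w y B₁ B₂ := by
  induction h with
  | refl w => exact fun B₁ B₂ h => Or.inl ⟨B₁, B₂, 0, 0, h, .refl _, .refl _, rfl⟩
  | insert p r q hp hb hr hW ih =>
    intro B₁ B₂ hB
    subst hW hb
    rw [List.append_assoc] at hB
    rcases List.append_eq_append_iff.1 hB with ⟨c, rfl, h1⟩ | ⟨c, h2, h1⟩
    · rcases List.append_eq_append_iff.1 h1 with ⟨d, rfl, h3⟩ | ⟨d, rfl, h3⟩
      · have := (ih (p ++ d) B₂ (by simp [h3])).insert_left hr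
        simpa using this
      · rcases d with _ | ⟨z, d⟩
        · have := (ih (p ++ []) B₂ (by simpa using h3.symm)).insert_left hr
          simpa using this
        · simp only [List.cons_append, List.cons.injEq] at h3
          obtain ⟨rfl, rfl⟩ := h3
          exact Or.inr ⟨p, c, d, q, c, d, _, 0, 0, rfl, rfl, hr, hp, .refl _, .refl _, by omega⟩
    · rcases c with _ | ⟨z, c⟩
      · simp only [List.append_nil, List.nil_append] at h1 h2
        subst h2
        rcases r with _ | ⟨z, r⟩
        · simp only [List.nil_append] at h1
          have := (ih (p ++ []) B₂ (by simpa using h1.symm)).insert_left hr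
          simpa using this
        · simp only [List.cons_append, List.cons.injEq] at h1
          obtain ⟨rfl, rfl⟩ := h1
          exact Or.inr ⟨p, [], r, q, [], r, _, 0, 0, by simp, rfl, hr, hp, .refl _, .refl _,
            by omega⟩
      · simp only [List.cons_append, List.cons.injEq] at h1
        obtain ⟨rfl, rfl⟩ := h1
        have := (ih B₁ (c ++ q) (by simp [h2])).insert_right hr
        simpa using this

end Expand

/-! ### Words that become freely trivial after relator insertions -/

/-- The word represents the trivial element of the free group. -/
def FreelyTrivial (w : GenWord α) : Prop := FreeGroup.mk w = 1

theorem mk_cons (x : α × Bool) (w : GenWord α) :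
    FreeGroup.mk (x :: w) = FreeGroup.mk [x] * FreeGroup.mk w := by
  rw [FreeGroup.mul_mk, List.singleton_append]

theorem mk_invLetter (x : α × Bool) : FreeGroup.mk [invLetter x] = (FreeGroup.mk [x])⁻¹ := by
  rw [FreeGroup.inv_mk]
  simp [FreeGroup.invRev]

theorem mk_append (v w : GenWord α) : FreeGroup.mk (v ++ w) = FreeGroup.mk v * FreeGroup.mk w :=
  FreeGroup.mul_mk.symm

theorem mk_spur (p q : GenWord α) (x : α × Bool) :
    FreeGroup.mk (p ++ x :: invLetter x :: q) = FreeGroup.mk (p ++ q) := by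
  rw [mk_append, mk_append, mk_cons, mk_cons (invLetter x), mk_invLetter, mul_inv_cancel_left]

theorem mul_eq_one_swap {G : Type*} [Group G] {a b : G} (h : a * b = 1) : b * a = 1 := by
  rw [← inv_eq_of_mul_eq_one_right h, inv_mul_cancel]

/-- In a freely trivial word each letter cancels against some inverse letter. -/
theorem FreelyTrivial.exists_partner {x : α × Bool} {B : GenWord α} (h : FreelyTrivial (x :: B)) :
    ∃ B₁ B₂, B = B₁ ++ invLetter x :: B₂ ∧ FreelyTrivial B₁ ∧ FreelyTrivial B₂ := by
  have hred : FreeGroup.Red (x :: B) [] := by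
    obtain ⟨c, h1, h2⟩ := FreeGroup.Red.exact.1 (h.trans FreeGroup.one_eq_mk)
    rwa [FreeGroup.Red.nil_iff.1 h2] at h1
  clear h
  generalize hw : x :: B = w at hred
  induction hred using Relation.ReflTransGen.head_induction_on generalizing B with
  | refl => simp at hw
  | head hstep hrest ih =>
    -- The first reduction either cancels `x` with its neighbour, which is then the partner, or
    -- removes a spur inside the rest; that spur is put back beside or into one of the two trivial
    -- pieces.
    cases hstep with
    | @not L₁ L₂ y b =>
      rcases L₁ with _ | ⟨z, L₁⟩
      · simp only [List.nil_append, List.cons.injEq] at hw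
        obtain ⟨rfl, rfl⟩ := hw
        refine ⟨[], L₂, rfl, FreeGroup.one_eq_mk.symm, ?_⟩
        have := FreeGroup.Red.exact.2 ⟨[], hrest, Relation.ReflTransGen.refl⟩
        simpa [FreelyTrivial, FreeGroup.one_eq_mk] using this
      · simp only [List.cons_append, List.cons.injEq] at hw
        obtain ⟨rfl, rfl⟩ := hw
        obtain ⟨B₁, B₂, h1, h2, h3⟩ := ih rfl
        rcases List.append_eq_append_iff.1 h1 with ⟨c, rfl, h4⟩ | ⟨c, rfl, h4⟩
        · refine ⟨L₁ ++ (y, b) :: invLetter (y, b) :: c, B₂, by simp [h4], ?_, h3⟩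
          rw [FreelyTrivial, mk_spur]
          exact h2
        · rcases c with _ | ⟨z, c⟩
          · simp only [List.nil_append] at h4
            refine ⟨B₁ ++ (y, b) :: invLetter (y, b) :: [], B₂, by simp [← h4], ?_, h3⟩
            rw [FreelyTrivial, mk_spur, List.append_nil]
            exact h2
          · simp only [List.cons_append, List.cons.injEq] at h4
            obtain ⟨rfl, rfl⟩ := h4
            refine ⟨B₁, c ++ (y, b) :: invLetter (y, b) :: L₂, by simp, h2, ?_⟩
            rw [FreelyTrivial, mk_spur]
            exact h3

/-- Insertions of relators turn `w` into a freely trivial word. -/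
def Cancellable (R : Finset (GenWord α)) (w : GenWord α) : Prop :=
  ∃ n W, Expand R n w W ∧ FreelyTrivial W

namespace Cancellable

theorem freely_insert {p t q : GenWord α} (ht : FreelyTrivial t) (h : Cancellable R (p ++ q)) :
    Cancellable R (p ++ t ++ q) := by
  obtain ⟨n, W, h1, h2⟩ := h
  obtain ⟨P, Q, i, j, rfl, h3, h4, -⟩ := h1.split p q rfl
  refine ⟨_, P ++ t ++ Q, (h3.append_right t).append h4, ?_⟩
  rw [FreelyTrivial] at *
  rw [mk_append, mk_append, ht, mul_one, ← mk_append, h2]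

/-- The insertions `T` made between `x` and its inverse must find a new place once the spur is gone.
The place is dictated by the letter against which `x` cancels in the cyclic word. -/
theorem delete_spur {p q : GenWord α} {x : α × Bool}
    (h : Cancellable R (p ++ x :: invLetter x :: q)) : Cancellable R (p ++ q) := by
  obtain ⟨n, W, h1, h2⟩ := h
  obtain ⟨P, B, i₁, i₂, rfl, hP, hB, -⟩ := h1.split p _ rfl
  obtain ⟨A, B, j₁, j₂, rfl, hA, hB, -⟩ := hB.split_cons
  obtain ⟨T, Q, k₁, k₂, rfl, hT, hQ, -⟩ := hB.split_cons
  obtain ⟨P', hP'⟩ : ∃ P', P' = P ++ A := ⟨_, rfl⟩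
  have hP : Expand R (i₁ + j₁) p P' := by
    rw [hP']
    simpa using hP.append hA
  have h3 : FreelyTrivial (x :: (T ++ invLetter x :: (Q ++ P'))) := by
    rw [FreelyTrivial, show P ++ (A ++ x :: (T ++ invLetter x :: Q)) =
      P' ++ (x :: (T ++ invLetter x :: Q)) by simp [hP'], mk_append] at h2
    have := mul_eq_one_swap h2
    rw [← mk_append] at this
    simpa [FreelyTrivial] using this
  obtain ⟨B₁, B₂, h4, h5, h6⟩ := h3.exists_partner
  obtain ⟨ξ, hξ⟩ : ∃ ξ, ∀ w, FreeGroup.mk (invLetter x :: w) = ξ * FreeGroup.mk w :=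
    ⟨_, mk_cons _⟩
  have key : ∀ {n : ℕ} {V : GenWord α}, Expand R n (p ++ q) V → FreelyTrivial V →
    Cancellable R (p ++ q) := fun h h' => ⟨_, _, h, h'⟩
  have hPQ := hP.append hQ
  -- The partner of `x` lies in `Q` or `P'`: insert `T` directly in front of that partner.
  have inQP : ∀ L₁, B₁ = T ++ invLetter x :: L₁ → Q ++ P' = L₁ ++ invLetter x :: B₂ →
      Cancellable R (p ++ q) := by
    rintro L₁ rfl h7
    have inP : ∀ P₁, P' = P₁ ++ invLetter x :: B₂ → L₁ = Q ++ P₁ → Cancellable R (p ++ q) := by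
      rintro P₁ h8 rfl
      rw [h8, List.append_assoc] at hPQ
      refine key (hPQ.insert_nested hT) ?_
      simp only [FreelyTrivial, List.append_assoc, mk_append, hξ] at h5 h6 ⊢
      rw [h6]
      have := mul_eq_one_swap (a := FreeGroup.mk T * (ξ *
        FreeGroup.mk Q)) (b := FreeGroup.mk P₁) (by simpa [mul_assoc] using h5)
      simpa [mul_assoc] using this
    rcases List.append_eq_append_iff.1 h7 with ⟨c, rfl, h8⟩ | ⟨c, rfl, h8⟩
    · exact inP c h8 rfl
    · rcases c with _ | ⟨z, c⟩
      · exact inP [] (by simpa using h8.symm) (by simp)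
      · simp only [List.cons_append, List.cons.injEq] at h8
        obtain ⟨rfl, rfl⟩ := h8
        rw [← List.append_assoc] at hPQ
        refine key (hPQ.insert_nested hT) ?_
        simp only [FreelyTrivial, List.append_assoc, mk_append, hξ] at h5 h6 ⊢
        have e1 := mul_eq_one_swap (a := FreeGroup.mk T * ξ)
          (b := FreeGroup.mk L₁) (by simpa [mul_assoc] using h5)
        have e2 := mul_eq_one_swap h6
        calc _ = FreeGroup.mk P' * (FreeGroup.mk L₁ * (FreeGroup.mk T * ξ)) * FreeGroup.mk c := by simp only [mul_assoc]
          _ = 1 := by rw [e1, mul_one, e2]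
  -- The partner lies in `T`: rotate `T` to start after that letter and insert it at the seam of
  -- `P'` and `Q`.
  have inT : ∀ T₂, T = B₁ ++ invLetter x :: T₂ → B₂ = T₂ ++ invLetter x :: (Q ++ P') →
      Cancellable R (p ++ q) := by
    rintro T₂ rfl rfl
    obtain ⟨m, hm⟩ := hT.rotate_nested (B₁ ++ [invLetter x]) T₂ rfl (by simp)
    refine key (hPQ.insert_nested hm) ?_
    simp only [FreelyTrivial, List.append_assoc, mk_append, hξ] at h5 h6 ⊢
    have e := mul_eq_one_swap (a := FreeGroup.mk T₂ * (ξ *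
        FreeGroup.mk Q)) (b := FreeGroup.mk P') (by simpa [mul_assoc] using h6)
    rw [h5, one_mul]
    simpa [mul_assoc] using e
  rcases List.append_eq_append_iff.1 h4 with ⟨c, rfl, h8⟩ | ⟨c, rfl, h8⟩
  · rcases c with _ | ⟨z, c⟩
    · simp only [List.nil_append, List.cons.injEq, true_and] at h8
      subst h8
      refine key hPQ ?_
      rw [FreelyTrivial, mk_append] at *
      exact mul_eq_one_swap h6
    · simp only [List.cons_append, List.cons.injEq] at h8
      obtain ⟨rfl, h8⟩ := h8
      exact inQP c rfl h8
  · rcases c with _ | ⟨z, c⟩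
    · simp only [List.nil_append, List.cons.injEq, true_and] at h8
      subst h8
      refine key hPQ ?_
      rw [FreelyTrivial, mk_append] at *
      exact mul_eq_one_swap h6
    · simp only [List.cons_append, List.cons.injEq] at h8
      obtain ⟨rfl, h8⟩ := h8
      exact inT c rfl h8

/-- Both words reduce to a common word; going down deletes spurs and going up inserts them. -/
theorem congr_mk {p v w q : GenWord α} (hvw : FreeGroup.mk v = FreeGroup.mk w)
    (h : Cancellable R (p ++ v ++ q)) : Cancellable R (p ++ w ++ q) := by
  have down : ∀ {v c : GenWord α}, FreeGroup.Red v c → Cancellable R (p ++ v ++ q) →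
      Cancellable R (p ++ c ++ q) := by
    intro v c hred h
    induction hred with
    | refl => exact h
    | tail _ hstep ih =>
      cases hstep with
      | @not L₁ L₂ y b =>
        have : Cancellable R ((p ++ L₁) ++ (y, b) :: invLetter (y, b) :: (L₂ ++ q)) := by
          simpa using ih
        simpa using this.delete_spur
  have up : ∀ {v c : GenWord α}, FreeGroup.Red v c → Cancellable R (p ++ c ++ q) →
      Cancellable R (p ++ v ++ q) := by
    intro v c hred h
    induction hred with
    | refl => exact h
    | tail _ hstep ih =>
      refine ih ?_
      cases hstep with
      | @not L₁ L₂ y b =>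
        have h1 : FreelyTrivial [(y, b), (y, !b)] := by
          have := mk_spur [] [] (y, b)
          simpa [FreelyTrivial, FreeGroup.one_eq_mk] using this
        have := freely_insert h1 (p := p ++ L₁) (q := L₂ ++ q) (R := R) (by simpa using h)
        simpa using this
  obtain ⟨c, h1, h2⟩ := FreeGroup.Red.exact.1 hvw
  exact up h2 (down h1 h)

/-- The deleted relator can be restored as the very first insertion. -/
theorem delete_relator {p r q : GenWord α} (hr : IsRelatorWord R r)
    (h : Cancellable R (p ++ r ++ q)) : Cancellable R (p ++ q) := by
  obtain ⟨n, W, h1, h2⟩ := h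
  exact ⟨_, W, (Expand.insert p r q (.refl _) rfl hr rfl).trans h1, h2⟩

/-- Insert the freely trivial word `r r⁻¹`, then delete the relator word `r⁻¹`. -/
theorem insert_relator {p r q : GenWord α} (hr : IsRelatorWord R r)
    (h : Cancellable R (p ++ q)) : Cancellable R (p ++ r ++ q) := by
  have h1 : FreelyTrivial (r ++ FreeGroup.invRev r) := by
    rw [FreelyTrivial, mk_append, ← FreeGroup.inv_mk, mul_inv_cancel]
  have h2 := freely_insert h1 h
  rw [← List.append_assoc] at h2
  exact h2.delete_relator hr.invRev

end Cancellable

/-- Words that represent `1` in `⟨α | R⟩` can be inserted. -/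
theorem Cancellable.insert_of_mem {g : FreeGroup α}
    (hg : g ∈ Subgroup.normalClosure (FreeGroup.mk '' (R : Set (GenWord α)))) :
    ∀ w p q, FreeGroup.mk w = g → (Cancellable R (p ++ w ++ q) ↔ Cancellable R (p ++ q)) := by
  unfold Subgroup.normalClosure at hg
  induction hg using Subgroup.closure_induction with
  | mem g hg =>
    intro w p q hw
    obtain ⟨g', ⟨r, hr, rfl⟩, hc⟩ := Group.mem_conjugatesOfSet_iff.1 hg
    obtain ⟨c, hc⟩ := isConj_iff.1 hc
    -- A conjugate `u r u⁻¹` is inserted by first inserting `u u⁻¹` and then `r` in its middle.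
    obtain ⟨u, rfl⟩ := Quot.exists_rep c
    have hr' : IsRelatorWord R r := ⟨r, hr, Or.inl (List.IsRotated.refl r)⟩
    have e1 : FreeGroup.mk w = FreeGroup.mk (u ++ r ++ FreeGroup.invRev u) := by
      rw [hw, mk_append, mk_append, ← FreeGroup.inv_mk, ← hc]
      rfl
    have e2 : FreeGroup.mk (u ++ FreeGroup.invRev u) = FreeGroup.mk [] := by
      rw [mk_append, ← FreeGroup.inv_mk, mul_inv_cancel, FreeGroup.one_eq_mk]
    constructor
    · intro h
      have h1 := h.congr_mk e1
      have h2 : Cancellable R ((p ++ u) ++ r ++ (FreeGroup.invRev u ++ q)) := by simpa using h1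
      have h3 : Cancellable R (p ++ (u ++ FreeGroup.invRev u) ++ q) := by
        simpa using h2.delete_relator hr'
      simpa using h3.congr_mk e2
    · intro h
      refine Cancellable.congr_mk e1.symm ?_
      have h3 : Cancellable R (p ++ (u ++ FreeGroup.invRev u) ++ q) :=
        Cancellable.congr_mk (v := []) e2.symm (by simpa using h)
      have h4 : Cancellable R ((p ++ u) ++ (FreeGroup.invRev u ++ q)) := by simpa using h3
      simpa using h4.insert_relator hr'
  | one =>
    intro w p q hw
    have e : FreeGroup.mk w = FreeGroup.mk [] := by rw [hw, FreeGroup.one_eq_mk]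
    exact ⟨fun h => by simpa using h.congr_mk e, fun h => Cancellable.freely_insert hw h⟩
  | mul g₁ g₂ _ _ ih₁ ih₂ =>
    intro w p q hw
    obtain ⟨w₁, rfl⟩ := Quot.exists_rep g₁
    obtain ⟨w₂, rfl⟩ := Quot.exists_rep g₂
    have e : FreeGroup.mk w = FreeGroup.mk (w₁ ++ w₂) := by rw [hw, mk_append]; rfl
    have h1 : Cancellable R (p ++ w ++ q) ↔ Cancellable R (p ++ (w₁ ++ w₂) ++ q) :=
      ⟨fun h => h.congr_mk e, fun h => h.congr_mk e.symm⟩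
    have h2 := ih₁ w₁ p (w₂ ++ q) rfl
    rw [h1, ← ih₂ w₂ p q rfl]
    simpa using h2
  | inv g _ ih =>
    intro w p q hw
    obtain ⟨u, rfl⟩ := Quot.exists_rep g
    have e : FreeGroup.mk (u ++ w) = FreeGroup.mk [] := by
      rw [mk_append, hw, ← FreeGroup.one_eq_mk]
      exact mul_inv_cancel _
    have h1 : Cancellable R (p ++ (u ++ w) ++ q) ↔ Cancellable R (p ++ [] ++ q) :=
      ⟨fun h => h.congr_mk e, fun h => h.congr_mk e.symm⟩
    have h2 := ih u p (w ++ q) rfl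
    simp only [List.append_assoc, List.nil_append] at h1 h2 ⊢
    rw [← h2, h1]

theorem cancellable_of_wordValue_eq_one {w : GenWord α} (h : wordValue R w = 1) :
    Cancellable R w := by
  have h1 : FreeGroup.mk w ∈ Subgroup.normalClosure (FreeGroup.mk '' (R : Set (GenWord α))) :=
    (QuotientGroup.eq_one_iff _).1 h
  have h2 := (Cancellable.insert_of_mem h1 w [] [] rfl).2
    ⟨0, [], .refl _, FreeGroup.one_eq_mk.symm⟩
  simpa using h2

/-! ### From relator insertions to spurs and chords -/

theorem Fillable.insert {t : GenWord α} (ht : Fillable R t) :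
    ∀ p q, Fillable R (p ++ q) → Fillable R (p ++ t ++ q) := by
  induction ht with
  | nil => intro p q h; simpa using h
  | spur a b x _ ih =>
    intro p q h
    have h1 : Fillable R ((p ++ a) ++ (b ++ q)) := by simpa using ih p q h
    simpa using Fillable.spur _ _ x h1
  | chord a u b x _ hr ih =>
    intro p q h
    have h1 : Fillable R ((p ++ a) ++ u ++ (b ++ q)) := by simpa using ih p q h
    simpa using Fillable.chord _ _ _ x h1 hr

/-- The partner of the first letter `x` decides the last edge of the diagram: a spur if the partner
belongs to `w`, a chord if it belongs to an inserted relator. The induction is lexicographic in the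
number of insertions and the length, since a chord lengthens the word but saves an insertion. -/
theorem fillable_of_expand (n : ℕ) : ∀ (k : ℕ) (w W : GenWord α), w.length ≤ k →
    Expand R n w W → FreelyTrivial W → Fillable R w := by
  induction n using Nat.strong_induction_on with
  | _ n ihn =>
  intro k
  induction k using Nat.strong_induction_on generalizing n with
  | _ k ihk =>
  intro w W hk hW hF
  rcases w with _ | ⟨x, w⟩
  · exact .nil
  obtain ⟨A, B, i, j, rfl, hA, hB, hij⟩ := hW.split_cons
  have hF' : FreelyTrivial (x :: (B ++ A)) := by
    rw [FreelyTrivial, mk_append] at hF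
    have := mul_eq_one_swap hF
    rw [← mk_append] at this
    simpa [FreelyTrivial] using this
  obtain ⟨B₁, B₂, h1, h2, h3⟩ := hF'.exists_partner
  -- The insertions in front of `x` are moved cyclically to the end of the word.
  have hBA : Expand R n w (B ++ A) := by
    have := hB.append hA
    rwa [add_comm, hij, List.append_nil] at this
  simp only [List.length_cons] at hk
  rcases hBA.letter_origin _ _ _ h1 with ⟨w₁, w₂, i', j', rfl, h4, h5, h6⟩ |
    ⟨A', S₁, S₂, D, r₁, r₂, i', j', k', rfl, rfl, h4, h5, h6, h7, h8⟩
  · simp only [List.length_append, List.length_cons] at hk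
    have f : ∀ (m : ℕ) (v V : GenWord α), m ≤ n → v.length < k → Expand R m v V →
        FreelyTrivial V → Fillable R v := by
      intro m v V hm hv hE hV
      rcases hm.lt_or_eq with hm | rfl
      · exact ihn m hm _ v V le_rfl hE hV
      · exact ihk _ hv m ihn v V le_rfl hE hV
    have f1 := f i' w₁ B₁ (by omega) (by omega) h4 h2
    have f2 := f j' w₂ B₂ (by omega) (by omega) h5 h3
    have f3 := f1.insert [x] (invLetter x :: w₂) (Fillable.spur [] w₂ x f2)
    simpa using f3
  -- Replacing `x` by the complementary part `r₂ r₁` of the relator undoes its insertion; the new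
  -- expansion is trivial because `S₁ A'` and `S₂ D` are.
  · have h9 : Expand R (k' + j' + i') (r₂ ++ r₁ ++ w) (S₂ ++ S₁ ++ (A' ++ D)) :=
      (h7.append h6).append h5
    have h10 : FreelyTrivial (S₂ ++ S₁ ++ (A' ++ D)) := by
      rw [FreelyTrivial, mk_append] at h2 h3
      simp only [FreelyTrivial, mk_append]
      have := mul_eq_one_swap h2
      rw [mul_assoc, ← mul_assoc (FreeGroup.mk S₁), this, one_mul, h3]
    have h11 := ihn _ (by omega) _ _ _ le_rfl h9 h10
    exact Fillable.chord [] (r₂ ++ r₁) w x h11 (by simpa using h4.swap)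

theorem fillable_of_wordValue_eq_one {w : GenWord α} (h : wordValue R w = 1) : Fillable R w := by
  obtain ⟨n, W, h1, h2⟩ := cancellable_of_wordValue_eq_one h
  exact fillable_of_expand n _ w W le_rfl h1 h2

end

/-! ### Spanning trees, genus and potentials for combinatorial maps -/

noncomputable section

/-- Breadth first search: if every node can be reached from `y₀` along darts, then each other node
has a dart towards a node of smaller depth. -/
theorem exists_parent_dart {X Y : Type*} [Nonempty X] (s t : X → Y) (S : X → Prop) (y₀ : Y)
    (h : ∀ P : Y → Prop, P y₀ → (∀ d, S d → P (t d) → P (s d)) → ∀ y, P y) :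
    ∃ (dep : Y → ℕ) (par : Y → X),
      ∀ y, y ≠ y₀ → S (par y) ∧ s (par y) = y ∧ dep (t (par y)) < dep y := by
  classical
  let reach : ℕ → Y → Prop := fun n =>
    n.rec (fun y => y = y₀) (fun _ r y => ∃ d, S d ∧ s d = y ∧ r (t d))
  let dep : Y → ℕ := fun y => sInf {n | reach n y}
  have hr : ∀ y, ∃ n, reach n y :=
    h _ ⟨0, rfl⟩ fun d hd ⟨n, hn⟩ => ⟨n + 1, d, hd, rfl, hn⟩
  have key : ∀ y, y ≠ y₀ → ∃ d, S d ∧ s d = y ∧ dep (t d) < dep y := by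
    intro y hy
    have h1 : reach (dep y) y := Nat.sInf_mem (hr y)
    rcases h2 : dep y with _ | n
    · rw [h2] at h1
      exact absurd h1 hy
    · rw [h2] at h1
      obtain ⟨d, hd, hs, hn⟩ := h1
      exact ⟨d, hd, hs, (Nat.sInf_le hn).trans_lt n.lt_succ_self⟩
  refine ⟨dep, fun y => if hy : y ≠ y₀ then (key y hy).choose else Classical.arbitrary X,
    fun y hy => ?_⟩
  simp only [dif_pos hy]
  exact (key y hy).choose_spec

/-- Values at the nodes of a rooted tree can be prescribed recursively. -/
theorem exists_rec_on_parent {Y A : Type*} (dep : Y → ℕ) (y₀ : Y) (up : Y → Y)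
    (hup : ∀ y, y ≠ y₀ → dep (up y) < dep y) (a₀ : A) (step : Y → A → A) :
    ∃ pot : Y → A, pot y₀ = a₀ ∧ ∀ y, y ≠ y₀ → pot y = step y (pot (up y)) := by
  classical
  let F : (y : Y) → ((z : Y) → dep z < dep y → A) → A := fun y r =>
    if hy : y ≠ y₀ then step y (r (up y) (hup y hy)) else a₀
  refine ⟨(measure dep).wf.fix F, ?_, fun y hy => ?_⟩
  · rw [WellFounded.fix_eq]
    simp [F]
  · rw [WellFounded.fix_eq]
    simp only [F, dif_pos hy]

namespace CombinatorialMap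

open Function

variable {X : Type*} (rev next : Equiv.Perm X)

/-- The vertices of the map. -/
abbrev Vertex : Type _ := Quotient (Equiv.Perm.SameCycle.setoid (next * rev))

/-- The faces, or the edges, of the map. -/
abbrev Orbit (σ : Equiv.Perm X) : Type _ := Quotient (Equiv.Perm.SameCycle.setoid σ)

/-- The origin of a dart. -/
def origin (d : X) : Vertex rev next := Quotient.mk (Equiv.Perm.SameCycle.setoid (next * rev)) d

/-- The orbit of a dart. -/
def orbit (σ : Equiv.Perm X) (d : X) : Orbit σ := Quotient.mk (Equiv.Perm.SameCycle.setoid σ) d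

theorem orbit_eq_iff {σ : Equiv.Perm X} {d e : X} : orbit σ d = orbit σ e ↔ σ.SameCycle d e :=
  Quotient.eq

theorem orbit_apply (σ : Equiv.Perm X) (d : X) : orbit σ (σ d) = orbit σ d :=
  orbit_eq_iff.2 (Equiv.Perm.sameCycle_apply_left.2 (Equiv.Perm.SameCycle.refl _ _))

theorem origin_next {rev next : Equiv.Perm X} (h2 : ∀ d, rev (rev d) = d) (d : X) :
    origin rev next (next d) = origin rev next (rev d) := by
  have := orbit_apply (next * rev) (rev d)
  rw [Equiv.Perm.mul_apply, h2] at this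
  exact this

theorem orbit_iterate (σ : Equiv.Perm X) (n : ℕ) (d : X) : orbit σ (σ^[n] d) = orbit σ d := by
  induction n with
  | zero => rfl
  | succ n ih => rw [iterate_succ_apply', orbit_apply, ih]

theorem orbit_rev_eq_iff {rev : Equiv.Perm X} (h2 : ∀ d, rev (rev d) = d) {d e : X} :
    orbit rev d = orbit rev e ↔ e = d ∨ e = rev d := by
  rw [orbit_eq_iff]
  constructor
  · rintro ⟨i, rfl⟩
    have h3 : rev ^ (2 : ℤ) = 1 := by
      ext x
      simp [zpow_ofNat, pow_two, h2]
    rcases Int.even_or_odd' i with ⟨k, rfl | rfl⟩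
    · left
      rw [zpow_mul, h3, one_zpow, Equiv.Perm.one_apply]
    · right
      rw [zpow_add, zpow_mul, h3, one_zpow, one_mul, zpow_one]
  · rintro (rfl | rfl)
    · exact Equiv.Perm.SameCycle.refl _ _
    · exact Equiv.Perm.sameCycle_apply_right.2 (Equiv.Perm.SameCycle.refl _ _)

/-- The darts off a set of edges, one for each inner face. -/
def OffTree (f₀ : Orbit next) (p : Orbit next → X) (d : X) : Prop :=
  ∀ f, f ≠ f₀ → d ≠ p f ∧ d ≠ rev (p f)

variable {rev next}

theorem tree_edges_disjoint (h2 : ∀ d, rev (rev d) = d) {f₀ : Orbit next} {p : Orbit next → X}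
    {d : X} (hd : OffTree rev next f₀ p d) {f : Orbit next} (hf : f ≠ f₀) :
    orbit rev (p f) ≠ orbit rev d := fun h => by
  rcases (orbit_rev_eq_iff h2).1 h with h | h
  · exact (hd f hf).1 h
  · exact (hd f hf).2 h

variable [Finite X]

theorem iterate_pred_minimalPeriod (σ : Equiv.Perm X) (d : X) :
    0 < minimalPeriod σ d ∧ σ^[minimalPeriod σ d] d = d := by
  refine ⟨minimalPeriod_pos_of_mem_periodicPts ?_, isPeriodicPt_minimalPeriod σ d⟩
  exact σ.injective.mem_periodicPts d

theorem minimalPeriod_apply_perm (σ : Equiv.Perm X) (d : X) :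
    minimalPeriod σ (σ d) = minimalPeriod σ d :=
  minimalPeriod_apply (σ.injective.mem_periodicPts d)

theorem exists_iterate_of_orbit_eq {σ : Equiv.Perm X} {d e : X} (h : orbit σ d = orbit σ e) :
    ∃ i < minimalPeriod σ d, σ^[i] d = e := by
  obtain ⟨n, hn⟩ := (orbit_eq_iff.1 h).exists_pow_eq'
  obtain ⟨h1, h2⟩ := iterate_pred_minimalPeriod σ d
  refine ⟨n % minimalPeriod σ d, Nat.mod_lt _ h1, ?_⟩
  rw [iterate_mod_minimalPeriod_eq, ← hn.2, Equiv.Perm.iterate_eq_pow]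

/-- The dual spanning tree: each inner face has a parent dart, the parent edges are distinct, and a
property of darts that holds off the parent edges and obeys the face rule holds everywhere. -/
theorem exists_dual_tree (h2 : ∀ d, rev (rev d) = d)
    (hconn : ∀ P : X → Prop, (∀ d, P (rev d) ↔ P d) → (∀ d, P (next d) ↔ P d) →
      ∀ d e, P d → P e) (root : X) :
    ∃ p : Orbit next → X,
      (∀ f, f ≠ orbit next root → orbit next (p f) = f) ∧
      (∀ f g, f ≠ orbit next root → g ≠ orbit next root →
        orbit rev (p f) = orbit rev (p g) → f = g) ∧
      ∀ Q : X → Prop, (∀ d, Q (rev d) ↔ Q d) → (∀ d, OffTree rev next (orbit next root) p d → Q d) →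
        (∀ d, orbit next d ≠ orbit next root →
          (∀ e, orbit next e = orbit next d → e ≠ d → Q e) → Q d) → ∀ d, Q d := by
  have : Nonempty X := ⟨root⟩
  obtain ⟨dep, p, hp⟩ := exists_parent_dart (orbit next) (fun d => orbit next (rev d))
    (fun _ => True) (orbit next root) (by
      intro P h0 hP f
      obtain ⟨d, rfl⟩ := Quotient.exists_rep f
      refine hconn (fun d => P (orbit next d)) (fun d => ⟨hP d trivial, fun h => ?_⟩)
        (fun d => by rw [orbit_apply]) root d h0
      refine hP (rev d) trivial ?_
      rwa [h2])
  refine ⟨p, fun f hf => (hp f hf).2.1, fun f g hf hg hfg => ?_, fun Q hQ hoff hface => ?_⟩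
  · rcases (orbit_rev_eq_iff h2).1 hfg with h | h
    · rw [← (hp f hf).2.1, ← (hp g hg).2.1, h]
    -- Two faces sharing a parent edge from its two sides would each be the parent of the other,
    -- against the decrease of the depth.
    · have a := (hp f hf).2.2
      have b := (hp g hg).2.2
      rw [← h, (hp g hg).2.1] at a
      rw [h, h2, (hp f hf).2.1] at b
      omega
  -- Peel the dual tree from its leaves: at a failing face of maximal depth, the other tree edges on
  -- its boundary are parent edges of deeper faces, so the face rule applies to its own parent dart.
  · have tree : ∀ f, f ≠ orbit next root → Q (p f) := by
      by_contra! hcon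
      have hfin : {f | f ≠ orbit next root ∧ ¬ Q (p f)}.Finite := Set.toFinite _
      obtain ⟨f, ⟨hf, hQf⟩, hmax⟩ := Set.exists_max_image _ dep hfin hcon
      refine hQf (hface _ (by rwa [(hp f hf).2.1]) fun e he hne => ?_)
      rw [(hp f hf).2.1] at he
      by_cases hoffe : OffTree rev next (orbit next root) p e
      · exact hoff e hoffe
      · simp only [OffTree, not_forall, not_and_or, not_not] at hoffe
        obtain ⟨g, hg, h | h⟩ := hoffe
        · rw [h, (hp g hg).2.1] at he
          rw [h, he] at hne
          exact absurd rfl hne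
        · rw [h, hQ]
          by_contra hcon'
          have h3 := hmax g ⟨hg, hcon'⟩
          have h4 := (hp g hg).2.2
          rw [← h, he] at h4
          omega
    intro d
    by_cases hd : OffTree rev next (orbit next root) p d
    · exact hoff d hd
    · simp only [OffTree, not_forall, not_and_or, not_not] at hd
      obtain ⟨g, hg, h | h⟩ := hd
      · rw [h]
        exact tree g hg
      · rw [h, hQ]
        exact tree g hg

/-- Walking around a face from `next d` to `d`. -/
theorem face_walk {M : ℕ → Prop} {d : X} (h0 : M 1)
    (hstep : ∀ k, next^[k] d ≠ d → orbit next (next^[k] d) = orbit next d →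
      0 < k → M k → M (k + 1)) : M (minimalPeriod next d) := by
  obtain ⟨hpos, hper⟩ := iterate_pred_minimalPeriod next d
  have : ∀ k, k < minimalPeriod next d → M (k + 1) := by
    intro k hk
    induction k with
    | zero => exact h0
    | succ k ih =>
      refine hstep (k + 1) (fun h => ?_) (orbit_iterate _ _ _) k.succ_pos (ih (by omega))
      exact absurd (IsPeriodicPt.minimalPeriod_le k.succ_pos h) (by omega)
  obtain ⟨k, hk⟩ := Nat.exists_eq_add_of_lt hpos
  have := this k (by omega)
  rwa [show k + 1 = minimalPeriod next d by omega] at this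

/-- The primal spanning tree in the complement of the dual spanning tree. -/
theorem exists_tree_pair (h2 : ∀ d, rev (rev d) = d)
    (hconn : ∀ P : X → Prop, (∀ d, P (rev d) ↔ P d) → (∀ d, P (next d) ↔ P d) →
      ∀ d e, P d → P e) (root : X) :
    ∃ (p : Orbit next → X) (q : Vertex rev next → X) (dep : Vertex rev next → ℕ),
      (∀ f, f ≠ orbit next root → orbit next (p f) = f) ∧
      (∀ f g, f ≠ orbit next root → g ≠ orbit next root →
        orbit rev (p f) = orbit rev (p g) → f = g) ∧
      (∀ Q : X → Prop, (∀ d, Q (rev d) ↔ Q d) →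
        (∀ d, OffTree rev next (orbit next root) p d → Q d) →
        (∀ d, orbit next d ≠ orbit next root →
          (∀ e, orbit next e = orbit next d → e ≠ d → Q e) → Q d) → ∀ d, Q d) ∧
      (∀ v, v ≠ origin rev next root → OffTree rev next (orbit next root) p (q v) ∧
        origin rev next (q v) = v ∧ dep (origin rev next (rev (q v))) < dep v) ∧
      (∀ v w, v ≠ origin rev next root → w ≠ origin rev next root →
        orbit rev (q v) = orbit rev (q w) → v = w) := by
  have : Nonempty X := ⟨root⟩
  obtain ⟨p, hp1, hp2, hp3⟩ := exists_dual_tree h2 hconn root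
  have hoffrev : ∀ d, OffTree rev next (orbit next root) p d →
      OffTree rev next (orbit next root) p (rev d) := fun d hd f hf =>
    ⟨fun h => (hd f hf).2 (by rw [← h, h2]), fun h => (hd f hf).1 (rev.injective h)⟩
  obtain ⟨dep, q, hq⟩ := exists_parent_dart (origin rev next) (fun d => origin rev next (rev d))
    (OffTree rev next (orbit next root) p) (origin rev next root) (by
      intro P h0 hP
      -- Removing the dual tree keeps the vertices connected: if the two ends of every other edge of
      -- a face agree, walking around the face shows that those of the remaining edge do too.
      have hQ := hp3 (fun d => P (origin rev next d) ↔ P (origin rev next (rev d)))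
        (fun d => by rw [h2]; exact ⟨Iff.symm, Iff.symm⟩)
        (fun d hd => ⟨fun h => hP (rev d) (hoffrev d hd) (by rwa [h2]), hP d hd⟩)
        (fun d hd hrest => by
          have hw := face_walk (next := next) (d := d)
            (M := fun k => P (origin rev next (next d)) ↔ P (origin rev next (next^[k] d))) Iff.rfl
            (fun k h3 h4 _ h5 => by
              rw [h5, hrest _ h4 h3, iterate_succ_apply', origin_next h2])
          rw [(iterate_pred_minimalPeriod next d).2, origin_next h2] at hw
          exact hw.symm)
      intro v
      obtain ⟨d, rfl⟩ := Quotient.exists_rep v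
      exact hconn (fun d => P (origin rev next d)) (fun d => (hQ d).symm)
        (fun d => by rw [origin_next h2]; exact (hQ d).symm) root d h0)
  refine ⟨p, q, dep, hp1, hp2, hp3, hq, fun f g hf hg hfg => ?_⟩
  rcases (orbit_rev_eq_iff h2).1 hfg with h | h
  · rw [← (hq f hf).2.1, ← (hq g hg).2.1, h]
  · have a := (hq f hf).2.2
    have b := (hq g hg).2.2
    rw [← h, (hq g hg).2.1] at a
    rw [h, h2, (hq f hf).2.1] at b
    omega

theorem card_ne_add_one {Y : Type*} [Finite Y] (y₀ : Y) :
    Nat.card {y // y ≠ y₀} + 1 = Nat.card Y := by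
  classical
  have := Fintype.ofFinite Y
  rw [Nat.card_eq_fintype_card, Nat.card_eq_fintype_card, Fintype.card_subtype_compl,
    Fintype.card_subtype_eq]
  have : 0 < Fintype.card Y := Fintype.card_pos_iff.2 ⟨y₀⟩
  omega

/-- The edges of the two spanning trees. -/
def treeEdge (f₀ : Orbit next) (v₀ : Vertex rev next) (p : Orbit next → X)
    (q : Vertex rev next → X) : {v // v ≠ v₀} ⊕ {f // f ≠ f₀} → Orbit rev
  | .inl v => orbit rev (q v)
  | .inr f => orbit rev (p f)

/-- The genus is nonnegative. -/
theorem card_vertex_add_card_face_le (h2 : ∀ d, rev (rev d) = d)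
    (hconn : ∀ P : X → Prop, (∀ d, P (rev d) ↔ P d) → (∀ d, P (next d) ↔ P d) →
      ∀ d e, P d → P e) (root : X) :
    Nat.card (Vertex rev next) + Nat.card (Orbit next) ≤ Nat.card (Orbit rev) + 2 := by
  obtain ⟨p, q, dep, hp1, hp2, hp3, hq, hq2⟩ := exists_tree_pair h2 hconn root
  -- The two trees use disjoint sets of edges, hence (V - 1) + (F - 1) ≤ E.
  have hinj : Injective (treeEdge (orbit next root) (origin rev next root) p q) := by
    rintro (⟨v, hv⟩ | ⟨f, hf⟩) (⟨w, hw⟩ | ⟨g, hg⟩) h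
    · rw [Sum.inl.injEq, Subtype.mk.injEq]
      exact hq2 v w hv hw h
    · exact absurd h.symm (tree_edges_disjoint h2 (hq v hv).1 hg)
    · exact absurd h (tree_edges_disjoint h2 (hq w hw).1 hf)
    · rw [Sum.inr.injEq, Subtype.mk.injEq]
      exact hp2 f g hf hg h
  have h3 := Nat.card_le_card_of_injective _ hinj
  rw [Nat.card_sum] at h3
  have h4 := card_ne_add_one (origin rev next root)
  have h5 := card_ne_add_one (orbit next root)
  omega

/-- In a planar map a labelling of the darts that is flat at the inner faces has a potential. -/
theorem exists_potential (h2 : ∀ d, rev (rev d) = d)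
    (hconn : ∀ P : X → Prop, (∀ d, P (rev d) ↔ P d) → (∀ d, P (next d) ↔ P d) →
      ∀ d e, P d → P e) (root : X)
    (heuler : Nat.card (Vertex rev next) + Nat.card (Orbit next) = Nat.card (Orbit rev) + 2)
    {G : Type*} [Group G] (l : X → G) (hl : ∀ d, l (rev d) = (l d)⁻¹)
    (hflat : ∀ d, orbit next d ≠ orbit next root →
      ((List.range (minimalPeriod next d)).map fun i => l (next^[i] d)).prod = 1) (g₀ : G) :
    ∃ pot : X → G, pot root = g₀ ∧ (∀ d, pot (rev d) = pot d * l d) ∧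
      ∀ d, pot (next d) = pot d * l d := by
  obtain ⟨p, q, dep, hp1, hp2, hp3, hq, hq2⟩ := exists_tree_pair h2 hconn root
  have hinj : Injective (treeEdge (orbit next root) (origin rev next root) p q) := by
    rintro (⟨v, hv⟩ | ⟨f, hf⟩) (⟨w, hw⟩ | ⟨g, hg⟩) h
    · rw [Sum.inl.injEq, Subtype.mk.injEq]
      exact hq2 v w hv hw h
    · exact absurd h.symm (tree_edges_disjoint h2 (hq v hv).1 hg)
    · exact absurd h (tree_edges_disjoint h2 (hq w hw).1 hf)
    · rw [Sum.inr.injEq, Subtype.mk.injEq]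
      exact hp2 f g hf hg h
  -- By Euler's formula the two trees exhaust the edges, so an edge off the dual tree belongs to the
  -- primal tree.
  have hsurj : Surjective (treeEdge (orbit next root) (origin rev next root) p q) := by
    refine ((Nat.bijective_iff_injective_and_card _).2 ⟨hinj, ?_⟩).2
    rw [Nat.card_sum]
    have h4 := card_ne_add_one (origin rev next root)
    have h5 := card_ne_add_one (orbit next root)
    omega
  obtain ⟨pot, hpot0, hpot⟩ := exists_rec_on_parent dep (origin rev next root)
    (fun v => origin rev next (rev (q v))) (fun v hv => (hq v hv).2.2) g₀
    (fun v a => a * (l (q v))⁻¹)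
  -- The edge relation holds on the primal tree by construction. Flatness of the faces propagates it
  -- to the edges of the dual tree.
  have hall := hp3 (fun d => pot (origin rev next (rev d)) = pot (origin rev next d) * l d)
    (fun d => by rw [h2, hl, eq_mul_inv_iff_mul_eq, eq_comm])
    (fun d hd => by
      obtain ⟨⟨v, hv⟩ | ⟨f, hf⟩, h⟩ := hsurj (orbit rev d)
      · have h3 := hpot v hv
        rw [eq_mul_inv_iff_mul_eq] at h3
        rcases (orbit_rev_eq_iff h2).1 h with rfl | rfl
        · rw [(hq v hv).2.1, h3]
        · rw [h2, hl, (hq v hv).2.1, ← h3, mul_inv_cancel_right]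
      · exact absurd h (tree_edges_disjoint h2 hd hf))
    (fun d hd hrest => by
      have hw := face_walk (next := next) (d := d)
        (M := fun k => pot (origin rev next (next^[k] d)) = pot (origin rev next (next d)) *
          ((List.range (k - 1)).map fun i => l (next^[i] (next d))).prod) (by simp)
        (fun k h3 h4 hk h5 => by
          obtain ⟨k, rfl⟩ := Nat.exists_eq_add_of_lt hk
          simp only [Nat.zero_add, Nat.add_sub_cancel] at h5 h3 h4 ⊢
          rw [iterate_succ_apply', origin_next h2, hrest _ h4 h3, h5, List.range_succ,
            List.map_append, List.prod_append, mul_assoc]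
          simp [iterate_succ_apply])
      obtain ⟨hpos, hper⟩ := iterate_pred_minimalPeriod next d
      have hf := hflat (next d) (by rwa [orbit_apply])
      rw [minimalPeriod_apply_perm] at hf
      obtain ⟨k, hk⟩ := Nat.exists_eq_add_of_lt hpos
      rw [hper, origin_next h2] at hw
      rw [show minimalPeriod next d = k + 1 by omega, List.range_succ, List.map_append,
        List.prod_append] at hf
      rw [show minimalPeriod next d = k + 1 by omega, iterate_succ_apply] at hper
      rw [hk, show 0 + k + 1 - 1 = k by omega] at hw
      simp only [List.map_cons, List.map_nil, List.prod_singleton, hper] at hf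
      rw [hw, mul_assoc, hf, mul_one])
  exact ⟨fun d => pot (origin rev next d), hpot0, hall, fun d => by
    simpa only [origin_next h2] using hall d⟩

end CombinatorialMap

end

/-! ### Gluing diagrams edge by edge: van Kampen's lemma -/

noncomputable section

namespace CombinatorialMap

open Function

/-- The list runs once around a face. -/
def IsFaceList {X : Type*} (next : Equiv.Perm X) (l : List X) : Prop :=
  l.Nodup ∧ l.map next = l.rotate 1

namespace IsFaceList

variable {X : Type*} {next : Equiv.Perm X} {l : List X}

theorem apply_getElem (h : IsFaceList next l) {i : ℕ} (hi : i < l.length) :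
    next l[i] = l[(i + 1) % l.length]'(Nat.mod_lt _ (by omega)) := by
  have h1 : (l.map next)[i]'(by simpa using hi) = (l.rotate 1)[i]'(by simpa using hi) := by
    congr 1
    exact h.2
  rw [List.getElem_map, List.getElem_rotate] at h1
  exact h1

theorem iterate_getElem_zero (h : IsFaceList next l) (h0 : 0 < l.length) :
    ∀ i (hi : i < l.length), next^[i] l[0] = l[i] := by
  intro i
  induction i with
  | zero => intro _; rfl
  | succ i ih =>
    intro hi
    rw [iterate_succ_apply', ih (by omega), h.apply_getElem]
    congr 1
    exact Nat.mod_eq_of_lt hi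

theorem minimalPeriod_eq (h : IsFaceList next l) (h0 : 0 < l.length) :
    minimalPeriod next l[0] = l.length := by
  have hper : next^[l.length] l[0] = l[0] := by
    obtain ⟨k, hk⟩ := Nat.exists_eq_add_of_lt h0
    have h1 := h.iterate_getElem_zero h0 k (by omega)
    rw [show l.length = k + 1 by omega, iterate_succ_apply', h1, h.apply_getElem]
    congr 1
    rw [show k + 1 = l.length by omega, Nat.mod_self]
  have hle : minimalPeriod next l[0] ≤ l.length := IsPeriodicPt.minimalPeriod_le h0 hper
  have hpos : 0 < minimalPeriod next l[0] := IsPeriodicPt.minimalPeriod_pos h0 hper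
  refine hle.antisymm (not_lt.1 fun hlt => ?_)
  have h2 := h.iterate_getElem_zero h0 _ hlt
  rw [(isPeriodicPt_minimalPeriod next l[0]).eq] at h2
  have := (h.1.getElem_inj_iff).1 h2
  omega

theorem map_iterate_range (h : IsFaceList next l) (h0 : 0 < l.length) :
    ((List.range (minimalPeriod next l[0])).map fun i => next^[i] l[0]) = l := by
  refine List.ext_getElem (by simp [h.minimalPeriod_eq h0]) fun i h1 h2 => ?_
  simp only [List.getElem_map, List.getElem_range]
  exact h.iterate_getElem_zero h0 i h2

theorem rotate (h : IsFaceList next l) (n : ℕ) : IsFaceList next (l.rotate n) := by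
  refine ⟨List.nodup_rotate.2 h.1, ?_⟩
  rw [List.map_rotate, h.2, List.rotate_rotate, List.rotate_rotate, add_comm]

theorem exists_cons (h : IsFaceList next l) {d : X} (hd : d ∈ l) :
    ∃ t, IsFaceList next (d :: t) ∧ (d :: t).IsRotated l := by
  obtain ⟨a, b, rfl⟩ := List.append_of_mem hd
  refine ⟨b ++ a, ?_, ?_⟩
  · have := h.rotate a.length
    rwa [List.rotate_append_length_eq] at this
  · refine ⟨(d :: b).length, ?_⟩
    rw [← List.cons_append, List.rotate_append_length_eq]

theorem mem_apply (h : IsFaceList next l) {d : X} (hd : d ∈ l) : next d ∈ l := by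
  have : next d ∈ l.map next := List.mem_map_of_mem hd
  rw [h.2] at this
  exact List.mem_rotate.1 this

theorem mem_iterate (h : IsFaceList next l) {d : X} (hd : d ∈ l) (n : ℕ) : next^[n] d ∈ l := by
  induction n with
  | zero => exact hd
  | succ n ih =>
    rw [iterate_succ_apply']
    exact h.mem_apply ih

theorem exists_iterate (h : IsFaceList next l) {d e : X} (hd : d ∈ l) (he : e ∈ l) :
    ∃ n, next^[n] d = e := by
  obtain ⟨t, ht, hrot⟩ := h.exists_cons hd
  have he' : e ∈ d :: t := hrot.mem_iff.2 he
  obtain ⟨i, hi, rfl⟩ := List.getElem_of_mem he'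
  exact ⟨i, ht.iterate_getElem_zero (by simp) i hi⟩

theorem orbit_eq (h : IsFaceList next l) {d e : X} (hd : d ∈ l) (he : e ∈ l) :
    orbit next d = orbit next e := by
  obtain ⟨n, rfl⟩ := h.exists_iterate hd he
  exact (orbit_iterate next n d).symm

theorem mem_of_orbit_eq [Finite X] (h : IsFaceList next l) {d e : X} (hd : d ∈ l)
    (he : orbit next d = orbit next e) : e ∈ l := by
  obtain ⟨n, -, rfl⟩ := exists_iterate_of_orbit_eq he
  exact h.mem_iterate hd n

theorem eq_formPerm [DecidableEq X] (h : IsFaceList next l) {d : X} (hd : d ∈ l) :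
    next d = l.formPerm d := by
  obtain ⟨i, hi, rfl⟩ := List.getElem_of_mem hd
  rw [h.apply_getElem hi, List.formPerm_apply_getElem l h.1 i hi]

theorem of_eq_formPerm [DecidableEq X] (hl : l.Nodup) (h : ∀ d ∈ l, next d = l.formPerm d) :
    IsFaceList next l := by
  refine ⟨hl, List.ext_getElem (by simp) fun i h1 h2 => ?_⟩
  rw [List.getElem_map, List.getElem_rotate, h _ (List.getElem_mem _),
    List.formPerm_apply_getElem l hl]

theorem comp_congr {A : Type*} (h : IsFaceList next l) {f g : X → A}
    (hfg : (l.rotate 1).map f = l.map g) {d : X} (hd : d ∈ l) : f (next d) = g d := by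
  rw [← h.2, List.map_map] at hfg
  exact List.map_inj_left.1 hfg d hd

end IsFaceList

/-- A lower bound for the number of orbits only needs an invariant labelling, so the vertices and
faces of a glued map need not be computed exactly. -/
theorem card_le_card_orbit {X A : Type*} [Finite X] {σ : Equiv.Perm X} (f : X → A)
    (hf : ∀ d, f (σ d) = f d) (hs : Surjective f) : Nat.card A ≤ Nat.card (Orbit σ) := by
  have key : ∀ d e, (Equiv.Perm.SameCycle.setoid σ) d e → f d = f e := by
    intro d e h
    obtain ⟨n, -, rfl⟩ := exists_iterate_of_orbit_eq (orbit_eq_iff.2 h)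
    induction n with
    | zero => rfl
    | succ n ih =>
      rw [iterate_succ_apply', hf]
      exact ih (orbit_eq_iff.1 (orbit_iterate σ n d).symm)
  refine Nat.card_le_card_of_surjective (Quotient.lift f key) fun a => ?_
  obtain ⟨d, rfl⟩ := hs a
  exact ⟨orbit σ d, rfl⟩

end CombinatorialMap

open CombinatorialMap

/-- A planar labelled map with an explicit list of the darts of the outer face. -/
structure BoundedMap {α : Type*} (R : Finset (GenWord α)) where
  Dart : Type
  finite : Finite Dart
  rev : Equiv.Perm Dart
  next : Equiv.Perm Dart
  rev_rev : ∀ d, rev (rev d) = d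
  rev_ne : ∀ d, rev d ≠ d
  letter : Dart → α × Bool
  letter_rev : ∀ d, letter (rev d) = invLetter (letter d)
  boundary : List Dart
  boundary_ne : boundary ≠ []
  isFaceList : IsFaceList next boundary
  inner : ∀ d, d ∈ boundary ∨ ∃ l, IsFaceList next l ∧ d ∈ l ∧ IsRelatorWord R (l.map letter)
  connected : ∀ P : Dart → Prop, (∀ d, P (rev d) ↔ P d) → (∀ d, P (next d) ↔ P d) →
    ∀ d e, P d → P e
  euler : Nat.card (Orbit rev) + 2 ≤ Nat.card (Vertex rev next) + Nat.card (Orbit next)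

namespace BoundedMap

variable {α : Type*} {R : Finset (GenWord α)}

instance (M : BoundedMap R) : Finite M.Dart := M.finite

theorem map_letter_range {X : Type*} {next : Equiv.Perm X} {d : X} {t : List X}
    (h : IsFaceList next (d :: t)) (f : X → α × Bool) :
    ((List.range (Function.minimalPeriod next d)).map fun i => f (next^[i] d)) =
      (d :: t).map f := by
  conv_rhs => rw [← h.map_iterate_range (by simp)]
  rw [List.map_map]
  rfl

/-- Nonnegativity of the genus upgrades the one-sided Euler inequality of `BoundedMap` to the
required equality. -/
theorem exists_planarLabelledMap (M : BoundedMap R) :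
    ∃ D : PlanarLabelledMap R, D.faceWord D.root = M.boundary.map M.letter := by
  obtain ⟨Dart, hfin, rev, next, h2, hne, letter, hletter, bd, hbd, hface, hinner, hconn, heuler⟩ :=
    M
  rcases bd with _ | ⟨root, t⟩
  · exact absurd rfl hbd
  refine ⟨⟨Dart, Fintype.ofFinite _, rev, next, h2, hne, fun d e => ?_, ?_, letter, hletter, root,
    fun d hd => ?_⟩, ?_⟩
  · refine hconn (fun e => ∃ g ∈ Subgroup.closure {rev, next}, g d = e) (fun e => ?_) (fun e => ?_)
      d e ⟨1, one_mem _, rfl⟩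
    · have hr : rev ∈ Subgroup.closure {rev, next} := Subgroup.subset_closure (by simp)
      constructor
      · rintro ⟨g, hg, h⟩
        exact ⟨rev * g, mul_mem hr hg, by rw [Equiv.Perm.mul_apply, h, h2]⟩
      · rintro ⟨g, hg, h⟩
        exact ⟨rev * g, mul_mem hr hg, by rw [Equiv.Perm.mul_apply, h]⟩
    · have hr : next ∈ Subgroup.closure {rev, next} := Subgroup.subset_closure (by simp)
      constructor
      · rintro ⟨g, hg, h⟩
        exact ⟨next⁻¹ * g, mul_mem (inv_mem hr) hg, by
          rw [Equiv.Perm.mul_apply, h]; exact next.symm_apply_apply e⟩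
      · rintro ⟨g, hg, h⟩
        exact ⟨next * g, mul_mem hr hg, by rw [Equiv.Perm.mul_apply, h]⟩
  · exact (card_vertex_add_card_face_le h2 hconn root).antisymm heuler
  · rcases hinner d with h | ⟨l, hl, hdl, r, hr, h⟩
    · exact absurd (orbit_eq_iff.1 (hface.orbit_eq (List.mem_cons_self) h)) hd
    · obtain ⟨t', ht', hrot⟩ := hl.exists_cons hdl
      refine ⟨r, hr, ?_⟩
      rw [map_letter_range ht']
      have h3 := hrot.map letter
      exact h.imp h3.trans h3.trans
  · exact map_letter_range hface letter

/-- The data that glue an edge into the outer face: the two new darts are `inr true` and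
`inr false`, and the lists `l₁` (the new outer face) and `l₂` (a new inner face, or empty) together
replace the old outer face. -/
structure EdgeInsertion (M : BoundedMap R) (x : α × Bool) where
  l₁ : List (M.Dart ⊕ Bool)
  l₂ : List (M.Dart ⊕ Bool)
  perm : (l₁ ++ l₂).Perm (Sum.inr true :: Sum.inr false :: M.boundary.map Sum.inl)
  mem_l₁ : Sum.inr true ∈ l₁
  mem_l₂ : l₂ = [] ∨ Sum.inr false ∈ l₂

namespace EdgeInsertion

variable {M : BoundedMap R} {x : α × Bool} (I : EdgeInsertion M x)

/-- The letters after the insertion. -/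
def newLetter (M : BoundedMap R) (x : α × Bool) : M.Dart ⊕ Bool → α × Bool
  | .inl d => M.letter d
  | .inr true => x
  | .inr false => invLetter x

/-- The edge reversal after the insertion. -/
def newRev (M : BoundedMap R) : Equiv.Perm (M.Dart ⊕ Bool) := Equiv.sumCongr M.rev Equiv.boolNot

@[simp] theorem newRev_inl (d : M.Dart) : newRev M (.inl d) = .inl (M.rev d) := rfl

@[simp] theorem newRev_inr (b : Bool) : newRev M (.inr b) = .inr (!b) := rfl

open Classical in
/-- The face permutation after the insertion. -/
def newNext : Equiv.Perm (M.Dart ⊕ Bool) :=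
  -- The inverse cycle dissolves the old outer face; the two disjoint cycles on the right create the
  -- new faces.
  Equiv.sumCongr M.next 1 * (M.boundary.map Sum.inl).formPerm⁻¹ * I.l₁.formPerm * I.l₂.formPerm

theorem nodup : (I.l₁ ++ I.l₂).Nodup := by
  rw [I.perm.nodup_iff, List.nodup_cons, List.nodup_cons,
    List.nodup_map_iff Sum.inl_injective]
  exact ⟨by simp, by simp, M.isFaceList.1⟩

theorem mem_iff (e : M.Dart ⊕ Bool) : e ∈ I.l₁ ++ I.l₂ ↔
    e = .inr true ∨ e = .inr false ∨ ∃ d ∈ M.boundary, .inl d = e := by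
  rw [I.perm.mem_iff]
  simp

theorem newNext_inl {d : M.Dart} (hd : d ∉ M.boundary) : I.newNext (.inl d) = .inl (M.next d) := by
  classical
  have h : Sum.inl d ∉ I.l₁ ++ I.l₂ := by
    rw [I.mem_iff]
    simpa using hd
  rw [List.mem_append, not_or] at h
  have h3 : (Sum.inl d : M.Dart ⊕ Bool) ∉ M.boundary.map Sum.inl := by simpa using hd
  rw [newNext, Equiv.Perm.mul_apply, Equiv.Perm.mul_apply, Equiv.Perm.mul_apply,
    List.formPerm_apply_of_notMem h.2, List.formPerm_apply_of_notMem h.1,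
    Equiv.Perm.inv_eq_iff_eq.2 (List.formPerm_apply_of_notMem h3).symm]
  rfl

-- On the darts of the new faces the two left factors of the permutation cancel, since `next` acts
-- on the old boundary as its cycle and both factors fix the new darts.
open Classical in
theorem newNext_of_mem {e : M.Dart ⊕ Bool} (he : e ∈ I.l₁ ++ I.l₂) :
    I.newNext e = I.l₁.formPerm (I.l₂.formPerm e) := by
  have h : I.l₁.formPerm (I.l₂.formPerm e) ∈ I.l₁ ++ I.l₂ := by
    rw [List.mem_append] at he ⊢
    by_cases h2 : e ∈ I.l₂
    · by_cases h1 : I.l₂.formPerm e ∈ I.l₁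
      · exact Or.inl (List.formPerm_apply_mem_of_mem h1)
      · rw [List.formPerm_apply_of_notMem h1]
        exact Or.inr (List.formPerm_apply_mem_of_mem h2)
    · rw [List.formPerm_apply_of_notMem h2]
      exact Or.inl (List.formPerm_apply_mem_of_mem (he.resolve_right h2))
  have key : ∀ e ∈ I.l₁ ++ I.l₂,
      (Equiv.sumCongr M.next 1 : Equiv.Perm (M.Dart ⊕ Bool))
        ((M.boundary.map Sum.inl).formPerm⁻¹ e) = e := by
    intro e he
    have hl : IsFaceList (Equiv.sumCongr M.next 1 : Equiv.Perm (M.Dart ⊕ Bool))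
        (M.boundary.map Sum.inl) := by
      refine ⟨(List.nodup_map_iff Sum.inl_injective).2 M.isFaceList.1, ?_⟩
      rw [← List.map_rotate, ← M.isFaceList.2, List.map_map, List.map_map]
      rfl
    rcases (I.mem_iff e).1 he with rfl | rfl | ⟨d, hd, rfl⟩
    · rw [Equiv.Perm.inv_eq_iff_eq.2 (List.formPerm_apply_of_notMem (by simp)).symm]
      rfl
    · rw [Equiv.Perm.inv_eq_iff_eq.2 (List.formPerm_apply_of_notMem (by simp)).symm]
      rfl
    · have h1 : (M.boundary.map Sum.inl).formPerm⁻¹ (Sum.inl d : M.Dart ⊕ Bool) ∈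
          M.boundary.map Sum.inl := by
        rw [← List.formPerm_mem_iff_mem]
        exact (Equiv.apply_symm_apply _ _).symm ▸ List.mem_map_of_mem hd
      rw [hl.eq_formPerm h1]
      exact Equiv.apply_symm_apply _ _
  rw [newNext, Equiv.Perm.mul_apply, Equiv.Perm.mul_apply, Equiv.Perm.mul_apply]
  exact key _ h

theorem isFaceList₁ : IsFaceList I.newNext I.l₁ := by
  classical
  have h := List.nodup_append.1 I.nodup
  refine .of_eq_formPerm h.1 fun d hd => ?_
  rw [I.newNext_of_mem (List.mem_append_left _ hd),
    List.formPerm_apply_of_notMem fun h2 => h.2.2 d hd d h2 rfl]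

theorem isFaceList₂ : IsFaceList I.newNext I.l₂ := by
  classical
  have h := List.nodup_append.1 I.nodup
  refine .of_eq_formPerm h.2.1 fun d hd => ?_
  rw [I.newNext_of_mem (List.mem_append_right _ hd), List.formPerm_apply_of_notMem fun h1 =>
    h.2.2 _ h1 _ (List.formPerm_apply_mem_of_mem hd) rfl]

/-- A property of old darts that are off the boundary and of the new faces holds everywhere. -/
theorem forall_dart {P : M.Dart ⊕ Bool → Prop} (h1 : ∀ e ∈ I.l₁, P e) (h2 : ∀ e ∈ I.l₂, P e)
    (h3 : ∀ d, d ∉ M.boundary → P (.inl d)) : ∀ e, P e := by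
  have h4 : ∀ e ∈ I.l₁ ++ I.l₂, P e := fun e he => (List.mem_append.1 he).elim (h1 e) (h2 e)
  rintro (d | b)
  · by_cases hd : d ∈ M.boundary
    · exact h4 _ ((I.mem_iff _).2 (Or.inr (Or.inr ⟨d, hd, rfl⟩)))
    · exact h3 d hd
  · refine h4 _ ((I.mem_iff _).2 ?_)
    cases b <;> simp

/-- The new faces hang together through the new edge, and they cover the old boundary. Thus the
split of the old outer face does not disconnect the old darts. -/
theorem connected (P : M.Dart ⊕ Bool → Prop) (hrev : ∀ d, P (newRev M d) ↔ P d)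
    (hnext : ∀ d, P (I.newNext d) ↔ P d) (d e : M.Dart ⊕ Bool) (hd : P d) : P e := by
  have hface : ∀ l, IsFaceList I.newNext l → ∀ d ∈ l, ∀ e ∈ l, (P d ↔ P e) := by
    intro l hl d hd e he
    obtain ⟨n, rfl⟩ := hl.exists_iterate hd he
    clear he
    induction n with
    | zero => rfl
    | succ n ih => rw [ih, Function.iterate_succ_apply', hnext]
  have hc : P (.inr false) ↔ P (.inr true) := hrev (.inr true)
  have h1 : ∀ e ∈ I.l₁, (P e ↔ P (.inr true)) := fun e he => hface _ I.isFaceList₁ _ he _ I.mem_l₁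
  have h2 : ∀ e ∈ I.l₂, (P e ↔ P (.inr true)) := fun e he => by
    rcases I.mem_l₂ with h | h
    · rw [h] at he
      simp at he
    · rw [hface _ I.isFaceList₂ _ he _ h, hc]
  have hb : ∀ d ∈ M.boundary, (P (.inl d) ↔ P (.inr true)) := fun d hd =>
    (List.mem_append.1 ((I.mem_iff _).2 (Or.inr (Or.inr ⟨d, hd, rfl⟩)))).elim (h1 _) (h2 _)
  obtain ⟨d₀, hd₀⟩ := List.exists_mem_of_ne_nil _ M.boundary_ne
  have hall : ∀ d e, P (.inl d) → P (.inl e) :=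
    M.connected (fun d => P (.inl d)) (fun d => hrev (.inl d)) fun d => by
      by_cases hd : d ∈ M.boundary
      · rw [hb _ hd, hb _ (M.isFaceList.mem_apply hd)]
      · rw [← I.newNext_inl hd, hnext]
  have h3 : ∀ e, P e ↔ P (.inr true) := I.forall_dart h1 h2 fun d _ =>
    ⟨fun h => (hb _ hd₀).1 (hall _ _ h), fun h => hall _ _ ((hb _ hd₀).2 h)⟩
  rwa [h3 e, ← h3 d]

theorem card_edge_le : Nat.card (Orbit (newRev M)) ≤ Nat.card (Orbit M.rev) + 1 := by
  rw [← Finite.card_option]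
  let g : Option (Orbit M.rev) → Orbit (newRev M) := fun o =>
    o.elim (orbit _ (.inr true)) fun e => orbit _ (.inl e.out)
  refine Nat.card_le_card_of_surjective g fun e => ?_
  obtain ⟨d | b, rfl⟩ := Quotient.exists_rep e
  · refine ⟨some (orbit _ d), ?_⟩
    have h : orbit M.rev (orbit M.rev d).out = orbit M.rev d := Quotient.out_eq _
    change orbit (newRev M) (.inl (orbit M.rev d).out) = orbit (newRev M) (.inl d)
    rcases (orbit_rev_eq_iff M.rev_rev).1 h with h | h
    · exact congrArg (fun z => orbit (newRev M) (.inl z)) h.symm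
    · have h' := congrArg (fun z => orbit (newRev M) (.inl z)) h
      exact (h'.trans (orbit_apply (newRev M) (.inl _))).symm
  · refine ⟨none, ?_⟩
    change orbit (newRev M) (.inr true) = orbit (newRev M) (.inr b)
    cases b
    · exact (orbit_apply (newRev M) (.inr true)).symm
    · rfl

/-- The map after the insertion, if the number of vertices or faces grows. -/
def newMap (hrel : I.l₂ = [] ∨ IsRelatorWord R (I.l₂.map (newLetter M x)))
    (hcard : Nat.card (Vertex M.rev M.next) + Nat.card (Orbit M.next) + 1 ≤
      Nat.card (Vertex (newRev M) I.newNext) + Nat.card (Orbit I.newNext)) : BoundedMap R where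
  Dart := M.Dart ⊕ Bool
  finite := inferInstance
  rev := newRev M
  next := I.newNext
  rev_rev := by rintro (d | b) <;> simp [M.rev_rev]
  rev_ne := by rintro (d | b) <;> simp [M.rev_ne]
  letter := newLetter M x
  letter_rev := by
    rintro (d | b)
    · exact M.letter_rev d
    · cases b
      · exact (invLetter_invLetter x).symm
      · rfl
  boundary := I.l₁
  boundary_ne := List.ne_nil_of_mem I.mem_l₁
  isFaceList := I.isFaceList₁
  inner := by
    refine I.forall_dart (fun e he => Or.inl he) (fun e he => Or.inr ?_) fun d hd => Or.inr ?_
    · rcases hrel with h | h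
      · rw [h] at he
        simp at he
      · exact ⟨I.l₂, I.isFaceList₂, he, h⟩
    · obtain ⟨l, hl, hdl, hr⟩ := (M.inner d).resolve_left hd
      refine ⟨l.map .inl, ⟨(List.nodup_map_iff Sum.inl_injective).2 hl.1, ?_⟩,
        List.mem_map_of_mem hdl, ?_⟩
      · rw [← List.map_rotate, ← hl.2, List.map_map, List.map_map]
        refine List.map_congr_left fun e he => I.newNext_inl fun heb => hd ?_
        obtain ⟨n, rfl⟩ := hl.exists_iterate he hdl
        exact M.isFaceList.mem_iterate heb n
      · rw [List.map_map]
        exact hr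
  connected := I.connected
  euler := by
    have := M.euler
    have := card_edge_le (M := M)
    omega

theorem card_le_card_vertex {A : Type*} (f : M.Dart ⊕ Bool → A) (hs : Function.Surjective f)
    (h1 : (I.l₁.rotate 1).map f = I.l₁.map fun e => f (newRev M e))
    (h2 : (I.l₂.rotate 1).map f = I.l₂.map fun e => f (newRev M e))
    (h3 : ∀ d, d ∉ M.boundary → f (.inl (M.next d)) = f (.inl (M.rev d))) :
    Nat.card A ≤ Nat.card (Vertex (newRev M) I.newNext) := by
  refine card_le_card_orbit f (fun e => ?_) hs
  have h : ∀ e, f (I.newNext e) = f (newRev M e) :=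
    I.forall_dart (fun e he => I.isFaceList₁.comp_congr h1 he)
      (fun e he => I.isFaceList₂.comp_congr h2 he) fun d hd => by
        rw [I.newNext_inl hd, h3 d hd, newRev_inl]
  rw [Equiv.Perm.mul_apply, h]
  rcases e with d | b <;> simp [M.rev_rev]

theorem card_le_card_face {A : Type*} (f : M.Dart ⊕ Bool → A) (hs : Function.Surjective f)
    (h1 : ∃ a, ∀ e ∈ I.l₁, f e = a) (h2 : ∃ a, ∀ e ∈ I.l₂, f e = a)
    (h3 : ∀ d, d ∉ M.boundary → f (.inl (M.next d)) = f (.inl d)) :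
    Nat.card A ≤ Nat.card (Orbit I.newNext) := by
  obtain ⟨a, h1⟩ := h1
  obtain ⟨b, h2⟩ := h2
  refine card_le_card_orbit f (I.forall_dart (fun e he => ?_) (fun e he => ?_) fun d hd => ?_) hs
  · rw [h1 _ he, h1 _ (I.isFaceList₁.mem_apply he)]
  · rw [h2 _ he, h2 _ (I.isFaceList₂.mem_apply he)]
  · rw [I.newNext_inl hd, h3 d hd]

end EdgeInsertion

open EdgeInsertion

/-- A spur adds one edge and one vertex, which keeps the Euler inequality. -/
theorem exists_spur (M : BoundedMap R) (x : α × Bool) : ∃ M' : BoundedMap R,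
    M'.boundary.map M'.letter = x :: invLetter x :: M.boundary.map M.letter := by
  obtain ⟨h, t, hbd⟩ := List.exists_cons_of_ne_nil M.boundary_ne
  let I : EdgeInsertion M x :=
    ⟨.inr true :: .inr false :: M.boundary.map .inl, [], by simp, by simp, Or.inl rfl⟩
  have hface : ∀ d ∈ M.boundary, orbit M.next d = orbit M.next h := fun d hd =>
    M.isFaceList.orbit_eq hd (by simp [hbd])
  refine ⟨I.newMap (Or.inl rfl) ?_, ?_⟩
  -- The label `none` marks the tip of the spur, from which only the dart `inr false` starts.
  · have hV : Nat.card (Option (Vertex M.rev M.next)) ≤ _ := I.card_le_card_vertex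
      (fun e => e.elim (fun d => some (origin M.rev M.next d))
        fun b => bif b then some (origin M.rev M.next h) else none)
      (by
        rintro (_ | v)
        · exact ⟨.inr false, rfl⟩
        · obtain ⟨d, rfl⟩ := Quotient.exists_rep v
          exact ⟨.inl d, rfl⟩)
      (by
        have h1 : M.boundary.map (fun d => origin M.rev M.next (M.rev d)) =
            (t ++ [h]).map (origin M.rev M.next) := by
          have h2 := congrArg (List.map (origin M.rev M.next)) M.isFaceList.2
          rw [List.map_map] at h2
          have h3 : (M.boundary.rotate 1) = t ++ [h] := by simp [hbd]
          rw [← h3, ← h2]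
          exact List.map_congr_left fun d _ => (origin_next M.rev_rev d).symm
        have h4 := congrArg (List.map some) h1
        simp only [I, List.rotate_cons_succ, List.rotate_zero, List.cons_append, List.map_cons,
          List.map_append, List.map_map, newRev_inr, List.map_nil] at h4 ⊢
        simp only [Function.comp_def] at h4 ⊢
        simp only [newRev_inl, Sum.elim_inl, Sum.elim_inr, hbd] at h4 ⊢
        simpa using h4.symm)
      (by simp [I])
      (fun d _ => by simp [origin_next M.rev_rev])
    have hF : Nat.card (Orbit M.next) ≤ _ := I.card_le_card_face
      (fun e => e.elim (orbit M.next) fun _ => orbit M.next h)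
      (fun f => by
        obtain ⟨d, rfl⟩ := Quotient.exists_rep f
        exact ⟨.inl d, rfl⟩)
      ⟨orbit M.next h, by simpa [I] using hface⟩ ⟨orbit M.next h, by simp [I]⟩
      (fun d _ => orbit_apply _ _)
    rw [Finite.card_option] at hV
    omega
  · simp only [newMap, I, List.map_cons, List.map_map]
    rfl

/-- A chord adds one edge and one face: it runs parallel to the boundary arc `u` and cuts off a face
that reads `x⁻¹ u`. -/
theorem exists_chord (M : BoundedMap R) (x : α × Bool) (u v : GenWord α)
    (huv : M.boundary.map M.letter = u ++ v) (hrel : IsRelatorWord R (invLetter x :: u)) :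
    ∃ M' : BoundedMap R, M'.boundary.map M'.letter = x :: v := by
  obtain ⟨a, b, hbd, rfl, rfl⟩ := List.map_eq_append_iff.1 huv
  let I : EdgeInsertion M x :=
    ⟨.inr true :: b.map .inl, .inr false :: a.map .inl, by
      rw [hbd, List.map_append, List.cons_append]
      exact (List.Perm.trans List.perm_middle (List.perm_append_comm.cons _)).cons _,
      by simp, Or.inr (by simp)⟩
  have hlink : M.boundary.map (fun d => origin M.rev M.next (M.rev d)) =
      (M.boundary.rotate 1).map (origin M.rev M.next) := by
    rw [← M.isFaceList.2, List.map_map]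
    exact List.map_congr_left fun d _ => (origin_next M.rev_rev d).symm
  have hne := M.boundary_ne
  have hnd := M.isFaceList.1
  have hmem : ∀ d, d ∈ M.boundary ↔ d ∈ a ∨ d ∈ b := by simp [hbd]
  rw [hbd] at hlink hne hnd
  -- Here `p` is the initial vertex of the arc `a` and `q` that of `b`; they coincide if one of the
  -- arcs is empty, and the chord is then a loop.
  obtain ⟨p, q, h1, h2⟩ : ∃ p q : Vertex M.rev M.next,
      b.map (origin M.rev M.next) ++ [p] =
        q :: b.map (fun d => origin M.rev M.next (M.rev d)) ∧
      a.map (origin M.rev M.next) ++ [q] =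
        p :: a.map (fun d => origin M.rev M.next (M.rev d)) := by
    rcases a with _ | ⟨s, a⟩ <;> rcases b with _ | ⟨t, b⟩
    · simp at hne
    · refine ⟨origin M.rev M.next t, origin M.rev M.next t, ?_, by simp⟩
      simp only [List.nil_append] at hlink
      rw [hlink]
      simp
    · refine ⟨origin M.rev M.next s, origin M.rev M.next s, by simp, ?_⟩
      simp only [List.append_nil] at hlink
      rw [hlink]
      simp
    · refine ⟨origin M.rev M.next s, origin M.rev M.next t, ?_⟩
      have h3 : ((s :: a) ++ (t :: b)).rotate 1 = (a ++ [t]) ++ (b ++ [s]) := by simp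
      rw [h3, List.map_append, List.map_append] at hlink
      obtain ⟨h4, h5⟩ := List.append_inj hlink (by simp)
      rw [h4, h5]
      simp
  obtain ⟨d₀, hd₀⟩ := List.exists_mem_of_ne_nil _ M.boundary_ne
  refine ⟨I.newMap (Or.inr ?_) ?_, ?_⟩
  · simp only [I, List.map_cons, List.map_map]
    exact hrel
  · have hV : Nat.card (Vertex M.rev M.next) ≤ _ := I.card_le_card_vertex
      (fun e => e.elim (origin M.rev M.next) fun b => bif b then p else q)
      (fun v => by
        obtain ⟨d, rfl⟩ := Quotient.exists_rep v
        exact ⟨.inl d, rfl⟩)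
      (by
        simp only [I, List.rotate_cons_succ, List.rotate_zero, List.map_cons, List.map_append,
          List.map_map, newRev_inr, List.map_nil]
        simpa [Function.comp_def] using h1)
      (by
        simp only [I, List.rotate_cons_succ, List.rotate_zero, List.map_cons, List.map_append,
          List.map_map, newRev_inr, List.map_nil]
        simpa [Function.comp_def] using h2)
      (fun d _ => origin_next M.rev_rev d)
    classical
    -- The label `none` marks the face that is cut off; the new outer face inherits the label of the
    -- old one.
    have hF : Nat.card (Option (Orbit M.next)) ≤ _ := I.card_le_card_face
      (fun e => e.elim (fun d => if d ∈ a then none else some (orbit M.next d))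
        fun b => bif b then some (orbit M.next d₀) else none)
      (by
        rintro (_ | f)
        · exact ⟨.inr false, rfl⟩
        · obtain ⟨d, rfl⟩ := Quotient.exists_rep f
          by_cases hd : d ∈ M.boundary
          · exact ⟨.inr true, congrArg some (M.isFaceList.orbit_eq hd₀ hd)⟩
          · exact ⟨.inl d, if_neg fun h => hd ((hmem d).2 (Or.inl h))⟩)
      ⟨some (orbit M.next d₀), by
        simp only [I, List.mem_cons, List.mem_map, forall_eq_or_imp, Sum.elim_inr, cond_true,
          true_and]
        rintro _ ⟨d, hd, rfl⟩
        have h3 : d ∉ a := fun h => (List.nodup_append.1 hnd).2.2 d h d hd rfl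
        simp only [Sum.elim_inl, if_neg h3]
        exact congrArg some (M.isFaceList.orbit_eq ((hmem d).2 (Or.inr hd)) hd₀)⟩
      ⟨none, by
        simp only [I, List.mem_cons, List.mem_map, forall_eq_or_imp, Sum.elim_inr, cond_false,
          true_and]
        rintro _ ⟨d, hd, rfl⟩
        simp only [Sum.elim_inl, if_pos hd]⟩
      (fun d hd => by
        have h3 : d ∉ a := fun h => hd ((hmem d).2 (Or.inl h))
        have h4 : M.next d ∉ a := fun h => hd (M.isFaceList.mem_of_orbit_eq
          ((hmem _).2 (Or.inl h)) (orbit_apply _ _))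
        simp only [Sum.elim_inl, if_neg h3, if_neg h4, orbit_apply])
    rw [Finite.card_option] at hF
    omega
  · simp only [newMap, I, List.map_cons, List.map_map]
    rfl

theorem exists_rotate (M : BoundedMap R) (u v : GenWord α)
    (huv : M.boundary.map M.letter = u ++ v) :
    ∃ M' : BoundedMap R, M'.boundary.map M'.letter = v ++ u := by
  refine ⟨{ M with
    boundary := M.boundary.rotate u.length
    boundary_ne := fun h => M.boundary_ne (List.rotate_eq_nil_iff.1 h)
    isFaceList := M.isFaceList.rotate _
    inner := fun d => (M.inner d).imp_left List.mem_rotate.2 }, ?_⟩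
  change (M.boundary.rotate u.length).map M.letter = v ++ u
  rw [List.map_rotate, huv, List.rotate_append_length_eq]

/-- The two ends of a single edge. -/
def edgeLetter (x : α × Bool) : Bool → α × Bool
  | true => x
  | false => invLetter x

theorem edgeLetter_not (x : α × Bool) (b : Bool) :
    edgeLetter x (Equiv.boolNot b) = invLetter (edgeLetter x b) := by
  cases b
  · exact (invLetter_invLetter x).symm
  · rfl

theorem bool_connected (P : Bool → Prop) (hP : ∀ d, P (Equiv.boolNot d) ↔ P d) (d e : Bool)
    (h : P d) : P e := by
  have : P false ↔ P true := hP true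
  cases d <;> cases e <;> tauto

theorem card_orbit_boolNot_le : Nat.card (Orbit Equiv.boolNot) ≤ 1 := by
  rw [Finite.card_le_one_iff_subsingleton]
  refine ⟨fun e f => ?_⟩
  obtain ⟨b, rfl⟩ := Quotient.exists_rep e
  obtain ⟨c, rfl⟩ := Quotient.exists_rep f
  refine (orbit_rev_eq_iff (by simp)).2 ?_
  cases b <;> cases c <;> simp

theorem exists_segment (R : Finset (GenWord α)) (x : α × Bool) : ∃ M : BoundedMap R,
    M.boundary.map M.letter = [x, invLetter x] := by
  refine ⟨{
    Dart := Bool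
    finite := inferInstance
    rev := Equiv.boolNot
    next := Equiv.boolNot
    rev_rev := by simp
    rev_ne := by simp
    letter := edgeLetter x
    letter_rev := edgeLetter_not x
    boundary := [true, false]
    boundary_ne := by simp
    isFaceList := ⟨by simp, rfl⟩
    inner := fun d => Or.inl (by cases d <;> simp)
    connected := fun P hP _ => bool_connected P hP
    euler := ?_ }, rfl⟩
  have h1 := card_orbit_boolNot_le
  have h2 : Nat.card Bool ≤ Nat.card (Vertex Equiv.boolNot Equiv.boolNot) :=
    card_le_card_orbit id (by simp) Function.surjective_id
  have h3 : Nat.card Unit ≤ Nat.card (Orbit Equiv.boolNot) :=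
    card_le_card_orbit (fun _ => ()) (fun _ => rfl) fun _ => ⟨true, rfl⟩
  simp only [Nat.card_eq_fintype_card, Fintype.card_bool, Fintype.card_unit] at h1 h2 h3 ⊢
  omega

theorem exists_loop (x : α × Bool) (h : IsRelatorWord R [invLetter x]) : ∃ M : BoundedMap R,
    M.boundary.map M.letter = [x] := by
  refine ⟨{
    Dart := Bool
    finite := inferInstance
    rev := Equiv.boolNot
    next := 1
    rev_rev := by simp
    rev_ne := by simp
    letter := edgeLetter x
    letter_rev := edgeLetter_not x
    boundary := [true]
    boundary_ne := by simp
    isFaceList := ⟨by simp, rfl⟩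
    inner := fun d => by
      cases d
      · exact Or.inr ⟨[false], ⟨by simp, rfl⟩, by simp, h⟩
      · exact Or.inl (by simp)
    connected := fun P hP _ => bool_connected P hP
    euler := ?_ }, rfl⟩
  have h1 := card_orbit_boolNot_le
  have h2 : Nat.card Bool ≤ Nat.card (Orbit (1 : Equiv.Perm Bool)) :=
    card_le_card_orbit id (fun _ => rfl) Function.surjective_id
  have h3 : Nat.card Unit ≤ Nat.card (Vertex Equiv.boolNot (1 : Equiv.Perm Bool)) :=
    card_le_card_orbit (fun _ => ()) (fun _ => rfl) fun _ => ⟨true, rfl⟩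
  simp only [Nat.card_eq_fintype_card, Fintype.card_bool, Fintype.card_unit] at h1 h2 h3 ⊢
  omega

/-- Rotating the boundary brings the place of gluing to the front. A map has at least one edge, so
the first edge glued to a point is treated separately: it is a segment or a loop. -/
theorem exists_of_fillable {w : GenWord α} (h : Fillable R w) :
    w = [] ∨ ∃ M : BoundedMap R, M.boundary.map M.letter = w := by
  induction h with
  | nil => exact Or.inl rfl
  | spur p q x _ ih =>
    refine Or.inr ?_
    rcases ih with h | ⟨M, hM⟩
    · obtain ⟨rfl, rfl⟩ := List.append_eq_nil_iff.1 h
      exact exists_segment R x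
    · obtain ⟨M₁, h₁⟩ := M.exists_rotate p q hM
      obtain ⟨M₂, h₂⟩ := M₁.exists_spur x
      obtain ⟨M₃, h₃⟩ := M₂.exists_rotate (x :: invLetter x :: q) p (by simp [h₂, h₁])
      exact ⟨M₃, h₃⟩
  | chord p u q x _ hr ih =>
    refine Or.inr ?_
    rcases ih with h | ⟨M, hM⟩
    · simp only [List.append_eq_nil_iff] at h
      obtain ⟨⟨rfl, rfl⟩, rfl⟩ := h
      exact exists_loop x hr
    · obtain ⟨M₁, h₁⟩ := M.exists_rotate p (u ++ q) (by simpa using hM)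
      obtain ⟨M₂, h₂⟩ := M₁.exists_chord x u (q ++ p) (by simp [h₁]) hr
      obtain ⟨M₃, h₃⟩ := M₂.exists_rotate (x :: q) p (by simp [h₂])
      exact ⟨M₃, h₃⟩

end BoundedMap

/-- **Van Kampen's lemma**: a word that represents `1` is the boundary word of a diagram. -/
theorem exists_diagram {α : Type*} {R : Finset (GenWord α)} {w : GenWord α}
    (h : wordValue R w = 1) : ∃ D : VanKampenDiagram R, D.boundaryWord = w := by
  rcases BoundedMap.exists_of_fillable (fillable_of_wordValue_eq_one h) with rfl | ⟨M, rfl⟩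
  · exact ⟨.point, rfl⟩
  · obtain ⟨D, hD⟩ := M.exists_planarLabelledMap
    exact ⟨.ofMap D, hD⟩

end

noncomputable section

/-! ### Sums along closed sequences -/

/-- A closed sequence travels between its minimum and its maximum twice, so its range is at most
half of its variation; take the midpoint. -/
theorem exists_center_of_closed {U : ℕ → ℝ} {n : ℕ} (hU : U n = U 0) :
    ∃ c, ∀ i ≤ n, |U i - c| ≤ (∑ i ∈ Finset.range n, |U (i + 1) - U i|) / 4 := by
  have hS : ∀ i j, i ≤ j → |U j - U i| ≤
      (∑ k ∈ Finset.range j, |U (k + 1) - U k|) - ∑ k ∈ Finset.range i, |U (k + 1) - U k| := by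
    intro i j hij
    induction j, hij using Nat.le_induction with
    | base => simp
    | succ j _ ih =>
      rw [Finset.sum_range_succ]
      have := abs_sub_le (U (j + 1)) (U j) (U i)
      linarith
  obtain ⟨a, ha, hmax⟩ := Finset.exists_max_image (Finset.range (n + 1)) U ⟨0, by simp⟩
  obtain ⟨b, hb, hmin⟩ := Finset.exists_min_image (Finset.range (n + 1)) U ⟨0, by simp⟩
  simp only [Finset.mem_range, Nat.lt_succ_iff] at ha hb hmax hmin
  have key : 2 * (U a - U b) ≤ ∑ i ∈ Finset.range n, |U (i + 1) - U i| := by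
    have h3 := hS 0 a (Nat.zero_le _)
    have h4 := hS 0 b (Nat.zero_le _)
    have h5 := hS a n ha
    have h6 := hS b n hb
    rw [Finset.sum_range_zero] at h3 h4
    rw [abs_le] at h3 h4 h5 h6
    rcases le_total a b with h | h
    · have h7 := abs_le.1 (hS a b h)
      linarith
    · have h7 := abs_le.1 (hS b a h)
      linarith
  refine ⟨(U a + U b) / 2, fun i hi => abs_le.2 ?_⟩
  have h1 := hmax i hi
  have h2 := hmin i hi
  constructor <;> linarith

/-- The isoperimetric inequality in the plane for closed polygons whose steps are at most `1` in
both coordinates. -/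
theorem abs_sum_area_le {F T : ℕ → ℝ} {n : ℕ} (hF : ∀ i < n, |F (i + 1) - F i| ≤ 1)
    (hT : ∀ i < n, |T (i + 1) - T i| ≤ 1) (hFn : F n = F 0) (hTn : T n = T 0) :
    |∑ i ∈ Finset.range n, (F i + F (i + 1)) / 2 * (T (i + 1) - T i)| ≤ (n : ℝ) ^ 2 / 8 := by
  -- In the diagonal coordinates each step satisfies |ΔU| + |ΔW| = 2 max(|ΔF|, |ΔT|) ≤ 2.
  let U : ℕ → ℝ := fun i => F i + T i
  let W : ℕ → ℝ := fun i => F i - T i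
  obtain ⟨c, hc⟩ := exists_center_of_closed (U := U) (n := n) (by simp [U, hFn, hTn])
  -- `Z` is a primitive of F dT + (U - c) dW / 2; the trapezoidal sums make this exact in the
  -- discrete setting.
  let Z : ℕ → ℝ := fun i => U i * W i / 4 + U i ^ 2 / 8 - W i ^ 2 / 8 - c / 2 * W i
  have h1 : ∑ i ∈ Finset.range n, (F i + F (i + 1)) / 2 * (T (i + 1) - T i) =
      -(∑ i ∈ Finset.range n, ((U i - c) + (U (i + 1) - c)) / 4 * (W (i + 1) - W i)) := by
    have h2 : ∑ i ∈ Finset.range n, (Z (i + 1) - Z i) = 0 := by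
      rw [Finset.sum_range_sub]
      simp [Z, U, W, hFn, hTn]
    rw [eq_neg_iff_add_eq_zero, ← h2, ← Finset.sum_add_distrib]
    refine Finset.sum_congr rfl fun i _ => ?_
    simp only [Z, U, W]
    ring
  set A := ∑ i ∈ Finset.range n, |U (i + 1) - U i| with hA
  set B := ∑ i ∈ Finset.range n, |W (i + 1) - W i| with hB
  have hAB : A + B ≤ 2 * n := by
    rw [hA, hB, ← Finset.sum_add_distrib]
    have : ∀ i ∈ Finset.range n, |U (i + 1) - U i| + |W (i + 1) - W i| ≤ 2 := by
      intro i hi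
      have h3 := abs_le.1 (hF i (Finset.mem_range.1 hi))
      have h4 := abs_le.1 (hT i (Finset.mem_range.1 hi))
      simp only [U, W]
      rcases abs_cases (F (i + 1) + T (i + 1) - (F i + T i)) with h5 | h5 <;>
        rcases abs_cases (F (i + 1) - T (i + 1) - (F i - T i)) with h6 | h6 <;> linarith
    refine (Finset.sum_le_sum this).trans ?_
    simp [mul_comm]
  have hA0 : 0 ≤ A := Finset.sum_nonneg fun _ _ => abs_nonneg _
  have hB0 : 0 ≤ B := Finset.sum_nonneg fun _ _ => abs_nonneg _
  have h3 : |∑ i ∈ Finset.range n, ((U i - c) + (U (i + 1) - c)) / 4 * (W (i + 1) - W i)| ≤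
      A / 8 * B := by
    refine (Finset.abs_sum_le_sum_abs _ _).trans ?_
    rw [hB, Finset.mul_sum]
    refine Finset.sum_le_sum fun i hi => ?_
    rw [abs_mul]
    refine mul_le_mul_of_nonneg_right ?_ (abs_nonneg _)
    have h4 := abs_le.1 (hc i (Finset.mem_range.1 hi).le)
    have h5 := abs_le.1 (hc (i + 1) (Finset.mem_range.1 hi))
    rw [abs_le]
    constructor <;> linarith
  rw [h1, abs_neg]
  -- AB/8 ≤ (A + B)²/32 ≤ (2n)²/32 = n²/8.
  nlinarith [sq_nonneg (A - B)]

/-! ### Line integrals in the Cayley graph -/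

section LineIntegral

variable {α : Type*} {R : Finset (GenWord α)}

theorem wordValue_nil : wordValue R [] = 1 := by
  rw [wordValue, ← FreeGroup.one_eq_mk, map_one]

theorem wordValue_append (v w : GenWord α) :
    wordValue R (v ++ w) = wordValue R v * wordValue R w := by
  rw [wordValue, mk_append, map_mul]
  rfl

theorem wordValue_cons (x : α × Bool) (w : GenWord α) :
    wordValue R (x :: w) = wordValue R [x] * wordValue R w :=
  wordValue_append [x] w

theorem wordValue_invRev (w : GenWord α) :
    wordValue R (FreeGroup.invRev w) = (wordValue R w)⁻¹ := by
  rw [wordValue, ← FreeGroup.inv_mk, map_inv]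
  rfl

theorem wordValue_invLetter (x : α × Bool) :
    wordValue R [invLetter x] = (wordValue R [x])⁻¹ := by
  rw [wordValue, mk_invLetter, map_inv]
  rfl

theorem wordValue_eq_one_of_isRotated {u v : GenWord α} (h : u.IsRotated v)
    (hu : wordValue R u = 1) : wordValue R v = 1 := by
  obtain ⟨n, rfl⟩ := h
  rw [List.rotate_eq_drop_append_take_mod, wordValue_append]
  refine mul_eq_one_swap ?_
  rw [← wordValue_append, List.take_append_drop, hu]

theorem IsRelatorWord.wordValue_eq_one {u : GenWord α} (h : IsRelatorWord R u) :
    wordValue R u = 1 := by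
  have key : ∀ r ∈ R, wordValue R r = 1 := fun r hr =>
    (QuotientGroup.eq_one_iff _).2 (Subgroup.subset_normalClosure ⟨r, hr, rfl⟩)
  obtain ⟨r, hr, h | h⟩ := h
  · exact wordValue_eq_one_of_isRotated h.symm (key r hr)
  · refine wordValue_eq_one_of_isRotated h.symm ?_
    rw [wordValue_invRev, key r hr, inv_one]

theorem IsRelatorWord.length_le {u : GenWord α} (h : IsRelatorWord R u) :
    u.length ≤ maxRelatorLength R := by
  obtain ⟨r, hr, h | h⟩ := h
  · rw [h.perm.length_eq]
    exact Finset.le_sup (f := List.length) hr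
  · rw [h.perm.length_eq, FreeGroup.invRev_length]
    exact Finset.le_sup (f := List.length) hr

/-- The sum of a function of the oriented edges along the path that starts at `g` and reads `w`. -/
def lineIntegral (φ : GroupOf R → α × Bool → ℝ) : GroupOf R → GenWord α → ℝ
  | _, [] => 0
  | g, x :: w => φ g x + lineIntegral φ (g * wordValue R [x]) w

/-- The function takes opposite values on the two orientations of an edge. -/
def IsAlternating (φ : GroupOf R → α × Bool → ℝ) : Prop :=
  ∀ g x, φ (g * wordValue R [x]) (invLetter x) = -φ g x

theorem lineIntegral_append (φ : GroupOf R → α × Bool → ℝ) (g : GroupOf R) (v w : GenWord α) :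
    lineIntegral φ g (v ++ w) = lineIntegral φ g v + lineIntegral φ (g * wordValue R v) w := by
  induction v generalizing g with
  | nil => simp [lineIntegral, wordValue_nil]
  | cons x v ih =>
    rw [List.cons_append, lineIntegral, lineIntegral, ih, wordValue_cons x v, mul_assoc, add_assoc]

theorem lineIntegral_eq_sum (φ : GroupOf R → α × Bool → ℝ) {X : Type*} (next : X → X)
    (letter : X → α × Bool) (pot : X → GroupOf R)
    (hpot : ∀ d, pot (next d) = pot d * wordValue R [letter d]) (d : X) (n : ℕ) :
    pot d * wordValue R ((List.range n).map fun i => letter (next^[i] d)) = pot (next^[n] d) ∧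
    lineIntegral φ (pot d) ((List.range n).map fun i => letter (next^[i] d)) =
      ∑ i ∈ Finset.range n, φ (pot (next^[i] d)) (letter (next^[i] d)) := by
  induction n with
  | zero => simp [lineIntegral, wordValue_nil]
  | succ n ih =>
    rw [List.range_succ, List.map_append, wordValue_append, lineIntegral_append,
      Finset.sum_range_succ, ← mul_assoc, ih.1, ih.2, Function.iterate_succ_apply', hpot]
    exact ⟨rfl, by simp [lineIntegral]⟩

theorem sum_iterate_eq {X : Type*} [Finite X] (next : Equiv.Perm X) (d : X)
    {A : Type*} [AddCommMonoid A] (ψ : X → A) (s : Finset X)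
    (hs : ∀ e, e ∈ s ↔ CombinatorialMap.orbit next e = CombinatorialMap.orbit next d) :
    ∑ i ∈ Finset.range (Function.minimalPeriod next d), ψ (next^[i] d) = ∑ e ∈ s, ψ e := by
  refine Finset.sum_bij (fun i _ => next^[i] d) (fun i _ => ?_) (fun i hi j hj h => ?_)
    (fun e he => ?_) fun _ _ => rfl
  · rw [hs, CombinatorialMap.orbit_iterate]
  · rw [Finset.mem_range] at hi hj
    exact Function.iterate_injOn_Iio_minimalPeriod hi hj h
  · obtain ⟨i, hi, rfl⟩ := CombinatorialMap.exists_iterate_of_orbit_eq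
      ((hs e).1 he).symm
    exact ⟨i, Finset.mem_range.2 hi, rfl⟩

theorem PlanarLabelledMap.length_faceWord (M : PlanarLabelledMap R) (d : M.Dart) :
    (M.faceWord d).length = Function.minimalPeriod M.next d := by
  simp [faceWord]

open CombinatorialMap Classical in
/-- The line integral along the boundary of a diagram is the sum of the line integrals around the
faces. -/
theorem PlanarLabelledMap.lineIntegral_boundary (M : PlanarLabelledMap R) (g : GroupOf R) :
    ∃ (base : M.Face → GroupOf R) (u : M.Face → GenWord α),
      (∀ f, f ≠ M.face M.root →
        IsRelatorWord R (u f) ∧ u f ≠ [] ∧ (u f).length = M.faceLength f) ∧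
      ∀ φ, IsAlternating φ → lineIntegral φ g (M.faceWord M.root) =
        -∑ f with f ≠ M.face M.root, lineIntegral φ (base f) (u f) := by
  have hface : ∀ d e, M.face d = M.face e ↔ orbit M.next d = orbit M.next e := fun _ _ => Iff.rfl
  have hrel : ∀ d, M.face d ≠ M.face M.root → IsRelatorWord R (M.faceWord d) := fun d hd =>
    M.inner_face d fun h => hd (orbit_eq_iff.2 h).symm
  -- The potential with values in the group is the map of the diagram to the Cayley graph; it is
  -- flat at inner faces because relators represent 1.
  obtain ⟨pot, hroot, hpot_rev, hpot⟩ := exists_potential M.rev_rev (fun P hP hP' d e hd => by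
    obtain ⟨σ, hσ, rfl⟩ := M.connected d e
    refine (?_ : ∀ d, P (σ d) ↔ P d) d |>.2 hd
    induction hσ using Subgroup.closure_induction with
    | mem τ hτ =>
      rcases hτ with rfl | rfl
      · exact hP
      · exact hP'
    | one => exact fun _ => Iff.rfl
    | mul σ τ _ _ h1 h2 => exact fun d => (h1 _).trans (h2 d)
    | inv σ _ h1 => exact fun d => by rw [← h1, Equiv.Perm.inv_def, Equiv.apply_symm_apply])
    M.root M.euler (fun d => wordValue R [M.letter d])
    (fun d => by
      rw [← wordValue_invLetter]
      exact congrArg (fun x => wordValue R [x]) (M.letter_rev d))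
    (fun d hd => by
      rw [← (hrel d hd).wordValue_eq_one, PlanarLabelledMap.faceWord]
      generalize List.range _ = l
      induction l with
      | nil => exact wordValue_nil.symm
      | cons i l ih =>
        rw [List.map_cons, List.map_cons, List.prod_cons, ih]
        exact (wordValue_cons _ _).symm) g
  have hcard : ∀ d, (M.faceWord d).length = M.faceLength (M.face d) := by
    intro d
    have h1 := sum_iterate_eq M.next d (fun _ => 1) {e | M.face e = M.face d} (by simp [hface])
    rw [M.length_faceWord, PlanarLabelledMap.faceLength, Nat.card_eq_fintype_card,
      Fintype.card_subtype]
    rw [Finset.sum_const, Finset.card_range, smul_eq_mul, mul_one, Finset.sum_const, smul_eq_mul,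
      mul_one] at h1
    exact h1
  refine ⟨fun f => pot f.out, fun f => M.faceWord f.out, fun f hf => ?_, fun φ hφ => ?_⟩
  · have hf' : M.face f.out = f := Quotient.out_eq f
    refine ⟨hrel _ (by rwa [hf']), fun h => ?_, by rw [hcard, hf']⟩
    have h1 := M.length_faceWord f.out
    have h2 := (iterate_pred_minimalPeriod M.next f.out).1
    have h3 := congrArg List.length h
    simp only [List.length_nil] at h3
    omega
  · let ψ : M.Dart → ℝ := fun d => φ (pot d) (M.letter d)
    have hψ : ∀ d, lineIntegral φ (pot d) (M.faceWord d) = ∑ e with M.face e = M.face d, ψ e :=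
      fun d => ((lineIntegral_eq_sum φ M.next M.letter pot hpot d _).2).trans
        (sum_iterate_eq M.next d ψ _ (by simp [hface]))
    -- Each edge contributes two opposite darts. Grouped by faces, the vanishing sum says that the
    -- outer face balances the inner ones.
    have hsum : ∑ d, ψ d = 0 := by
      have h1 : ∑ d, ψ (M.rev d) = ∑ d, ψ d := Equiv.sum_comp M.rev ψ
      have h2 : ∀ d, ψ (M.rev d) = -ψ d := fun d => by
        simp only [ψ]
        rw [hpot_rev, M.letter_rev]
        exact hφ _ _
      simp only [h2, Finset.sum_neg_distrib] at h1
      linarith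
    have htot : ∑ f, ∑ e with M.face e = f, ψ e = ∑ d, ψ d :=
      Finset.sum_fiberwise _ _ _
    rw [← Finset.sum_filter_add_sum_filter_not _ (fun f => f ≠ M.face M.root), hsum] at htot
    have hr : (Finset.univ.filter fun f : M.Face => ¬ f ≠ M.face M.root) = {M.face M.root} := by
      ext f
      simp
    rw [hr, Finset.sum_singleton, ← hψ, hroot] at htot
    have h3 : ∑ f with f ≠ M.face M.root, lineIntegral φ (pot f.out) (M.faceWord f.out) =
        ∑ f with f ≠ M.face M.root, ∑ e with M.face e = f, ψ e := by
      refine Finset.sum_congr rfl fun f _ => ?_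
      rw [hψ]
      have : M.face f.out = f := Quotient.out_eq f
      rw [this]
    rw [h3]
    linarith

/-- A diagram yields a decomposition of line integrals along its boundary. -/
theorem VanKampenDiagram.exists_decomposition (D : VanKampenDiagram R) (g : GroupOf R) :
    ∃ (ι : Type) (s : Finset ι) (base : ι → GroupOf R) (u : ι → GenWord α),
      (∀ f ∈ s, IsRelatorWord R (u f) ∧ u f ≠ []) ∧ ∑ f ∈ s, (u f).length = D.area ∧
      ∀ φ, IsAlternating φ →
        lineIntegral φ g D.boundaryWord = -∑ f ∈ s, lineIntegral φ (base f) (u f) := by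
  classical
  rcases D with _ | M
  · exact ⟨Empty, ∅, fun _ => 1, fun _ => [], by simp, by simp [area], fun φ _ => by
      simp [boundaryWord, lineIntegral]⟩
  · obtain ⟨base, u, h1, h2⟩ := M.lineIntegral_boundary g
    refine ⟨M.Face, Finset.univ.filter fun f => f ≠ M.face M.root, base, u, fun f hf => ?_, ?_, h2⟩
    · have := h1 f (by simpa using hf)
      exact ⟨this.1, this.2.1⟩
    · rw [area, PlanarLabelledMap.area]
      refine Finset.sum_congr (by ext; simp) fun f hf => ?_
      exact (h1 f (by simpa using hf)).2.2

theorem exists_isMinimal {w : GenWord α} (h : wordValue R w = 1) :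
    ∃ D : VanKampenDiagram R, D.boundaryWord = w ∧ D.IsMinimal := by
  have hne : {n | ∃ D : VanKampenDiagram R, D.boundaryWord = w ∧ D.area = n}.Nonempty := by
    obtain ⟨D, hD⟩ := exists_diagram h
    exact ⟨_, D, hD, rfl⟩
  obtain ⟨D, hD, hA⟩ := Nat.sInf_mem hne
  refine ⟨D, hD, fun D' hD' => ?_⟩
  rw [hA]
  exact Nat.sInf_le ⟨D', hD'.trans hD, rfl⟩

/-- The linear isoperimetric inequality of the presentation. -/
def LinearIsoperimetric (R : Finset (GenWord α)) (C : ℝ) : Prop :=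
  ∀ D : VanKampenDiagram R, D.IsMinimal → C * (D.area : ℝ) ≤ (D.boundaryLength : ℝ)

/-- A bound proportional to the length of each face sums to a bound by the area of a minimal
filling, which the hypothesis compares with the boundary. -/
theorem LinearIsoperimetric.abs_lineIntegral_le {C : ℝ} (hR : LinearIsoperimetric R C)
    {φ : GroupOf R → α × Bool → ℝ} (hφ : IsAlternating φ) {K : ℝ} (hC : 0 < C) (hK : 0 ≤ K)
    (hbound : ∀ g u, IsRelatorWord R u → |lineIntegral φ g u| ≤ K * u.length)
    {w : GenWord α} (hw : wordValue R w = 1) (g : GroupOf R) :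
    C * |lineIntegral φ g w| ≤ K * w.length := by
  obtain ⟨D, rfl, hmin⟩ := exists_isMinimal hw
  obtain ⟨ι, s, base, u, h1, h2, h3⟩ := D.exists_decomposition g
  have h4 := hR D hmin
  have h5 : |lineIntegral φ g D.boundaryWord| ≤ K * D.area := by
    rw [h3 φ hφ, abs_neg, ← h2, Nat.cast_sum, Finset.mul_sum]
    exact (Finset.abs_sum_le_sum_abs _ _).trans
      (Finset.sum_le_sum fun f hf => hbound _ _ (h1 f hf).1)
  calc C * |lineIntegral φ g D.boundaryWord| ≤ C * (K * D.area) :=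
        mul_le_mul_of_nonneg_left h5 hC.le
    _ = K * (C * D.area) := by ring
    _ ≤ K * D.boundaryLength := mul_le_mul_of_nonneg_left h4 hK

/-- If the isoperimetric constant is larger than `1` then all closed line integrals vanish. -/
theorem LinearIsoperimetric.lineIntegral_eq_zero {C : ℝ} (hR : LinearIsoperimetric R C)
    (hC : 1 < C ∨ maxRelatorLength R = 0)
    {φ : GroupOf R → α × Bool → ℝ} (hφ : IsAlternating φ) (n : ℕ) :
    ∀ w : GenWord α, w.length = n → wordValue R w = 1 → ∀ g, lineIntegral φ g w = 0 := by
  induction n using Nat.strong_induction_on with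
  | _ n ih =>
  intro w hn hw g
  obtain ⟨D, rfl, hmin⟩ := exists_isMinimal hw
  obtain ⟨ι, s, base, u, h1, h2, h3⟩ := D.exists_decomposition g
  have h4 := hR D hmin
  rw [h3 φ hφ, neg_eq_zero]
  refine Finset.sum_eq_zero fun f hf => ?_
  have hpos : 0 < (u f).length := List.length_pos_iff.2 (h1 f hf).2
  -- For C > 1 every face is strictly shorter than the boundary, so induction applies to its word;
  -- for λ = 0 there are no nonempty relator words, hence no faces.
  rcases hC with hC | hC
  · refine ih (u f).length ?_ (u f) rfl (h1 f hf).1.wordValue_eq_one _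
    have h5 : (u f).length ≤ D.area := by
      rw [← h2]
      exact Finset.single_le_sum (f := fun f => (u f).length) (fun _ _ => Nat.zero_le _) hf
    have h6 : (0 : ℝ) < D.area := by exact_mod_cast hpos.trans_le h5
    have h7 : (D.area : ℝ) < n := by
      rw [← hn]
      refine lt_of_lt_of_le ?_ h4
      nlinarith
    have h8 : D.area < n := by exact_mod_cast h7
    omega
  · have := (h1 f hf).1.length_le
    omega

/-! ### The form F dT and its isoperimetric bound -/

/-- A real function on the vertices that varies by at most `1` along each edge. -/
def OneLipschitz (F : GroupOf R → ℝ) : Prop := ∀ g x, |F (g * wordValue R [x]) - F g| ≤ 1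

/-- The discrete one-form `F dT`. -/
def areaForm (F T : GroupOf R → ℝ) (g : GroupOf R) (x : α × Bool) : ℝ :=
  (F g + F (g * wordValue R [x])) / 2 * (T (g * wordValue R [x]) - T g)

theorem areaForm_isAlternating (F T : GroupOf R → ℝ) : IsAlternating (areaForm F T) := by
  intro g x
  rw [areaForm, areaForm, wordValue_invLetter, mul_inv_cancel_right]
  ring

theorem lineIntegral_areaForm (F T : GroupOf R → ℝ) (w : GenWord α) (g : GroupOf R) :
    lineIntegral (areaForm F T) g w = ∑ i ∈ Finset.range w.length,
      (F (g * wordValue R (w.take i)) + F (g * wordValue R (w.take (i + 1)))) / 2 *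
        (T (g * wordValue R (w.take (i + 1))) - T (g * wordValue R (w.take i))) := by
  induction w generalizing g with
  | nil => simp [lineIntegral]
  | cons x w ih =>
    rw [lineIntegral, ih, List.length_cons, Finset.sum_range_succ', add_comm]
    congr 1
    · refine Finset.sum_congr rfl fun i _ => ?_
      rw [List.take_succ_cons, List.take_succ_cons, wordValue_cons x (w.take i),
        wordValue_cons x (w.take (i + 1)), mul_assoc, mul_assoc]
    · simp [areaForm, wordValue_nil]

theorem wordValue_take_succ (w : GenWord α) {i : ℕ} (hi : i < w.length) :
    wordValue R (w.take (i + 1)) = wordValue R (w.take i) * wordValue R [w[i]] := by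
  rw [← wordValue_append, List.take_append_getElem hi]

theorem abs_lineIntegral_areaForm_le {F T : GroupOf R → ℝ} (hF : OneLipschitz F)
    (hT : OneLipschitz T) (g : GroupOf R) {u : GenWord α} (hu : wordValue R u = 1) :
    |lineIntegral (areaForm F T) g u| ≤ (u.length : ℝ) ^ 2 / 8 := by
  rw [lineIntegral_areaForm]
  refine abs_sum_area_le (F := fun i => F (g * wordValue R (u.take i)))
    (T := fun i => T (g * wordValue R (u.take i))) (fun i hi => ?_) (fun i hi => ?_) ?_ ?_
  · rw [wordValue_take_succ u hi, ← mul_assoc]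
    exact hF _ _
  · rw [wordValue_take_succ u hi, ← mul_assoc]
    exact hT _ _
  · simp [hu, wordValue_nil]
  · simp [hu, wordValue_nil]

/-- The quadratic planar bound becomes linear on a face, as one factor |∂f| is at most λ. -/
theorem LinearIsoperimetric.abs_areaForm_le {C : ℝ} (hR : LinearIsoperimetric R C) (hC : 0 < C)
    {F T : GroupOf R → ℝ} (hF : OneLipschitz F) (hT : OneLipschitz T) {w : GenWord α}
    (hw : wordValue R w = 1) (g : GroupOf R) :
    C * |lineIntegral (areaForm F T) g w| ≤ maxRelatorLength R / 8 * w.length := by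
  refine hR.abs_lineIntegral_le (areaForm_isAlternating F T) hC (by positivity) (fun g u hu => ?_)
    hw g
  refine (abs_lineIntegral_areaForm_le hF hT g hu.wordValue_eq_one).trans ?_
  have h1 : (u.length : ℝ) ≤ maxRelatorLength R := by exact_mod_cast hu.length_le
  have h2 : (0 : ℝ) ≤ u.length := Nat.cast_nonneg _
  nlinarith

end LineIntegral

end

/-! ### Thin triangles of vertex geodesics -/

noncomputable section

section DiscreteGeometry

variable {α : Type*} {R : Finset (GenWord α)}

theorem vertexDist_mul_letter_le (g : GroupOf R) (x : α × Bool) :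
    vertexDist g (g * wordValue R [x]) ≤ 1 := by
  rw [vertexDist, inv_mul_cancel_left]
  exact groupNorm_le [x]

theorem exists_word_between (g h : GroupOf R) :
    ∃ u : GenWord α, g * wordValue R u = h ∧ u.length = vertexDist g h := by
  obtain ⟨u, hu, hlen⟩ := exists_word (g⁻¹ * h)
  exact ⟨u, by rw [hu, mul_inv_cancel_left], hlen⟩

theorem exists_letter_of_vertexDist_eq_one {g h : GroupOf R} (hgh : vertexDist g h = 1) :
    ∃ x, h = g * wordValue R [x] := by
  obtain ⟨u, hu, hlen⟩ := exists_word_between g h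
  rw [hgh] at hlen
  obtain ⟨x, rfl⟩ := List.length_eq_one_iff.1 hlen
  exact ⟨x, hu.symm⟩

/-- There is an edge path of length `m` from `g` to `h` all of whose vertices lie in `S`. -/
inductive JoinedBy (S : GroupOf R → Prop) (g : GroupOf R) : GroupOf R → ℕ → Prop
  | refl (hg : S g) : JoinedBy S g g 0
  | step {h : GroupOf R} {m : ℕ} (hp : JoinedBy S g h m) (x : α × Bool)
      (hx : S (h * wordValue R [x])) : JoinedBy S g (h * wordValue R [x]) (m + 1)

namespace JoinedBy

variable {S S' : GroupOf R → Prop} {g h k : GroupOf R} {m n : ℕ}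

theorem left_mem (p : JoinedBy S g h m) : S g := by
  induction p with
  | refl hg => exact hg
  | step _ _ _ ih => exact ih

theorem right_mem (p : JoinedBy S g h m) : S h := by
  cases p with
  | refl hg => exact hg
  | step _ _ hx => exact hx

theorem mono (p : JoinedBy S g h m) (hS : ∀ z, S z → S' z) : JoinedBy S' g h m := by
  induction p with
  | refl hg => exact .refl (hS _ hg)
  | step _ x hx ih => exact ih.step x (hS _ hx)

theorem trans (p : JoinedBy S g h m) (q : JoinedBy S h k n) : JoinedBy S g k (m + n) := by
  induction q with
  | refl _ => exact p
  | step _ x hx ih => exact ih.step x hx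

theorem symm (p : JoinedBy S g h m) : JoinedBy S h g m := by
  induction p with
  | refl hg => exact .refl hg
  | @step h m hp x hx ih =>
    have h1 : JoinedBy S (h * wordValue R [x]) h (0 + 1) := by
      have := (JoinedBy.refl hx).step (invLetter x)
      rw [wordValue_invLetter, mul_inv_cancel_right] at this
      exact this hp.right_mem
    have := h1.trans ih
    rwa [zero_add, add_comm] at this

theorem exists_lineIntegral_eq_zero (p : JoinedBy S g h m) {φ : GroupOf R → α × Bool → ℝ}
    (hφ : ∀ z x, S z → S (z * wordValue R [x]) → φ z x = 0) :
    ∃ u : GenWord α, u.length = m ∧ g * wordValue R u = h ∧ lineIntegral φ g u = 0 := by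
  induction p with
  | refl _ => exact ⟨[], rfl, by rw [wordValue_nil, mul_one], rfl⟩
  | step hp x hx ih =>
    obtain ⟨u, rfl, rfl, h3⟩ := ih
    refine ⟨u ++ [x], by simp, by rw [wordValue_append, mul_assoc], ?_⟩
    rw [lineIntegral_append, h3, lineIntegral, lineIntegral, hφ _ x hp.right_mem hx]
    simp

theorem of_word (u : GenWord α) (hS : ∀ i ≤ u.length, S (g * wordValue R (u.take i))) :
    JoinedBy S g (g * wordValue R u) u.length := by
  induction u using List.reverseRecOn with
  | nil =>
    rw [wordValue_nil, mul_one]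
    exact .refl (by simpa [wordValue_nil] using hS 0 le_rfl)
  | append_singleton u x ih =>
    rw [wordValue_append, ← mul_assoc, List.length_append]
    refine (ih fun i hi => ?_).step x ?_
    · have := hS i (by rw [List.length_append]; omega)
      rwa [List.take_append_of_le_length hi] at this
    · have := hS (u ++ [x]).length le_rfl
      rwa [List.take_length, wordValue_append, ← mul_assoc] at this

/-- A geodesic between two points. -/
theorem geodesic (g h : GroupOf R) :
    JoinedBy (fun z => vertexDist g z + vertexDist z h ≤ vertexDist g h) g h (vertexDist g h) := by
  obtain ⟨u, rfl, hlen⟩ := exists_word_between g h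
  rw [← hlen]
  refine of_word u fun i hi => ?_
  have h1 : vertexDist g (g * wordValue R (u.take i)) ≤ i := by
    rw [vertexDist, inv_mul_cancel_left]
    exact (groupNorm_le _).trans (List.length_take_le _ _)
  have h2 : vertexDist (g * wordValue R (u.take i)) (g * wordValue R u) ≤ u.length - i := by
    rw [vertexDist, mul_inv_rev, mul_assoc, inv_mul_cancel_left]
    nth_rewrite 2 [← List.take_append_drop i u]
    rw [wordValue_append, inv_mul_cancel_left]
    exact (groupNorm_le _).trans (by rw [List.length_drop])
  omega

end JoinedBy

/-- The vertices `v lo, …, v hi` are the consecutive vertices of a geodesic. -/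
def IsGeodesicChain (v : ℕ → GroupOf R) (lo hi : ℕ) : Prop :=
  ∀ i j, lo ≤ i → i ≤ j → j ≤ hi → vertexDist (v i) (v j) = j - i

namespace IsGeodesicChain

variable {v : ℕ → GroupOf R} {lo hi : ℕ}

theorem mono (hv : IsGeodesicChain v lo hi) {lo' hi' : ℕ} (h1 : lo ≤ lo') (h2 : hi' ≤ hi) :
    IsGeodesicChain v lo' hi' :=
  fun i j hi hij hj => hv i j (h1.trans hi) hij (hj.trans h2)

theorem exists_letter (hv : IsGeodesicChain v lo hi) {i : ℕ} (h1 : lo ≤ i) (h2 : i + 1 ≤ hi) :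
    ∃ x, v (i + 1) = v i * wordValue R [x] :=
  exists_letter_of_vertexDist_eq_one (by rw [hv i (i + 1) h1 (Nat.le_succ _) h2]; omega)

theorem joinedBy (hv : IsGeodesicChain v lo hi) {S : GroupOf R → Prop} {i j : ℕ} (h1 : lo ≤ i)
    (hij : i ≤ j) (h2 : j ≤ hi) (hS : ∀ k, i ≤ k → k ≤ j → S (v k)) :
    JoinedBy S (v i) (v j) (j - i) := by
  induction j, hij using Nat.le_induction with
  | base =>
    rw [Nat.sub_self]
    exact .refl (hS i le_rfl le_rfl)
  | succ j hij ih =>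
    obtain ⟨x, hx⟩ := hv.exists_letter (h1.trans hij) h2
    have h3 := hS (j + 1) (by omega) le_rfl
    rw [hx] at h3 ⊢
    rw [show j + 1 - i = j - i + 1 by omega]
    exact (ih (by omega) fun k hk hk' => hS k hk (by omega)).step x h3

theorem exists_lineIntegral (hv : IsGeodesicChain v lo hi) (F T : GroupOf R → ℝ) {j : ℕ}
    (h1 : lo ≤ j) (h2 : j ≤ hi) :
    ∃ u : GenWord α, u.length = j - lo ∧ v lo * wordValue R u = v j ∧
      lineIntegral (areaForm F T) (v lo) u = ∑ k ∈ Finset.Ico lo j,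
        (F (v k) + F (v (k + 1))) / 2 * (T (v (k + 1)) - T (v k)) := by
  induction j, h1 using Nat.le_induction with
  | base => exact ⟨[], by simp, by rw [wordValue_nil, mul_one], by simp [lineIntegral]⟩
  | succ j hij ih =>
    obtain ⟨u, h3, h4, h5⟩ := ih (by omega)
    obtain ⟨x, hx⟩ := hv.exists_letter hij h2
    refine ⟨u ++ [x], ?_, ?_, ?_⟩
    · rw [List.length_append, h3, List.length_singleton]
      omega
    · rw [wordValue_append, ← mul_assoc, h4, hx]
    · rw [lineIntegral_append, h5, h4, Finset.sum_Ico_succ_top hij, lineIntegral, lineIntegral,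
        areaForm, ← hx, add_zero]

end IsGeodesicChain

theorem oneLipschitz_vertexDist (g : GroupOf R) :
    OneLipschitz fun z : GroupOf R => (vertexDist g z : ℝ) := by
  intro z x
  have h1 := vertexDist_mul_letter_le z x
  have h2 := vertexDist_triangle g z (z * wordValue R [x])
  have h3 := vertexDist_triangle g (z * wordValue R [x]) z
  rw [vertexDist_comm (z * wordValue R [x]) z] at h3
  have h4 : (vertexDist g (z * wordValue R [x]) : ℝ) ≤ vertexDist g z + 1 := by
    exact_mod_cast (by omega)
  have h5 : (vertexDist g z : ℝ) ≤ vertexDist g (z * wordValue R [x]) + 1 := by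
    exact_mod_cast (by omega)
  rw [abs_le]
  constructor <;> linarith

/-- The height above the complement of the `h`-neighbourhood of a part of a chain. -/
def bump (v : ℕ → GroupOf R) (K : Finset ℕ) (h : ℕ) (z : GroupOf R) : ℕ :=
  K.sup fun k => h - vertexDist z (v k)

theorem bump_le_add_one (v : ℕ → GroupOf R) (K : Finset ℕ) (h : ℕ) {z z' : GroupOf R}
    (hz : vertexDist z z' ≤ 1) : bump v K h z ≤ bump v K h z' + 1 := by
  refine Finset.sup_le fun k hk => ?_
  have h1 : h - vertexDist z' (v k) ≤ bump v K h z' :=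
    Finset.le_sup (f := fun k => h - vertexDist z' (v k)) hk
  have h2 := vertexDist_triangle z' z (v k)
  rw [vertexDist_comm z' z] at h2
  omega

theorem oneLipschitz_bump (v : ℕ → GroupOf R) (K : Finset ℕ) (h : ℕ) :
    OneLipschitz fun z : GroupOf R => (bump v K h z : ℝ) := by
  intro z x
  have h1 := vertexDist_mul_letter_le z x
  have h2 := bump_le_add_one v K h h1
  rw [vertexDist_comm] at h1
  have h3 := bump_le_add_one v K h h1
  have h4 : (bump v K h z : ℝ) ≤ bump v K h (z * wordValue R [x]) + 1 := by exact_mod_cast h2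
  have h5 : (bump v K h (z * wordValue R [x]) : ℝ) ≤ bump v K h z + 1 := by exact_mod_cast h3
  rw [abs_le]
  constructor <;> linarith

theorem bump_eq_zero {v : ℕ → GroupOf R} {K : Finset ℕ} {h : ℕ} {z : GroupOf R}
    (hz : ∀ k ∈ K, h ≤ vertexDist z (v k)) : bump v K h z = 0 :=
  Nat.le_zero.1 (Finset.sup_le fun k hk => (Nat.sub_eq_zero_of_le (hz k hk)).le)

theorem le_bump {v : ℕ → GroupOf R} {K : Finset ℕ} {h k : ℕ} (hk : k ∈ K) :
    h ≤ bump v K h (v k) := by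
  have : h - vertexDist (v k) (v k) ≤ bump v K h (v k) :=
    Finset.le_sup (f := fun l => h - vertexDist (v k) (v l)) hk
  rwa [vertexDist_self, Nat.sub_zero] at this

variable {C : ℝ}

/-- A geodesic whose middle part is far from the remaining part of a closed path is short. -/
theorem LinearIsoperimetric.strip (hR : LinearIsoperimetric R C) (hC : 0 < C)
    {v : ℕ → GroupOf R} {lo hi : ℕ} (hlo : lo ≤ hi) (hv : IsGeodesicChain v lo hi) {h m : ℕ}
    (hrest : JoinedBy (fun z => ∀ k, lo + 2 * h ≤ k → k + 2 * h ≤ hi → h ≤ vertexDist z (v k))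
      (v hi) (v lo) m) :
    C * (h * ((hi : ℝ) - lo - 4 * h)) ≤ maxRelatorLength R / 8 * ((hi : ℝ) - lo + m) := by
  have hlo' : (lo : ℝ) ≤ hi := by exact_mod_cast hlo
  rcases lt_or_ge hi (lo + 4 * h) with hlt | hge
  · have h1 : (hi : ℝ) < lo + 4 * h := by exact_mod_cast hlt
    have h2 : C * (h * ((hi : ℝ) - lo - 4 * h)) ≤ 0 :=
      mul_nonpos_of_nonneg_of_nonpos hC.le
        (mul_nonpos_of_nonneg_of_nonpos (Nat.cast_nonneg _) (by linarith))
    have h3 : 0 ≤ (hi : ℝ) - lo := by linarith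
    exact h2.trans (by positivity)
  -- `F` has height at least `h` on the middle part and vanishes on the rest of the closed path,
  -- while `T` grows by 1 at each step of the geodesic.
  let K := Finset.Icc (lo + 2 * h) (hi - 2 * h)
  let F : GroupOf R → ℝ := fun z => (bump v K h z : ℝ)
  let T : GroupOf R → ℝ := fun z => (vertexDist (v lo) z : ℝ)
  have hF0 : ∀ z, 0 ≤ F z := fun z => Nat.cast_nonneg _
  obtain ⟨u, hu1, hu2, hu3⟩ := hv.exists_lineIntegral F T hlo le_rfl
  obtain ⟨u', hu1', hu2', hu3'⟩ := hrest.exists_lineIntegral_eq_zero (φ := areaForm F T) (by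
    intro z x hz hzx
    have key : ∀ z, (∀ k, lo + 2 * h ≤ k → k + 2 * h ≤ hi → h ≤ vertexDist z (v k)) → F z = 0 := by
      intro z hz
      have : bump v K h z = 0 := bump_eq_zero fun k hk => by
        rw [Finset.mem_Icc] at hk
        exact hz k hk.1 (by omega)
      simp [F, this]
    rw [areaForm, key z hz, key _ hzx]
    simp)
  have hclosed : wordValue R (u ++ u') = 1 := by
    rw [← hu2, mul_assoc, ← wordValue_append] at hu2'
    exact mul_eq_left.1 hu2'
  have hmain := hR.abs_areaForm_le hC (oneLipschitz_bump v K h) (oneLipschitz_vertexDist (v lo))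
    hclosed (v lo)
  have hint : lineIntegral (areaForm F T) (v lo) (u ++ u') =
      ∑ k ∈ Finset.Ico lo hi, (F (v k) + F (v (k + 1))) / 2 * (T (v (k + 1)) - T (v k)) := by
    rw [lineIntegral_append, hu2, hu3', add_zero, hu3]
  have hT : ∀ k ∈ Finset.Ico lo hi, T (v (k + 1)) - T (v k) = 1 := by
    intro k hk
    rw [Finset.mem_Ico] at hk
    simp only [T]
    rw [hv lo (k + 1) le_rfl (by omega) (by omega), hv lo k le_rfl hk.1 hk.2.le,
      Nat.cast_sub (by omega), Nat.cast_sub hk.1]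
    push_cast
    ring
  -- Each of the `hi - lo - 4h` edges of the middle part contributes at least `h`, and the remaining
  -- edges contribute nonnegatively.
  have hlow : (h : ℝ) * ((hi : ℝ) - lo - 4 * h) ≤
      ∑ k ∈ Finset.Ico lo hi, (F (v k) + F (v (k + 1))) / 2 * (T (v (k + 1)) - T (v k)) := by
    have hsub : Finset.Ico (lo + 2 * h) (hi - 2 * h) ⊆ Finset.Ico lo hi :=
      Finset.Ico_subset_Ico (by omega) (by omega)
    refine le_trans ?_ (Finset.sum_le_sum_of_subset_of_nonneg hsub fun k hk _ => ?_)
    · have hcard : ((hi : ℝ) - lo - 4 * h) = (Finset.Ico (lo + 2 * h) (hi - 2 * h)).card := by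
        rw [Nat.card_Ico, Nat.cast_sub (by omega), Nat.cast_sub (by omega)]
        push_cast
        ring
      rw [hcard, mul_comm, ← nsmul_eq_mul]
      refine Finset.card_nsmul_le_sum _ _ _ fun k hk => ?_
      rw [hT k (hsub hk), mul_one]
      rw [Finset.mem_Ico] at hk
      have h1 : h ≤ bump v K h (v k) := le_bump (Finset.mem_Icc.2 ⟨hk.1, hk.2.le⟩)
      have h2 : h ≤ bump v K h (v (k + 1)) := le_bump (Finset.mem_Icc.2 ⟨by omega, hk.2⟩)
      have h1' : (h : ℝ) ≤ F (v k) := Nat.cast_le.2 h1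
      have h2' : (h : ℝ) ≤ F (v (k + 1)) := Nat.cast_le.2 h2
      linarith
    · rw [hT k hk, mul_one]
      have := hF0 (v k)
      have := hF0 (v (k + 1))
      linarith
  have hlen : ((u ++ u').length : ℝ) = (hi : ℝ) - lo + m := by
    rw [List.length_append, hu1, hu1', Nat.cast_add, Nat.cast_sub hlo]
  rw [hlen] at hmain
  refine le_trans (mul_le_mul_of_nonneg_left ?_ hC.le) hmain
  rw [← hint] at hlow
  exact hlow.trans (le_abs_self _)

/-- The strip inequality for a closed path that consists of a geodesic, two further parts that are
far from it, and three short connections. -/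
theorem LinearIsoperimetric.hexagon (hR : LinearIsoperimetric R C) (hC : 0 < C)
    {v : ℕ → GroupOf R} {lo hi : ℕ} (hlo : lo ≤ hi) (hv : IsGeodesicChain v lo hi) {h m n : ℕ}
    {e e' q q' r r' : GroupOf R} (he : (e = v hi ∧ e' = v lo) ∨ (e = v lo ∧ e' = v hi))
    (hq : JoinedBy (fun z => ∀ k, lo + 2 * h ≤ k → k + 2 * h ≤ hi → 2 * h ≤ vertexDist z (v k))
      q q' m)
    (hr : JoinedBy (fun z => ∀ k, lo + 2 * h ≤ k → k + 2 * h ≤ hi → 2 * h ≤ vertexDist z (v k))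
      r r' n)
    (heq : vertexDist e q ≤ 2 * h) (hqr : vertexDist q' r ≤ 2 * h)
    (hre : vertexDist r' e' ≤ 2 * h) :
    C * (h * ((hi : ℝ) - lo - 4 * h)) ≤
      maxRelatorLength R / 8 * ((hi : ℝ) - lo + m + n + 6 * h) := by
  let S : GroupOf R → Prop :=
    fun z => ∀ k, lo + 2 * h ≤ k → k + 2 * h ≤ hi → h ≤ vertexDist z (v k)
  let S' : GroupOf R → Prop :=
    fun z => ∀ k, lo + 2 * h ≤ k → k + 2 * h ≤ hi → 2 * h ≤ vertexDist z (v k)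
  have hSS : ∀ z, S' z → S z := fun z hz k h1 h2 => by
    have := hz k h1 h2
    omega
  -- A point of a connection of length at most 2h is within h of one of its ends, which is itself at
  -- least 2h from the middle part.
  have conn : ∀ a b, S' a → S' b → vertexDist a b ≤ 2 * h → JoinedBy S a b (vertexDist a b) := by
    intro a b ha hb hab
    refine (JoinedBy.geodesic a b).mono fun z hz k h1 h2 => ?_
    have h3 := ha k h1 h2
    have h4 := hb k h1 h2
    have h5 := vertexDist_triangle a z (v k)
    have h6 := vertexDist_triangle b z (v k)
    rw [vertexDist_comm b z] at h6
    omega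
  have hend : S' (v lo) ∧ S' (v hi) := by
    constructor
    · intro k h1 h2
      rw [hv lo k le_rfl (by omega) (by omega)]
      omega
    · intro k h1 h2
      rw [vertexDist_comm, hv k hi (by omega) (by omega) le_rfl]
      omega
  have hee : S' e ∧ S' e' := by
    rcases he with ⟨rfl, rfl⟩ | ⟨rfl, rfl⟩
    · exact hend.symm
    · exact hend
  have p := ((((conn e q hee.1 hq.left_mem heq).trans (hq.mono hSS)).trans
    (conn q' r hq.right_mem hr.left_mem hqr)).trans (hr.mono hSS)).trans
    (conn r' e' hr.right_mem hee.2 hre)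
  have p' : JoinedBy S (v hi) (v lo) (vertexDist e q + m + vertexDist q' r + n +
      vertexDist r' e') := by
    rcases he with ⟨rfl, rfl⟩ | ⟨rfl, rfl⟩
    · exact p
    · exact p.symm
  refine (hR.strip hC hlo hv p').trans (mul_le_mul_of_nonneg_left ?_ (by positivity))
  have h1 : (vertexDist e q : ℝ) ≤ 2 * h := by exact_mod_cast heq
  have h2 : (vertexDist q' r : ℝ) ≤ 2 * h := by exact_mod_cast hqr
  have h3 : (vertexDist r' e' : ℝ) ≤ 2 * h := by exact_mod_cast hre
  push_cast
  linarith

/-- The length of a gap whose two ends are close to one and the same geodesic. -/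
theorem LinearIsoperimetric.gap_same (hR : LinearIsoperimetric R C) (hC : 0 < C)
    {v u : ℕ → GroupOf R} {s s' n : ℕ} (hs : s ≤ s') (hv : IsGeodesicChain v s s')
    (hu : IsGeodesicChain u 0 n) {h β β' : ℕ} (hβ : β ≤ n) (hβ' : β' ≤ n)
    (h1 : vertexDist (v s) (u β) ≤ 2 * h) (h2 : vertexDist (v s') (u β') ≤ 2 * h)
    (hsep : ∀ i, s ≤ i → i ≤ s' → ∀ l ≤ n, 2 * h ≤ vertexDist (u l) (v i)) :
    C * (h * ((s' : ℝ) - s - 4 * h)) ≤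
      maxRelatorLength R / 8 * (2 * ((s' : ℝ) - s) + 10 * h) := by
  let S : GroupOf R → Prop :=
    fun z => ∀ k, s + 2 * h ≤ k → k + 2 * h ≤ s' → 2 * h ≤ vertexDist z (v k)
  have hS : ∀ l ≤ n, S (u l) := fun l hl k hk hk' => hsep k (by omega) (by omega) l hl
  obtain ⟨m, hm, hm'⟩ : ∃ m, JoinedBy S (u β') (u β) m ∧ m ≤ s' - s + 4 * h := by
    have h3 := vertexDist_triangle (u β') (v s') (u β)
    have h4 := vertexDist_triangle (v s') (v s) (u β)
    rw [vertexDist_comm (v s') (v s), hv s s' le_rfl hs le_rfl] at h4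
    rw [vertexDist_comm (u β') (v s')] at h3
    rcases le_total β β' with hle | hle
    · refine ⟨_, (hu.joinedBy (Nat.zero_le _) hle hβ' fun k _ hk => hS k (by omega)).symm, ?_⟩
      rw [vertexDist_comm (u β'), hu β β' (Nat.zero_le _) hle hβ'] at h3
      omega
    · refine ⟨_, hu.joinedBy (Nat.zero_le _) hle hβ fun k _ hk => hS k (by omega), ?_⟩
      rw [hu β' β (Nat.zero_le _) hle hβ] at h3
      omega
  have h5 := hR.hexagon hC hs hv (Or.inl ⟨rfl, rfl⟩) hm (JoinedBy.refl (hS β hβ)) h2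
    (by rw [vertexDist_self]; omega) (by rwa [vertexDist_comm])
  refine h5.trans (mul_le_mul_of_nonneg_left ?_ (by positivity))
  have h6 : (m : ℝ) ≤ (s' : ℝ) - s + 4 * h := by
    rw [← Nat.cast_sub hs]
    exact_mod_cast hm'
  push_cast
  linarith

/-- The length of a gap whose two ends are close to two different geodesics with a common end. -/
theorem LinearIsoperimetric.gap_diff (hR : LinearIsoperimetric R C) (hC : 0 < C)
    {v b c : ℕ → GroupOf R} {s s' n₂ n₃ : ℕ} (hs : s ≤ s') (hv : IsGeodesicChain v s s')
    (hb : IsGeodesicChain b 0 n₂) (hc : IsGeodesicChain c 0 n₃) {h β γ : ℕ} (hβ : β ≤ n₂)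
    (hγ : γ ≤ n₃) (hh : 1 ≤ h) {e e' : GroupOf R}
    (he : (e = v s' ∧ e' = v s) ∨ (e = v s ∧ e' = v s'))
    (h1 : vertexDist e (b β) ≤ 2 * h) (h2 : vertexDist e' (c γ) ≤ 2 * h)
    (hcorner : vertexDist (b n₂) (c 0) ≤ 2 * h)
    (hsepb : ∀ i, s ≤ i → i ≤ s' → ∀ l ≤ n₂, 2 * h ≤ vertexDist (b l) (v i))
    (hsepc : ∀ i, s ≤ i → i ≤ s' → ∀ l ≤ n₃, 2 * h ≤ vertexDist (c l) (v i)) :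
    ∃ B D : ℝ,
      C * (h * ((s' : ℝ) - s - 4 * h)) ≤
        maxRelatorLength R / 8 * ((s' : ℝ) - s + B + D + 6 * h) ∧
      C * (h * (B - 4 * h)) ≤ maxRelatorLength R / 8 * ((s' : ℝ) - s + B + D + 6 * h) ∧
      C * (h * (D - 4 * h)) ≤ maxRelatorLength R / 8 * ((s' : ℝ) - s + B + D + 6 * h) := by
  classical
  -- Cut off the common corner at the first passage of length at most 2h between the two sides. By
  -- minimality the remaining stretches are separated, so any of the three sides can serve as the
  -- geodesic of the hexagon.
  have hex : ∃ N, ∃ i j, β ≤ i ∧ i ≤ n₂ ∧ j ≤ γ ∧ vertexDist (b i) (c j) ≤ 2 * h ∧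
      (i - β) + (γ - j) = N := ⟨_, n₂, 0, hβ, le_rfl, Nat.zero_le _, hcorner, rfl⟩
  obtain ⟨β₁, γ₁, hβ₁, hβ₁', hγ₁, hd, hN⟩ := Nat.find_spec hex
  have hmin : ∀ i j, β ≤ i → i ≤ n₂ → j ≤ γ → (i - β) + (γ - j) < (β₁ - β) + (γ - γ₁) →
      2 * h ≤ vertexDist (b i) (c j) := by
    intro i j hi hi' hj hlt
    by_contra hcon
    exact Nat.find_min hex (hN ▸ hlt) ⟨i, j, hi, hi', hj, by omega, rfl⟩
  refine ⟨(β₁ : ℝ) - β, (γ : ℝ) - γ₁, ?_, ?_, ?_⟩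
  · have hp := hb.joinedBy (Nat.zero_le _) hβ₁ hβ₁' (S := fun z => ∀ k, s + 2 * h ≤ k →
      k + 2 * h ≤ s' → 2 * h ≤ vertexDist z (v k)) fun l _ hl k hk hk' =>
        hsepb k (by omega) (by omega) l (by omega)
    have hq := (hc.joinedBy (Nat.zero_le _) hγ₁ hγ (S := fun z => ∀ k, s + 2 * h ≤ k →
      k + 2 * h ≤ s' → 2 * h ≤ vertexDist z (v k)) fun l _ hl k hk hk' =>
        hsepc k (by omega) (by omega) l (by omega))
    have := hR.hexagon hC hs hv he hp hq h1 hd (by rwa [vertexDist_comm])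
    rwa [Nat.cast_sub hβ₁, Nat.cast_sub hγ₁] at this
  -- Now the stretch of `b` is the geodesic. Its middle indices are strictly below `β₁` because h ≥
  -- 1, so minimality separates them from `c`.
  · have hp : JoinedBy (fun z => ∀ k, β + 2 * h ≤ k → k + 2 * h ≤ β₁ →
        2 * h ≤ vertexDist z (b k)) e e' (s' - s) := by
      have := hv.joinedBy le_rfl hs le_rfl (S := fun z => ∀ k, β + 2 * h ≤ k → k + 2 * h ≤ β₁ →
        2 * h ≤ vertexDist z (b k)) fun l hl hl' k hk hk' => by
          rw [vertexDist_comm]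
          exact hsepb l hl hl' k (by omega)
      rcases he with ⟨rfl, rfl⟩ | ⟨rfl, rfl⟩
      · exact this.symm
      · exact this
    have hq := (hc.joinedBy (Nat.zero_le _) hγ₁ hγ (S := fun z => ∀ k, β + 2 * h ≤ k →
      k + 2 * h ≤ β₁ → 2 * h ≤ vertexDist z (b k)) fun l hl hl' k hk hk' => by
        rw [vertexDist_comm]
        exact hmin k l (by omega) (by omega) hl' (by omega)).symm
    have := hR.hexagon hC hβ₁ (hb.mono (Nat.zero_le _) hβ₁') (Or.inr ⟨rfl, rfl⟩) hp hq
      (by rwa [vertexDist_comm]) h2 (by rwa [vertexDist_comm])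
    rw [Nat.cast_sub hs, Nat.cast_sub hγ₁] at this
    refine this.trans_eq ?_
    ring
  · have hp : JoinedBy (fun z => ∀ k, γ₁ + 2 * h ≤ k → k + 2 * h ≤ γ →
        2 * h ≤ vertexDist z (c k)) e' e (s' - s) := by
      have := hv.joinedBy le_rfl hs le_rfl (S := fun z => ∀ k, γ₁ + 2 * h ≤ k → k + 2 * h ≤ γ →
        2 * h ≤ vertexDist z (c k)) fun l hl hl' k hk hk' => by
          rw [vertexDist_comm]
          exact hsepc l hl hl' k (by omega)
      rcases he with ⟨rfl, rfl⟩ | ⟨rfl, rfl⟩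
      · exact this
      · exact this.symm
    have hq := hb.joinedBy (Nat.zero_le _) hβ₁ hβ₁' (S := fun z => ∀ k, γ₁ + 2 * h ≤ k →
      k + 2 * h ≤ γ → 2 * h ≤ vertexDist z (c k)) fun l hl hl' k hk hk' =>
        hmin l k hl (by omega) (by omega) (by omega)
    have := hR.hexagon hC hγ₁ (hc.mono (Nat.zero_le _) hγ) (Or.inl ⟨rfl, rfl⟩) hp hq
      (by rwa [vertexDist_comm]) h1 hd
    rw [Nat.cast_sub hs, Nat.cast_sub hβ₁] at this
    refine this.trans_eq ?_
    ring

/-- The estimate that bounds the length of a gap. -/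
theorem gap_length_le {a h G P : ℝ} (ha : 1 ≤ a) (hah : a ≤ h) (hha : h ≤ a + 1)
    (hP : P ≤ 3 * G + 6 * h ∨ P ≤ 2 * G + 10 * h) (hG : h * (G - 4 * h) ≤ a / 8 * P) :
    G ≤ 24 * a - 4 * h - 4 := by
  -- The two alternatives give (8h - 3a)G ≤ 32h² + 6ah and (8h - 2a)G ≤ 32h² + 10ah; write h = a + t
  -- with 0 ≤ t ≤ 1.
  by_contra! hcon
  rcases hP with hP | hP
  · have h1 : a / 8 * P ≤ a / 8 * (3 * G + 6 * h) :=
      mul_le_mul_of_nonneg_left hP (by linarith)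
    have h2 : G * (8 * h - 3 * a) ≤ 32 * h ^ 2 + 6 * a * h := by nlinarith
    have h3 : (24 * a - 4 * h - 4) * (8 * h - 3 * a) < G * (8 * h - 3 * a) :=
      mul_lt_mul_of_pos_right hcon (by linarith)
    obtain ⟨t, rfl⟩ : ∃ t, h = a + t := ⟨h - a, by ring⟩
    nlinarith [mul_nonneg (by linarith : (0 : ℝ) ≤ t) (by linarith : (0 : ℝ) ≤ a - 1),
      mul_nonneg (by linarith : (0 : ℝ) ≤ t) (by linarith : (0 : ℝ) ≤ 1 - t), sq_nonneg (a - 1)]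
  · have h1 : a / 8 * P ≤ a / 8 * (2 * G + 10 * h) :=
      mul_le_mul_of_nonneg_left hP (by linarith)
    have h2 : G * (8 * h - 2 * a) ≤ 32 * h ^ 2 + 10 * a * h := by nlinarith
    have h3 : (24 * a - 4 * h - 4) * (8 * h - 2 * a) < G * (8 * h - 2 * a) :=
      mul_lt_mul_of_pos_right hcon (by linarith)
    obtain ⟨t, rfl⟩ : ∃ t, h = a + t := ⟨h - a, by ring⟩
    nlinarith [mul_nonneg (by linarith : (0 : ℝ) ≤ t) (by linarith : (0 : ℝ) ≤ a - 1),
      mul_nonneg (by linarith : (0 : ℝ) ≤ t) (by linarith : (0 : ℝ) ≤ 1 - t), sq_nonneg (a - 1)]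

/-- A maximal gap around a point where a property fails. -/
theorem exists_gap {P : ℕ → Prop} {k n : ℕ} (h0 : P 0) (hn : P n) (hk : ¬ P k) (hkn : k ≤ n) :
    ∃ s s', s < k ∧ k < s' ∧ s' ≤ n ∧ P s ∧ P s' ∧ ∀ i, s < i → i < s' → ¬ P i := by
  classical
  have hex : ∃ j, k ≤ j ∧ P j := ⟨n, hkn, hn⟩
  obtain ⟨h1, h2⟩ := Nat.find_spec hex
  have h3 : P (Nat.findGreatest P k) := Nat.findGreatest_spec (Nat.zero_le k) h0
  have h4 : Nat.findGreatest P k ≤ k := Nat.findGreatest_le k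
  refine ⟨Nat.findGreatest P k, Nat.find hex, ?_, ?_, Nat.find_min' hex ⟨hkn, hn⟩, h3, h2,
    fun i hi hi' => ?_⟩
  · exact h4.lt_of_ne fun h => hk (h ▸ h3)
  · exact h1.lt_of_ne fun h => hk (h ▸ h2)
  · rcases le_total i k with hik | hik
    · exact Nat.findGreatest_is_greatest hi hik
    · exact fun h => Nat.find_min hex hi' ⟨hik, h⟩

/-- Triangles with vertices at group elements are thin. -/
theorem LinearIsoperimetric.thin_triangle (hR : LinearIsoperimetric R C) (hC : 0 < C) {a : ℝ}
    (ha : 1 ≤ a) (haC : (maxRelatorLength R : ℝ) = a * C) {v b c : ℕ → GroupOf R} {n₁ n₂ n₃ : ℕ}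
    (hv : IsGeodesicChain v 0 n₁) (hb : IsGeodesicChain b 0 n₂) (hc : IsGeodesicChain c 0 n₃)
    (hvb : vertexDist (v n₁) (b 0) ≤ 2) (hbc : vertexDist (b n₂) (c 0) ≤ 2)
    (hcv : vertexDist (c n₃) (v 0) ≤ 2) {k : ℕ} (hk : k ≤ n₁) :
    (∃ l ≤ n₂, (vertexDist (v k) (b l) : ℝ) ≤ 12 * a - 2) ∨
      (∃ l ≤ n₃, (vertexDist (v k) (c l) : ℝ) ≤ 12 * a - 2) := by
  obtain ⟨h, hah, hha⟩ : ∃ h : ℕ, a ≤ h ∧ (h : ℝ) ≤ a + 1 :=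
    ⟨⌈a⌉₊, Nat.le_ceil a, (Nat.ceil_lt_add_one (by linarith)).le⟩
  have hh : 1 ≤ h := by exact_mod_cast ha.trans hah
  let near : ℕ → Prop := fun i =>
    (∃ l ≤ n₂, vertexDist (v i) (b l) ≤ 2 * h) ∨ (∃ l ≤ n₃, vertexDist (v i) (c l) ≤ 2 * h)
  have final : ∀ i ≤ n₁, near i → (vertexDist (v k) (v i) : ℝ) ≤ 12 * a - 2 - 2 * h →
      (∃ l ≤ n₂, (vertexDist (v k) (b l) : ℝ) ≤ 12 * a - 2) ∨
      (∃ l ≤ n₃, (vertexDist (v k) (c l) : ℝ) ≤ 12 * a - 2) := by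
    intro i hi hn hd
    have key : ∀ z, vertexDist (v i) z ≤ 2 * h → (vertexDist (v k) z : ℝ) ≤ 12 * a - 2 := by
      intro z hz
      have h1 : (vertexDist (v k) z : ℝ) ≤ vertexDist (v k) (v i) + vertexDist (v i) z := by
        exact_mod_cast vertexDist_triangle _ _ _
      have h2 : (vertexDist (v i) z : ℝ) ≤ 2 * h := by exact_mod_cast hz
      linarith
    rcases hn with ⟨l, hl, h1⟩ | ⟨l, hl, h1⟩
    · exact Or.inl ⟨l, hl, key _ h1⟩
    · exact Or.inr ⟨l, hl, key _ h1⟩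
  by_cases hkn : near k
  · refine final k hk hkn ?_
    rw [vertexDist_self, Nat.cast_zero]
    linarith
  obtain ⟨s, s', hsk, hks, hs', hns, hns', hgap⟩ := exists_gap (P := near) (n := n₁)
    (Or.inr ⟨n₃, le_rfl, by rw [vertexDist_comm]; omega⟩) (Or.inl ⟨0, Nat.zero_le _, by omega⟩)
    hkn hk
  have hvs : IsGeodesicChain v s s' := hv.mono (Nat.zero_le _) hs'
  -- Interior vertices of the gap are at least 2h + 1 away, so the two end vertices, being adjacent
  -- to interior ones, are still at least 2h away.
  have sep : ∀ z, (∀ i, s < i → i < s' → 2 * h < vertexDist (v i) z) →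
      ∀ i, s ≤ i → i ≤ s' → 2 * h ≤ vertexDist z (v i) := by
    intro z hz i hi hi'
    rw [vertexDist_comm]
    rcases hi.eq_or_lt with rfl | hlt
    · have h1 := hz (s + 1) (by omega) (by omega)
      have h2 := vertexDist_triangle (v (s + 1)) (v s) z
      rw [vertexDist_comm (v (s + 1)) (v s), hvs s (s + 1) le_rfl (by omega) (by omega)] at h2
      omega
    · rcases hi'.eq_or_lt with rfl | hlt'
      · have h1 := hz (i - 1) (by omega) (by omega)
        have h2 := vertexDist_triangle (v (i - 1)) (v i) z
        rw [hvs (i - 1) i (by omega) (by omega) le_rfl] at h2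
        omega
      · exact (hz i hlt hlt').le
  have hsepb : ∀ i, s ≤ i → i ≤ s' → ∀ l ≤ n₂, 2 * h ≤ vertexDist (b l) (v i) :=
    fun i hi hi' l hl => sep _ (fun j hj hj' => by
      by_contra hcon
      exact hgap j hj hj' (Or.inl ⟨l, hl, by omega⟩)) i hi hi'
  have hsepc : ∀ i, s ≤ i → i ≤ s' → ∀ l ≤ n₃, 2 * h ≤ vertexDist (c l) (v i) :=
    fun i hi hi' l hl => sep _ (fun j hj hj' => by
      by_contra hcon
      exact hgap j hj hj' (Or.inr ⟨l, hl, by omega⟩)) i hi hi'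
  have hdiv : ∀ {X P : ℝ}, C * X ≤ maxRelatorLength R / 8 * P → X ≤ a / 8 * P := by
    intro X P hXP
    rw [haC] at hXP
    refine le_of_mul_le_mul_left ?_ hC
    linarith
  have hss : s ≤ s' := by omega
  have hdiff : ∀ {e e' : GroupOf R} {β γ : ℕ}, β ≤ n₂ → γ ≤ n₃ →
      ((e = v s' ∧ e' = v s) ∨ (e = v s ∧ e' = v s')) → vertexDist e (b β) ≤ 2 * h →
      vertexDist e' (c γ) ≤ 2 * h → (s' : ℝ) - s ≤ 24 * a - 4 * h - 4 := by
    intro e e' β γ hβ hγ he h1 h2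
    obtain ⟨B, D, hG, hB, hD⟩ := hR.gap_diff hC hss hvs hb hc hβ hγ hh he h1 h2 (by omega)
      hsepb hsepc
    replace hG := hdiv hG
    replace hB := hdiv hB
    replace hD := hdiv hD
    -- Apply the length estimate to the longest of the three sides; the perimeter is at most three
    -- times that length plus 6h.
    rcases le_total B ((s' : ℝ) - s) with hB' | hB'
    · rcases le_total D ((s' : ℝ) - s) with hD' | hD'
      · exact gap_length_le ha hah hha (Or.inl (by linarith)) hG
      · exact hD'.trans (gap_length_le ha hah hha (Or.inl (by linarith)) hD)
    · rcases le_total B D with hBD | hBD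
      · exact (hB'.trans hBD).trans (gap_length_le ha hah hha (Or.inl (by linarith)) hD)
      · exact hB'.trans (gap_length_le ha hah hha (Or.inl (by linarith)) hB)
  have hG : (s' : ℝ) - s ≤ 24 * a - 4 * h - 4 := by
    rcases hns with ⟨β, hβ, h1⟩ | ⟨γ, hγ, h1⟩ <;> rcases hns' with ⟨β', hβ', h2⟩ | ⟨γ', hγ', h2⟩
    · exact gap_length_le ha hah hha (Or.inr le_rfl)
        (hdiv (hR.gap_same hC hss hvs hb hβ hβ' h1 h2 hsepb))
    · exact hdiff hβ hγ' (Or.inr ⟨rfl, rfl⟩) h1 h2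
    · exact hdiff hβ' hγ (Or.inl ⟨rfl, rfl⟩) h2 h1
    · exact gap_length_le ha hah hha (Or.inr le_rfl)
        (hdiv (hR.gap_same hC hss hvs hc hγ hγ' h1 h2 hsepc))
  -- The nearer end of the gap is at distance at most half its length, 12a - 2h - 2; from there
  -- another 2h reaches one of the other sides.
  rcases le_total ((k : ℝ) - s) ((s' : ℝ) - k) with hle | hle
  · refine final s (by omega) hns ?_
    rw [vertexDist_comm, hvs s k le_rfl hsk.le hks.le, Nat.cast_sub hsk.le]
    linarith
  · refine final s' hs' hns' ?_
    rw [hvs k s' hsk.le hks.le le_rfl, Nat.cast_sub hks.le]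
    linarith

end DiscreteGeometry

end

/-! ### Vertices and distances in the geometric Cayley graph -/

noncomputable section

namespace CayleyGraph

variable {α : Type*} {R : Finset (GenWord α)}

theorem dist_eq (p q : CayleyGraph R) : dist p q = graphDist p q := rfl

/-- The vertex `g`, described as the initial point of the edge that is labelled by `x`. -/
def vertex (x : α) (g : GroupOf R) : CayleyGraph R := ⟨g, x, 0, le_rfl, zero_le_one⟩

theorem dist_eq_zero_of_eq {p q : CayleyGraph R} (hb : p.base = q.base) (hg : p.gen = q.gen)
    (ht : p.t = q.t) : dist p q = 0 := by
  refine le_antisymm ?_ dist_nonneg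
  have := graphDist_le_abs p q hb hg
  rwa [ht, sub_self, abs_zero] at this

theorem exists_dist_vertex (x : α) (g : GroupOf R) (q : CayleyGraph R) :
    ∃ j, dist (vertex x g) q = vertexDist g (q.endpoint j) + q.offset j := by
  rcases graphDist_cases (vertex x g) q with h | ⟨hb, hg, h⟩
  · obtain ⟨i, j, hij⟩ := exists_throughDist (vertex x g) q
    refine ⟨j, ?_⟩
    rw [dist_eq, h]
    refine le_antisymm ?_ ?_
    · have := throughDist_le (vertex x g) q false j
      simpa only [vertex, offset, endpoint, zero_add] using this
    · rw [hij]
      have h1 := vertexDist_endpoint (vertex x g) false i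
      have h2 : (vertexDist g (q.endpoint j) : ℝ) ≤
          vertexDist g ((vertex x g).endpoint i) +
            vertexDist ((vertex x g).endpoint i) (q.endpoint j) := by
        exact_mod_cast vertexDist_triangle _ _ _
      have h3 : (vertex x g).offset false = 0 := rfl
      have h4 : (vertex x g).endpoint false = g := rfl
      rw [h3, h4] at h1
      linarith
  · refine ⟨false, ?_⟩
    have hb' : g = q.base := hb
    rw [dist_eq, h, hb']
    simp only [vertex, endpoint, offset, vertexDist_self, zero_sub, abs_neg, Nat.cast_zero,
      zero_add, abs_of_nonneg q.t_nonneg]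

theorem dist_vertex_le (x : α) (g : GroupOf R) (q : CayleyGraph R) (j : Bool) :
    dist (vertex x g) q ≤ vertexDist g (q.endpoint j) + q.offset j := by
  have := (graphDist_le_throughDist (vertex x g) q).trans (throughDist_le (vertex x g) q false j)
  simpa only [dist_eq, vertex, offset, endpoint, zero_add] using this

theorem dist_vertex_endpoint_le (x : α) (q : CayleyGraph R) (j : Bool) :
    dist (vertex x (q.endpoint j)) q ≤ q.offset j := by
  have := dist_vertex_le x (q.endpoint j) q j
  rwa [vertexDist_self, Nat.cast_zero, zero_add] at this

theorem dist_vertex_vertex (x y : α) (g h : GroupOf R) :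
    dist (vertex x g) (vertex y h) = vertexDist g h := by
  refine le_antisymm ?_ ?_
  · have := dist_vertex_le x g (vertex y h) false
    simpa only [vertex, endpoint, offset, add_zero] using this
  · obtain ⟨j, hj⟩ := exists_dist_vertex x g (vertex y h)
    have h1 := vertexDist_endpoint (vertex y h) j false
    have h2 : (vertexDist g h : ℝ) ≤ vertexDist g ((vertex y h).endpoint j) +
        vertexDist ((vertex y h).endpoint j) h := by
      exact_mod_cast vertexDist_triangle _ _ _
    have h3 : (vertex y h).offset false = 0 := rfl
    have h4 : (vertex y h).endpoint false = h := rfl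
    rw [h3, h4] at h1
    linarith

/-- A point is a vertex. -/
def IsVertex (p : CayleyGraph R) : Prop := ∃ j, p.offset j = 0

theorem IsVertex.exists_dist_eq_zero {p : CayleyGraph R} (hp : p.IsVertex) (x : α) :
    ∃ g, dist (vertex x g) p = 0 := by
  obtain ⟨j, hj⟩ := hp
  exact ⟨p.endpoint j, le_antisymm ((dist_vertex_endpoint_le x p j).trans hj.le) dist_nonneg⟩

/-- The distance is an integer plus an offset in [0, 1]. Integrality forces the offset to be 0, or 1
and then the offset from the other end is 0. -/
theorem isVertex_of_dist_eq_natCast {x : α} {g : GroupOf R} {q : CayleyGraph R} {n : ℕ}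
    (h : dist (vertex x g) q = n) : q.IsVertex := by
  obtain ⟨j, hj⟩ := exists_dist_vertex x g q
  rw [h] at hj
  have h0 := q.offset_nonneg j
  have h1 : q.offset j ≤ 1 := by
    have := q.t_nonneg
    have := q.t_le_one
    cases j <;> simp only [offset] <;> linarith
  have hle : vertexDist g (q.endpoint j) ≤ n := by
    have : (vertexDist g (q.endpoint j) : ℝ) ≤ n := by linarith
    exact_mod_cast this
  have hle' : n ≤ vertexDist g (q.endpoint j) + 1 := by
    have : (n : ℝ) ≤ vertexDist g (q.endpoint j) + 1 := by linarith
    exact_mod_cast this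
  rcases hle.eq_or_lt with h2 | h2
  · refine ⟨j, ?_⟩
    rw [h2] at hj
    linarith
  · have h3 : n = vertexDist g (q.endpoint j) + 1 := by omega
    rw [h3] at hj
    push_cast at hj
    refine ⟨!j, ?_⟩
    cases j <;> simp only [offset, Bool.not_true, Bool.not_false] at hj ⊢ <;> linarith

theorem IsVertex.exists_dist_eq_natCast {p q : CayleyGraph R} (hp : p.IsVertex)
    (hq : q.IsVertex) : ∃ n : ℕ, dist p q = n := by
  obtain ⟨g, hg⟩ := hp.exists_dist_eq_zero p.gen
  obtain ⟨h, hh⟩ := hq.exists_dist_eq_zero p.gen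
  refine ⟨vertexDist g h, ?_⟩
  rw [← dist_vertex_vertex p.gen p.gen g h]
  have h1 := dist_triangle4 (vertex p.gen g) p q (vertex p.gen h)
  have h2 := dist_triangle4 p (vertex p.gen g) (vertex p.gen h) q
  rw [dist_comm q] at h1
  rw [dist_comm p (vertex p.gen g)] at h2
  linarith

theorem not_isVertex {p : CayleyGraph R} (hp : ¬ p.IsVertex) : 0 < p.t ∧ p.t < 1 := by
  constructor
  · exact p.t_nonneg.lt_of_ne fun h => hp ⟨false, h.symm⟩
  · refine p.t_le_one.lt_of_ne fun h => hp ⟨true, ?_⟩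
    rw [offset, h, sub_self]

/-- Points that are close to an interior point of an edge lie on this edge. -/
theorem eq_of_dist_lt {p q : CayleyGraph R} (h : dist p q < min p.t (1 - p.t)) :
    p.base = q.base ∧ p.gen = q.gen ∧ dist p q = |p.t - q.t| := by
  rcases graphDist_cases p q with h1 | h1
  · exfalso
    obtain ⟨i, j, hij⟩ := exists_throughDist p q
    rw [dist_eq, h1, hij] at h
    have h2 := q.offset_nonneg j
    have h3 : (0 : ℝ) ≤ vertexDist (p.endpoint i) (q.endpoint j) := Nat.cast_nonneg _
    have h4 : min p.t (1 - p.t) ≤ p.offset i := by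
      cases i
      · exact min_le_left _ _
      · exact min_le_right _ _
    linarith
  · exact h1

end CayleyGraph

/-! ### From real geodesics to chains of vertices -/

section RealGeodesics

open CayleyGraph

variable {α : Type*} {R : Finset (GenWord α)}

/-- A path without vertices cannot change its edge, as the edge is locally constant on a connected
interval; but interior points of one edge are less than 1 apart. -/
theorem IsGeodesic.exists_isVertex {γ : ℝ → CayleyGraph R} {L : ℝ} {x y : CayleyGraph R}
    (hγ : IsGeodesic γ L x y) (hL : 1 ≤ L) : ∃ s ∈ Set.Icc (0 : ℝ) 1, (γ s).IsVertex := by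
  by_contra! hcon
  have hmem : ∀ s : Set.Icc (0 : ℝ) 1, (s : ℝ) ∈ Set.Icc 0 L :=
    fun s => ⟨s.2.1, s.2.2.trans hL⟩
  let f : Set.Icc (0 : ℝ) 1 → GroupOf R × α := fun s => ((γ s).base, (γ s).gen)
  have hf : IsLocallyConstant f := by
    rw [IsLocallyConstant.iff_eventually_eq]
    intro s
    obtain ⟨h0, h1⟩ := not_isVertex (hcon s s.2)
    have hε : 0 < min (γ s).t (1 - (γ s).t) := lt_min h0 (by linarith)
    filter_upwards [Metric.ball_mem_nhds s hε] with s' hs'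
    have hd : dist (γ s) (γ s') < min (γ s).t (1 - (γ s).t) := by
      rw [hγ.isometry s (hmem s) s' (hmem s'), abs_sub_comm]
      exact hs'
    obtain ⟨hb, hg, -⟩ := eq_of_dist_lt hd
    exact Prod.ext hb.symm hg.symm
  have h01 : f ⟨0, by simp⟩ = f ⟨1, by simp⟩ := hf.apply_eq_of_preconnectedSpace _ _
  have h1 := graphDist_le_abs (γ 0) (γ 1) (congrArg Prod.fst h01) (congrArg Prod.snd h01)
  rw [← dist_eq, hγ.isometry 0 ⟨le_rfl, by linarith⟩ 1 ⟨zero_le_one, hL⟩] at h1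
  obtain ⟨h2, h3⟩ := not_isVertex (hcon 0 (by simp))
  obtain ⟨h4, h5⟩ := not_isVertex (hcon 1 (by simp))
  have h6 : |(γ 0).t - (γ 1).t| < 1 := abs_lt.2 ⟨by linarith, by linarith⟩
  rw [zero_sub, abs_neg, abs_one] at h1
  linarith

/-- A geodesic of the Cayley graph follows a geodesic chain of vertices. -/
theorem IsGeodesic.exists_chain {γ : ℝ → CayleyGraph R} {L : ℝ} {x y : CayleyGraph R}
    (hγ : IsGeodesic γ L x y) (a : α) : ∃ (n : ℕ) (v : ℕ → GroupOf R), IsGeodesicChain v 0 n ∧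
      (∀ k ≤ n, ∃ t ∈ Set.Icc 0 L, dist (vertex a (v k)) (γ t) ≤ 1 / 2) ∧
      (∀ s ∈ Set.Icc 0 L, ∃ k ≤ n, dist (γ s) (vertex a (v k)) ≤ 3 / 2) ∧
      dist x (vertex a (v 0)) ≤ 1 ∧ dist (vertex a (v n)) y ≤ 3 / 2 := by
  rcases le_or_gt 1 L with hL | hL
  · obtain ⟨s₀, hs₀, hvert⟩ := hγ.exists_isVertex hL
    obtain ⟨g₀, hg₀⟩ := hvert.exists_dist_eq_zero a
    have hs₀L : s₀ ≤ L := hs₀.2.trans hL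
    let n := ⌊L - s₀⌋₊
    have hn : (n : ℝ) ≤ L - s₀ := Nat.floor_le (by linarith)
    have hn' : L - s₀ < n + 1 := Nat.lt_floor_add_one _
    have hmem : ∀ k ≤ n, s₀ + (k : ℝ) ∈ Set.Icc 0 L := fun k hk => by
      have : (k : ℝ) ≤ n := Nat.cast_le.2 hk
      have h0 : (0 : ℝ) ≤ k := Nat.cast_nonneg k
      exact ⟨by linarith [hs₀.1], by linarith⟩
    -- Points at integer distance from the vertex at `s₀` are again vertices; the value 1 for k > n
    -- is never used.
    have hex : ∀ k, ∃ g : GroupOf R, k ≤ n → dist (vertex a g) (γ (s₀ + k)) = 0 := by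
      intro k
      by_cases hk : k ≤ n
      · have h1 : dist (vertex a g₀) (γ (s₀ + k)) = k := by
          have h2 : dist (γ s₀) (γ (s₀ + k)) = k := by
            rw [hγ.isometry s₀ ⟨hs₀.1, hs₀L⟩ _ (hmem k hk), sub_add_cancel_left, abs_neg,
              Nat.abs_cast]
          have h3 := dist_triangle (vertex a g₀) (γ s₀) (γ (s₀ + k))
          have h4 := dist_triangle (γ s₀) (vertex a g₀) (γ (s₀ + k))
          rw [dist_comm (γ s₀) (vertex a g₀)] at h4
          linarith
        obtain ⟨g, hg⟩ := (isVertex_of_dist_eq_natCast h1).exists_dist_eq_zero a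
        exact ⟨g, fun _ => hg⟩
      · exact ⟨1, fun h => absurd h hk⟩
    choose v hv using hex
    have hv0 : dist (γ s₀) (vertex a (v 0)) = 0 := by
      have := hv 0 (Nat.zero_le _)
      rwa [Nat.cast_zero, add_zero, dist_comm] at this
    have hx : ∀ s ∈ Set.Icc 0 L, s ≤ s₀ → dist (γ s) (vertex a (v 0)) ≤ 1 := fun s hs hss => by
      have h1 := dist_triangle (γ s) (γ s₀) (vertex a (v 0))
      rw [hv0, hγ.isometry s hs s₀ ⟨hs₀.1, hs₀L⟩, abs_sub_comm, abs_of_nonneg (by linarith)] at h1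
      linarith [hs.1, hs₀.2]
    have hlate : ∀ s ∈ Set.Icc 0 L, s₀ ≤ s →
        ⌊s - s₀⌋₊ ≤ n ∧ dist (γ s) (vertex a (v ⌊s - s₀⌋₊)) ≤ 1 := fun s hs hss => by
      have hk : ⌊s - s₀⌋₊ ≤ n := Nat.floor_le_floor (by linarith [hs.2])
      refine ⟨hk, ?_⟩
      have h1 := dist_triangle (γ s) (γ (s₀ + (⌊s - s₀⌋₊ : ℝ))) (vertex a (v ⌊s - s₀⌋₊))
      have h2 := hv _ hk
      rw [dist_comm] at h2
      have h3 : (⌊s - s₀⌋₊ : ℝ) ≤ s - s₀ := Nat.floor_le (by linarith)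
      have h4 : s - s₀ < ⌊s - s₀⌋₊ + 1 := Nat.lt_floor_add_one _
      rw [h2, hγ.isometry s hs _ (hmem _ hk), abs_of_nonneg (by linarith)] at h1
      linarith
    refine ⟨n, v, fun i j _ hij hj => ?_, fun k hk => ?_, fun s hs => ?_, ?_, ?_⟩
    · have h1 := dist_triangle4 (vertex a (v i)) (γ (s₀ + i)) (γ (s₀ + j)) (vertex a (v j))
      have h2 := dist_triangle4 (γ (s₀ + i)) (vertex a (v i)) (vertex a (v j)) (γ (s₀ + j))
      have h3 := hv i (hij.trans hj)
      have h4 := hv j hj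
      have h5 : dist (γ (s₀ + i)) (γ (s₀ + j)) = (j : ℝ) - i := by
        have : (i : ℝ) ≤ j := Nat.cast_le.2 hij
        rw [hγ.isometry _ (hmem i (hij.trans hj)) _ (hmem j hj), abs_sub_comm,
          abs_of_nonneg (by linarith)]
        ring
      rw [dist_comm (γ (s₀ + j)), dist_vertex_vertex] at h1
      rw [dist_comm (γ (s₀ + i)) (vertex a (v i)), dist_vertex_vertex] at h2
      have h6 : ((vertexDist (v i) (v j) : ℕ) : ℝ) = ((j - i : ℕ) : ℝ) := by
        rw [Nat.cast_sub hij]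
        linarith
      exact_mod_cast h6
    · exact ⟨_, hmem k hk, (hv k hk).le.trans (by norm_num)⟩
    · rcases le_total s s₀ with hss | hss
      · exact ⟨0, Nat.zero_le _, (hx s hs hss).trans (by norm_num)⟩
      · obtain ⟨h1, h2⟩ := hlate s hs hss
        exact ⟨_, h1, h2.trans (by norm_num)⟩
    · have := hx 0 ⟨le_rfl, hγ.nonneg⟩ hs₀.1
      rwa [hγ.source] at this
    · obtain ⟨-, h2⟩ := hlate L ⟨hγ.nonneg, le_rfl⟩ hs₀L
      rw [hγ.target, dist_comm] at h2
      exact h2.trans (by norm_num)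
  -- A geodesic shorter than 1 may contain no vertex; it is replaced by the end of the initial edge
  -- nearest to its source.
  · obtain ⟨j, hj⟩ : ∃ j, (γ 0).offset j ≤ 1 / 2 := by
      rcases le_total (γ 0).t (1 / 2) with h | h
      · exact ⟨false, h⟩
      · exact ⟨true, by rw [offset]; linarith⟩
    have h0 : dist (vertex a ((γ 0).endpoint j)) (γ 0) ≤ 1 / 2 :=
      (dist_vertex_endpoint_le a _ j).trans hj
    have hs : ∀ s ∈ Set.Icc 0 L, dist (γ s) (vertex a ((γ 0).endpoint j)) ≤ 3 / 2 := by
      intro s hs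
      have h1 := dist_triangle (γ s) (γ 0) (vertex a ((γ 0).endpoint j))
      rw [hγ.isometry s hs 0 ⟨le_rfl, hγ.nonneg⟩, sub_zero, abs_of_nonneg hs.1,
        dist_comm (γ 0)] at h1
      linarith [hs.2]
    refine ⟨0, fun _ => (γ 0).endpoint j, fun i j _ hij hj => ?_, fun k _ => ?_,
      fun s h => ⟨0, le_rfl, hs s h⟩, ?_, ?_⟩
    · rw [vertexDist_self]
      omega
    · exact ⟨0, ⟨le_rfl, hγ.nonneg⟩, h0⟩
    · rw [← hγ.source, dist_comm]
      exact h0.trans (by norm_num)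
    · have := hs L ⟨hγ.nonneg, le_rfl⟩
      rwa [hγ.target, dist_comm] at this

theorem LinearIsoperimetric.ripsHyperbolic {C : ℝ} (hR : LinearIsoperimetric R C) (hC : 0 < C)
    {a : ℝ} (ha : 1 ≤ a) (haC : (maxRelatorLength R : ℝ) = a * C) :
    RipsHyperbolic (CayleyGraph R) (12 * a) := by
  intro x y z γ₁ γ₂ γ₃ L₁ L₂ L₃ h₁ h₂ h₃ s hs
  obtain ⟨n₁, v, hv, -, hv', hv0, hvn⟩ := h₁.exists_chain x.gen
  obtain ⟨n₂, b, hb, hb', -, hb0, hbn⟩ := h₂.exists_chain x.gen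
  obtain ⟨n₃, c, hc, hc', -, hc0, hcn⟩ := h₃.exists_chain x.gen
  have corner : ∀ {g h : GroupOf R} {p : CayleyGraph R}, dist (vertex x.gen g) p ≤ 3 / 2 →
      dist p (vertex x.gen h) ≤ 1 → vertexDist g h ≤ 2 := by
    intro g h p h1 h2
    have h3 := dist_triangle (vertex x.gen g) p (vertex x.gen h)
    rw [dist_vertex_vertex] at h3
    -- The bound 3/2 + 1 < 3 rounds down to 2 because vertex distances are integers.
    have h4 : (vertexDist g h : ℝ) < (3 : ℕ) := by push_cast; linarith
    exact Nat.lt_succ_iff.1 (Nat.cast_lt.1 h4)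
  obtain ⟨k, hk, hsk⟩ := hv' s hs
  -- The errors 3/2 and 1/2 at the two ends use up exactly the reserve of 2.
  have key : ∀ {g : GroupOf R} {p : CayleyGraph R}, (vertexDist (v k) g : ℝ) ≤ 12 * a - 2 →
      dist (vertex x.gen g) p ≤ 1 / 2 → dist (γ₁ s) p ≤ 12 * a := by
    intro g p h1 h2
    have h3 := dist_triangle4 (γ₁ s) (vertex x.gen (v k)) (vertex x.gen g) p
    rw [dist_vertex_vertex] at h3
    linarith
  rcases hR.thin_triangle hC ha haC hv hb hc (corner hvn hb0) (corner hbn hc0) (corner hcn hv0) hk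
    with ⟨l, hl, h⟩ | ⟨l, hl, h⟩
  · obtain ⟨t, ht, htl⟩ := hb' l hl
    exact Or.inl ⟨t, ht, key h htl⟩
  · obtain ⟨t, ht, htl⟩ := hc' l hl
    exact Or.inr ⟨t, ht, key h htl⟩

end RealGeodesics

/-! ### The degenerate case: the Cayley graph is a tree -/

section TreeLike

open CayleyGraph

variable {α : Type*} {R : Finset (GenWord α)}

/-- A form all of whose integrals along closed paths vanish has a potential. -/
theorem exists_potential_of_lineIntegral_eq_zero {φ : GroupOf R → α × Bool → ℝ}
    (h : ∀ w, wordValue R w = 1 → lineIntegral φ 1 w = 0) :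
    ∃ f : GroupOf R → ℝ, ∀ w, f (wordValue R w) = lineIntegral φ 1 w := by
  choose w hw _ using fun g : GroupOf R => exists_word g
  refine ⟨fun g => lineIntegral φ 1 (w g), fun u => ?_⟩
  have key : ∀ u₁ : GenWord α, wordValue R u₁ = wordValue R u →
      lineIntegral φ 1 u₁ + lineIntegral φ (wordValue R u) (FreeGroup.invRev u) = 0 := by
    intro u₁ h₁
    have h2 := h (u₁ ++ FreeGroup.invRev u) (by
      rw [wordValue_append, wordValue_invRev, h₁, mul_inv_cancel])
    rwa [lineIntegral_append, one_mul, h₁] at h2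
  have h1 := key (w (wordValue R u)) (hw _)
  have h2 := key u rfl
  linarith

open Classical in
/-- The form that counts the passages through the edge that starts at `g₀` with the label `x₀`. -/
def edgeForm (g₀ : GroupOf R) (x₀ : α) (g : GroupOf R) : α × Bool → ℝ
  | (x, true) => if g = g₀ ∧ x = x₀ then 1 else 0
  | (x, false) => -if g * wordValue R [(x, false)] = g₀ ∧ x = x₀ then 1 else 0

theorem edgeForm_isAlternating (g₀ : GroupOf R) (x₀ : α) : IsAlternating (edgeForm g₀ x₀) := by
  classical
  rintro g ⟨x, b⟩
  have h : g * wordValue R [(x, b)] * wordValue R [(x, !b)] = g := by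
    have := wordValue_invLetter (R := R) (x, b)
    rw [invLetter] at this
    rw [this, mul_inv_cancel_right]
  cases b
  · simp only [invLetter, Bool.not_false, edgeForm, neg_neg]
  · simp only [Bool.not_true] at h
    simp only [invLetter, Bool.not_true, edgeForm]
    exact congrArg Neg.neg (if_congr (by rw [h]) rfl rfl)

/-- The height function of an edge: the signed number of passages of a path through the edge. -/
structure EdgeHeight (R : Finset (GenWord α)) (g₀ : GroupOf R) (x₀ : α) where
  toFun : GroupOf R → ℝ
  map_edge : toFun (g₀ * PresentedGroup.of x₀) = toFun g₀ + 1
  map_other : ∀ g x, ¬ (g = g₀ ∧ x = x₀) → toFun (g * PresentedGroup.of x) = toFun g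
  exists_intCast : ∀ g, ∃ n : ℤ, toFun g = n
  abs_sub_le : ∀ g h, |toFun g - toFun h| ≤ vertexDist g h

/-- The counting form of a single edge is exact because its closed integrals vanish. Its potential
separates the two sides of the edge. -/
theorem LinearIsoperimetric.nonempty_edgeHeight {C : ℝ} (hR : LinearIsoperimetric R C)
    (hC : 1 < C ∨ maxRelatorLength R = 0) (g₀ : GroupOf R) (x₀ : α) :
    Nonempty (EdgeHeight R g₀ x₀) := by
  classical
  obtain ⟨f, hf⟩ := exists_potential_of_lineIntegral_eq_zero (φ := edgeForm g₀ x₀)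
    fun w hw => hR.lineIntegral_eq_zero hC (edgeForm_isAlternating g₀ x₀) _ w rfl hw 1
  have hstep : ∀ g x, f (g * wordValue R [x]) = f g + edgeForm g₀ x₀ g x := by
    intro g x
    obtain ⟨w, rfl, -⟩ := exists_word g
    rw [← wordValue_append, hf, hf, lineIntegral_append, one_mul, lineIntegral, lineIntegral,
      add_zero]
  have hval : ∀ g x, edgeForm g₀ x₀ g x = 1 ∨ edgeForm g₀ x₀ g x = 0 ∨
      edgeForm g₀ x₀ g x = -1 := by
    rintro g ⟨x, _ | _⟩ <;> simp only [edgeForm] <;> split_ifs <;> simp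
  have hof : ∀ x : α, (PresentedGroup.of x : GroupOf R) = wordValue R [(x, true)] := fun _ => rfl
  refine ⟨⟨f, ?_, fun g x hgx => ?_, fun g => ?_, fun g h => ?_⟩⟩
  · rw [hof, hstep, edgeForm, if_pos ⟨rfl, rfl⟩]
  · rw [hof, hstep, edgeForm, if_neg hgx, add_zero]
  · obtain ⟨w, rfl, -⟩ := exists_word g
    induction w using List.reverseRecOn with
    | nil => exact ⟨0, by rw [hf, lineIntegral, Int.cast_zero]⟩
    | append_singleton w x ih =>
      obtain ⟨n, hn⟩ := ih
      rw [wordValue_append, hstep, hn]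
      rcases hval (wordValue R w) x with h | h | h <;> rw [h]
      · exact ⟨n + 1, by push_cast; ring⟩
      · exact ⟨n, by ring⟩
      · exact ⟨n - 1, by push_cast; ring⟩
  · obtain ⟨u, rfl, hu⟩ := exists_word_between g h
    rw [← hu]
    clear hu
    induction u using List.reverseRecOn with
    | nil => simp [wordValue_nil]
    | append_singleton u x ih =>
      rw [wordValue_append, ← mul_assoc, hstep, List.length_append, List.length_singleton]
      rw [abs_le] at ih ⊢
      push_cast
      rcases hval (g * wordValue R u) x with h | h | h <;> rw [h] <;>
        constructor <;> linarith [ih.1, ih.2]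

namespace EdgeHeight

variable {g₀ : GroupOf R} {x₀ : α} (f : EdgeHeight R g₀ x₀)

/-- The extension of the height function to the Cayley graph. -/
def extend (p : CayleyGraph R) : ℝ :=
  f.toFun p.base + p.t * (f.toFun (p.base * PresentedGroup.of p.gen) - f.toFun p.base)

theorem abs_slope_le (p : CayleyGraph R) :
    |f.toFun (p.base * PresentedGroup.of p.gen) - f.toFun p.base| ≤ 1 := by
  by_cases h : p.base = g₀ ∧ p.gen = x₀
  · rw [h.1, h.2, f.map_edge, add_sub_cancel_left, abs_one]
  · rw [f.map_other _ _ h, sub_self, abs_zero]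
    exact zero_le_one

theorem abs_extend_sub_le (p : CayleyGraph R) (i : Bool) :
    |f.extend p - f.toFun (p.endpoint i)| ≤ p.offset i := by
  have h := f.abs_slope_le p
  set σ := f.toFun (p.base * PresentedGroup.of p.gen) - f.toFun p.base with hσ
  cases i
  · have : f.extend p - f.toFun (p.endpoint false) = p.t * σ := by
      simp only [extend, endpoint, hσ]
      ring
    rw [this, abs_mul, abs_of_nonneg p.t_nonneg]
    exact mul_le_of_le_one_right p.t_nonneg h
  · have : f.extend p - f.toFun (p.endpoint true) = -((1 - p.t) * σ) := by
      simp only [extend, endpoint, hσ]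
      ring
    have h1 : 0 ≤ 1 - p.t := by linarith [p.t_le_one]
    rw [this, abs_neg, abs_mul, abs_of_nonneg h1]
    exact mul_le_of_le_one_right h1 h

theorem dist_extend_le (p q : CayleyGraph R) : dist (f.extend p) (f.extend q) ≤ dist p q := by
  rw [Real.dist_eq, dist_eq]
  rcases graphDist_cases p q with h | ⟨hb, hg, h⟩
  · obtain ⟨i, j, hij⟩ := exists_throughDist p q
    rw [h, hij]
    have h1 := abs_le.1 (f.abs_extend_sub_le p i)
    have h2 := abs_le.1 (f.abs_extend_sub_le q j)
    have h3 := abs_le.1 (f.abs_sub_le (p.endpoint i) (q.endpoint j))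
    exact abs_le.2 ⟨by linarith [h1.1, h2.2, h3.1], by linarith [h1.2, h2.1, h3.2]⟩
  · have : f.extend p - f.extend q =
        (p.t - q.t) * (f.toFun (q.base * PresentedGroup.of q.gen) - f.toFun q.base) := by
      simp only [extend, hb, hg]
      ring
    rw [h, this, abs_mul]
    exact mul_le_of_le_one_right (abs_nonneg _) (f.abs_slope_le q)

theorem extend_of_eq {p : CayleyGraph R} (hb : p.base = g₀) (hg : p.gen = x₀) :
    f.extend p = f.toFun g₀ + p.t := by
  rw [extend, hb, hg, f.map_edge]
  ring

/-- The interior points of the edge are determined by their height. -/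
theorem dist_eq_zero {p q : CayleyGraph R} (hb : p.base = g₀) (hg : p.gen = x₀) (h0 : 0 < p.t)
    (h1 : p.t < 1) (h : f.extend q = f.extend p) : dist p q = 0 := by
  rw [f.extend_of_eq hb hg] at h
  by_cases hq : q.base = g₀ ∧ q.gen = x₀
  · rw [f.extend_of_eq hq.1 hq.2] at h
    exact dist_eq_zero_of_eq (hb.trans hq.1.symm) (hg.trans hq.2.symm) (by linarith)
  -- Off the edge the height is an integer, whereas at an interior point of the edge it lies
  -- strictly between consecutive integers.
  · exfalso
    rw [extend, f.map_other _ _ hq, sub_self, mul_zero, add_zero] at h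
    obtain ⟨m, hm⟩ := f.exists_intCast q.base
    obtain ⟨n, hn⟩ := f.exists_intCast g₀
    rw [hm, hn] at h
    have h2 : (n : ℝ) < m := by linarith
    have h3 : (m : ℝ) < n + 1 := by linarith
    have h4 : n < m := by exact_mod_cast h2
    have h5 : m < n + 1 := by exact_mod_cast h3
    omega

theorem continuousOn_extend {γ : ℝ → CayleyGraph R} {L : ℝ} {x y : CayleyGraph R}
    (hγ : IsGeodesic γ L x y) : ContinuousOn (fun s => f.extend (γ s)) (Set.Icc 0 L) := by
  refine LipschitzOnWith.continuousOn (K := 1) (LipschitzOnWith.of_dist_le_mul fun s hs t ht => ?_)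
  rw [NNReal.coe_one, one_mul, Real.dist_eq s t, ← hγ.isometry s hs t ht]
  exact f.dist_extend_le _ _

theorem exists_extend_eq {γ : ℝ → CayleyGraph R} {L : ℝ} {x y : CayleyGraph R}
    (hγ : IsGeodesic γ L x y) {c : ℝ} (hc : (f.extend x - c) * (f.extend y - c) ≤ 0) :
    ∃ t ∈ Set.Icc 0 L, f.extend (γ t) = c := by
  have hcont := f.continuousOn_extend hγ
  rw [← Set.uIcc_of_le hγ.nonneg] at hcont ⊢
  refine intermediate_value_uIcc hcont ?_
  simp only [hγ.source, hγ.target]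
  rw [Set.mem_uIcc]
  rcases mul_nonpos_iff.1 hc with h | h
  · exact Or.inr ⟨by linarith [h.2], by linarith [h.1]⟩
  · exact Or.inl ⟨by linarith [h.1], by linarith [h.2]⟩

/-- A geodesic that passes through an interior point of the edge crosses its level. -/
theorem mul_neg_of_geodesic {γ : ℝ → CayleyGraph R} {L : ℝ} {x y : CayleyGraph R}
    (hγ : IsGeodesic γ L x y) {s : ℝ} (hs0 : 0 < s) (hsL : s < L) (hb : (γ s).base = g₀)
    (hg : (γ s).gen = x₀) (h0 : 0 < (γ s).t) (h1 : (γ s).t < 1) :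
    (f.extend x - f.extend (γ s)) * (f.extend y - f.extend (γ s)) < 0 := by
  have hs : s ∈ Set.Icc 0 L := ⟨hs0.le, hsL.le⟩
  have hinj : ∀ t ∈ Set.Icc 0 L, f.extend (γ t) = f.extend (γ s) → t = s := by
    intro t ht h
    have h2 := f.dist_eq_zero hb hg h0 h1 h
    rw [hγ.isometry s hs t ht, abs_eq_zero] at h2
    linarith
  obtain ⟨η, hη0, hη⟩ : ∃ η, 0 < η ∧ η < min (min s (L - s)) (min (γ s).t (1 - (γ s).t)) :=
    exists_between (lt_min (lt_min hs0 (by linarith)) (lt_min h0 (by linarith)))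
  rw [lt_min_iff, lt_min_iff] at hη
  have hnear : ∀ t ∈ Set.Icc 0 L, |s - t| = η → (γ t).base = g₀ ∧ (γ t).gen = x₀ ∧
      |(γ s).t - (γ t).t| = η := by
    intro t ht hst
    have h2 := hγ.isometry s hs t ht
    obtain ⟨h3, h4, h5⟩ := eq_of_dist_lt (p := γ s) (q := γ t) (by rw [h2, hst]; exact hη.2)
    exact ⟨h3.symm.trans hb, h4.symm.trans hg, by rw [← h5, h2, hst]⟩
  have hm : s - η ∈ Set.Icc 0 L := ⟨by linarith [hη.1.1], by linarith⟩
  have hp : s + η ∈ Set.Icc 0 L := ⟨by linarith, by linarith [hη.1.2]⟩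
  obtain ⟨hmb, hmg, hmt⟩ := hnear _ hm (by rw [sub_sub_cancel, abs_of_pos hη0])
  obtain ⟨hpb, hpg, hpt⟩ := hnear _ hp (by rw [sub_add_cancel_left, abs_neg, abs_of_pos hη0])
  have hne : (γ (s - η)).t ≠ (γ (s + η)).t := by
    intro h
    have h2 := dist_eq_zero_of_eq (hmb.trans hpb.symm) (hmg.trans hpg.symm) h
    rw [hγ.isometry _ hm _ hp, abs_eq_zero] at h2
    linarith
  -- The points at parameters s ± η lie on the same edge at distance η from γ(s), and they differ;
  -- so they lie on opposite sides of it.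
  have hcross : (f.extend (γ (s - η)) - f.extend (γ s)) *
      (f.extend (γ (s + η)) - f.extend (γ s)) < 0 := by
    rw [f.extend_of_eq hb hg, f.extend_of_eq hmb hmg, f.extend_of_eq hpb hpg]
    rcases abs_eq hη0.le |>.1 hmt with h2 | h2 <;> rcases abs_eq hη0.le |>.1 hpt with h3 | h3
    · exact absurd (by linarith) hne
    · nlinarith
    · nlinarith
    · exact absurd (by linarith) hne
  -- The geodesic meets the level of γ(s) only at `s`, so the height stays on one side of it on any
  -- interval that avoids `s`.
  have hsame : ∀ t t', t ≤ t' → Set.Icc t t' ⊆ Set.Icc 0 L → s ∉ Set.Icc t t' →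
      0 < (f.extend (γ t) - f.extend (γ s)) * (f.extend (γ t') - f.extend (γ s)) := by
    intro t t' htt hsub hns
    by_contra! hcon
    have hcont := (f.continuousOn_extend hγ).mono hsub
    rw [← Set.uIcc_of_le htt] at hcont hns hsub
    have hmem : f.extend (γ s) ∈ Set.uIcc (f.extend (γ t)) (f.extend (γ t')) := by
      rw [Set.mem_uIcc]
      rcases mul_nonpos_iff.1 hcon with h | h
      · exact Or.inr ⟨by linarith [h.2], by linarith [h.1]⟩
      · exact Or.inl ⟨by linarith [h.1], by linarith [h.2]⟩
    obtain ⟨r, hr, hrs⟩ := intermediate_value_uIcc hcont hmem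
    exact hns (hinj r (hsub hr) hrs ▸ hr)
  have hx := hsame 0 (s - η) hm.1 (Set.Icc_subset_Icc le_rfl hm.2) fun h => by linarith [h.2]
  have hy := hsame (s + η) L hp.2 (Set.Icc_subset_Icc hp.1 le_rfl) fun h => by linarith [h.1]
  rw [hγ.source] at hx
  rw [hγ.target] at hy
  generalize f.extend x - f.extend (γ s) = X at *
  generalize f.extend y - f.extend (γ s) = Y at *
  generalize f.extend (γ (s - η)) - f.extend (γ s) = U at *
  generalize f.extend (γ (s + η)) - f.extend (γ s) = V at *
  have h2 : 0 < (X * Y) * (U * V) := by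
    have := mul_pos hx hy
    rwa [show X * U * (V * Y) = (X * Y) * (U * V) by ring] at this
  exact neg_of_mul_pos_left h2 hcross.le

end EdgeHeight

theorem IsGeodesic.exists_isMinOn_dist {γ : ℝ → CayleyGraph R} {L : ℝ} {x y : CayleyGraph R}
    (hγ : IsGeodesic γ L x y) (p : CayleyGraph R) :
    ∃ t ∈ Set.Icc 0 L, ∀ t' ∈ Set.Icc 0 L, dist p (γ t) ≤ dist p (γ t') := by
  have hcont : ContinuousOn γ (Set.Icc 0 L) :=
    LipschitzOnWith.continuousOn (K := 1) (LipschitzOnWith.of_dist_le_mul fun s hs t ht => by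
      rw [NNReal.coe_one, one_mul, hγ.isometry s hs t ht, Real.dist_eq])
  obtain ⟨t, ht, hmin⟩ := isCompact_Icc.exists_isMinOn ⟨0, le_rfl, hγ.nonneg⟩
    ((continuous_const.dist continuous_id).comp_continuousOn hcont : ContinuousOn (fun t => dist p (γ t)) _)
  exact ⟨t, ht, fun t' ht' => hmin ht'⟩

/-- If all closed line integrals vanish then the Cayley graph is a tree. -/
theorem LinearIsoperimetric.ripsHyperbolic_zero {C : ℝ} (hR : LinearIsoperimetric R C)
    (hC : 1 < C ∨ maxRelatorLength R = 0) : RipsHyperbolic (CayleyGraph R) 0 := by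
  intro x y z γ₁ γ₂ γ₃ L₁ L₂ L₃ h₁ h₂ h₃ s hs
  -- The level separates `x` from `y`, so wherever `z` lies one of the other two sides crosses it,
  -- and the crossing can only be the point itself.
  have interior : ∀ r, 0 < r → r < L₁ → ¬ (γ₁ r).IsVertex →
      (∃ t ∈ Set.Icc 0 L₂, dist (γ₁ r) (γ₂ t) = 0) ∨
        (∃ t ∈ Set.Icc 0 L₃, dist (γ₁ r) (γ₃ t) = 0) := by
    intro r hr0 hrL hr
    obtain ⟨h0, h1⟩ := not_isVertex hr
    obtain ⟨f⟩ := hR.nonempty_edgeHeight hC (γ₁ r).base (γ₁ r).gen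
    have hneg := f.mul_neg_of_geodesic h₁ hr0 hrL rfl rfl h0 h1
    by_cases hz : (f.extend y - f.extend (γ₁ r)) * (f.extend z - f.extend (γ₁ r)) ≤ 0
    · obtain ⟨t, ht, hft⟩ := f.exists_extend_eq h₂ hz
      exact Or.inl ⟨t, ht, f.dist_eq_zero rfl rfl h0 h1 hft⟩
    · have hz' : (f.extend z - f.extend (γ₁ r)) * (f.extend x - f.extend (γ₁ r)) ≤ 0 := by
        generalize f.extend x - f.extend (γ₁ r) = X at *
        generalize f.extend y - f.extend (γ₁ r) = Y at *
        generalize f.extend z - f.extend (γ₁ r) = Z at *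
        by_contra! hcon
        have := mul_pos hcon (not_le.1 hz)
        rw [show Z * X * (Y * Z) = (X * Y) * Z ^ 2 by ring] at this
        nlinarith [sq_nonneg Z]
      obtain ⟨t, ht, hft⟩ := f.exists_extend_eq h₃ hz'
      exact Or.inr ⟨t, ht, f.dist_eq_zero rfl rfl h0 h1 hft⟩
  rcases hs.1.eq_or_lt with rfl | hs0
  · refine Or.inr ⟨L₃, ⟨h₃.nonneg, le_rfl⟩, ?_⟩
    rw [h₁.source, h₃.target, dist_self]
  rcases hs.2.eq_or_lt with rfl | hsL
  · refine Or.inl ⟨0, ⟨le_rfl, h₂.nonneg⟩, ?_⟩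
    rw [h₁.target, h₂.source, dist_self]
  by_cases hv : (γ₁ s).IsVertex
  -- A vertex is approximated by interior points of the next edge, which lie on the other sides.
  -- Compactness makes the distances to these sides attained, so they cannot both be positive.
  · obtain ⟨t₂, ht₂, hmin₂⟩ := h₂.exists_isMinOn_dist (γ₁ s)
    obtain ⟨t₃, ht₃, hmin₃⟩ := h₃.exists_isMinOn_dist (γ₁ s)
    by_contra! hcon
    have hp₂ := hcon.1 t₂ ht₂
    have hp₃ := hcon.2 t₃ ht₃
    obtain ⟨η, hη0, hη⟩ : ∃ η, 0 < η ∧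
        η < min (min 1 (L₁ - s)) (min (dist (γ₁ s) (γ₂ t₂)) (dist (γ₁ s) (γ₃ t₃))) :=
      exists_between (lt_min (lt_min one_pos (by linarith)) (lt_min hp₂ hp₃))
    simp only [lt_min_iff] at hη
    have hmem : s + η ∈ Set.Icc 0 L₁ := ⟨by linarith, by linarith [hη.1.2]⟩
    have hdist : dist (γ₁ s) (γ₁ (s + η)) = η := by
      rw [h₁.isometry s hs _ hmem, sub_add_cancel_left, abs_neg, abs_of_pos hη0]
    have hnv : ¬ (γ₁ (s + η)).IsVertex := fun hv' => by
      obtain ⟨n, hn⟩ := hv.exists_dist_eq_natCast hv'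
      rw [hdist] at hn
      have h1 : (0 : ℝ) < n := hn ▸ hη0
      have h2 : (n : ℝ) < (1 : ℕ) := by rw [Nat.cast_one, ← hn]; exact hη.1.1
      have h3 : 0 < n := by exact_mod_cast h1
      have h4 : n < 1 := Nat.cast_lt.1 h2
      omega
    rcases interior (s + η) (by linarith) (by linarith [hη.1.2]) hnv with ⟨t, ht, h⟩ | ⟨t, ht, h⟩
    · have := dist_triangle (γ₁ s) (γ₁ (s + η)) (γ₂ t)
      linarith [hmin₂ t ht, hη.2.1]
    · have := dist_triangle (γ₁ s) (γ₁ (s + η)) (γ₃ t)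
      linarith [hmin₃ t ht, hη.2.2]
  · rcases interior s hs0 hsL hv with ⟨t, ht, h⟩ | ⟨t, ht, h⟩
    · exact Or.inl ⟨t, ht, h.le⟩
    · exact Or.inr ⟨t, ht, h.le⟩

end TreeLike

theorem RipsHyperbolic.mono {X : Type*} [PseudoMetricSpace X] {δ δ' : ℝ} (h : RipsHyperbolic X δ)
    (hδ : δ ≤ δ') : RipsHyperbolic X δ' := by
  intro x y z γ₁ γ₂ γ₃ L₁ L₂ L₃ h₁ h₂ h₃ s hs
  rcases h x y z γ₁ γ₂ γ₃ L₁ L₂ L₃ h₁ h₂ h₃ s hs with ⟨t, ht, hd⟩ | ⟨t, ht, hd⟩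
  · exact Or.inl ⟨t, ht, hd.trans hδ⟩
  · exact Or.inr ⟨t, ht, hd.trans hδ⟩

end

theorem mainTheorem4 {α : Type*} [Finite α] (R : Finset (GenWord α)) (C : ℝ) (hC : 0 < C)
    (hR : ∀ D : VanKampenDiagram R, D.IsMinimal → C * (D.area : ℝ) ≤ (D.boundaryLength : ℝ)) :
    RipsHyperbolic (CayleyGraph R) (12 * (maxRelatorLength R : ℝ) / C ^ 2) := by
  have hiso : LinearIsoperimetric R C := hR
  by_cases hC1 : 1 < C ∨ maxRelatorLength R = 0
  · exact (hiso.ripsHyperbolic_zero hC1).mono (by positivity)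
  -- Now C ≤ 1 ≤ λ, so a = λ/C ≥ 1, and 12λ/C ≤ 12λ/C².
  · rw [not_or, not_lt] at hC1
    have hlen : (1 : ℝ) ≤ maxRelatorLength R := by
      exact_mod_cast Nat.one_le_iff_ne_zero.2 hC1.2
    refine (hiso.ripsHyperbolic hC (a := maxRelatorLength R / C) ?_ ?_).mono ?_
    · rw [le_div_iff₀ hC]
      linarith [hC1.1]
    · field_simp
    · rw [mul_div_assoc]
      refine mul_le_mul_of_nonneg_left ?_ (by norm_num)
      refine div_le_div_of_nonneg_left (Nat.cast_nonneg _) (by positivity) ?_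
      nlinarith [hC1.1]
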